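/- Let $H$ be a finite-dimensional Hopf algebra over a field $\Bbbk$, with comultiplication $\Delta$, counit $\varepsilon$ and antipode $S$. A *2-cocycle* of $H$ is an invertible element $F=\sum f^{1}\otimes f^{2}\in H\otimes H$ with $(\varepsilon\otimes\mathrm{id})(F)=(\mathrm{id}\otimes\varepsilon)(F)=1$ and $(F\otimes 1)(\Delta\otimes\mathrm{id})(F)=(1\otimes F)(\mathrm{id}\otimes\Delta)(F)$. The *twist* $H_F$ is the Hopf algebra with the algebra structure and counit of $H$, comultiplication $\Delta_F(h)=F\Delta(h)F^{-1}$ and antipode $S_F(h)=uS(h)u^{-1}$, where $u=\sum f^{1}S(f^{2})$. Let $n>k>0$ be coprime integers with $n-k$ odd, and put $k_0=(n-k-1)/2$. For $a\in\mathbb Z$ let $\overline a\in\{1,\dots,n\}$ be its representative modulo $n$. There are unique integers $c_1,\dots,c_n$ with $c_n=0$ and $$c_{\overline{i+k}}=\begin{cases}c_i+1 & (1\le i\le k_0),\\ c_i-1 & (k_0<i\le 2k_0),\\ c_i & (2k_0<i\le n).\end{cases}$$ With $\sigma(t)=\overline{-tk}$, a permutation of $\{1,\dots,n-1\}$, define the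 linear endomorphism $P^{(n,-k)}$ of $H$ by $$P^{(n,-k)}(x)=\sum\prod_{t=1}^{n-1}S^{2c_{\sigma(t)}}\bigl(x_{(\sigma(t))}\bigr)\quad(\text{product in the order }t=1,\dots,n-1),\qquad \Delta^{(n-1)}(x)=\sum x_{(1)}\otimes\cdots\otimes x_{(n-1)},$$ where $\Delta^{(n-1)}:H\to H^{\otimes(n-1)}$ is the iterated comultiplication ($\Delta^{(1)}=\mathrm{id}$). Let $P_F^{(n,-k)}$ be the same endomorphism formed in $H_F$. Then, for every 2-cocycle $F$ of $H$, $$\operatorname{Tr}\bigl(S\circ P^{(n,-k)}\bigr)=\operatorname{Tr}\bigl(S_F\circ P_F^{(n,-k)}\bigr).$$ Moreover, $K(L(n,k),f_R,H)=K(L(n,k),f_R,H_F)$, where $f_R$ is the framing of the lens space $L(n,k)$ and $K$ the Kuperberg invariant that are given as follows. *Kuperberg invariant of a genus-one framed Heegaard diagram.* A choice of normalized integrals of $H$ consists of $\Lambda\in H$ and $\lambda\in H^*$ with $h\Lambda=\varepsilon(h)\Lambda$ and $\sum\lambda(h_{(1)})h_{(2)}=\lambda(h)1$ for all $h\in H$,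 and $\lambda(\Lambda)=1$. It determines $\alpha\in H^*$ and $g\in H$ by $\Lambda h=\alpha(h)\Lambda$ and $\sum h_{(1)}\lambda(h_{(2)})=\lambda(h)g$. For an integer $m$ put $$\Lambda_{m-1/2}=\sum S(\Lambda)_{(1)}\,\alpha^{-m}(S(\Lambda)_{(2)}),\qquad \lambda_{m-1/2}(x)=\lambda(xg^m),\qquad T(x)=\sum\alpha^{-1}(x_{(1)})\,S^{-2}(x_{(2)})\,\alpha(x_{(3)}),$$ with powers of $\alpha$ in the convolution algebra $H^*$. Suppose the lower curve $\eta$ meets the upper curve $\mu$ successively in $p_1,\dots,p_n$, and $\mu$ meets them in the order $p_{\tau(1)},\dots,p_{\tau(n)}$. Let $\theta_\eta(p_r),\theta_\mu(p_r)$ be the rotations of the tangents relative to the first combing, in full turns, from the base point of the curve to $p_r$; let $\phi_\eta(p_r),\phi_\mu(p_r)$ be the corresponding rotations of the second combing; and let $\theta_\eta,\theta_\mu,\phi_\eta,\phi_\mu$ be the totals along the full curves. With $s_r=2(\theta_\eta(p_r)-\theta_\mu(p_r))+\tfrac12$ and $t_r=\phi_\eta(p_r)-\phi_\mu(p_r)$,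 $$K=\lambda_{-\theta_\mu}\Bigl(\sum y^{(\tau(1))}\cdots y^{(\tau(n))}\Bigr),\qquad \sum y^{(1)}\otimes\cdots\otimes y^{(n)}=\Bigl(\bigotimes_{r=1}^{n}S^{s_r}T^{t_r}\Bigr)\Delta^{(n)}\bigl(\Lambda_{\theta_\eta}\bigr).$$ *The diagram of $(L(n,k),f_R)$.* It is the genus-one diagram with $n$ intersection points and $\tau(r)=\overline{k(r-1)}$, with $\theta_\eta(p_i)=0$ for $i<n$, $\theta_\eta(p_n)=\tfrac14$, $\theta_\eta=\phi_\eta=\tfrac12$, $\phi_\mu=-\tfrac12$, and $\phi_\eta(p_i)=\phi_\mu(p_i)=0$ for all $i$. The rotation $\theta_\mu$ is $0$ at $p_n$, the first point of $\mu$. Along the arc of $\mu$ that leaves $p_i$ (towards $p_{\overline{i+k}}$ for $i\neq n-k$, and back to the base point for $i=n-k$) it increases by $-\tfrac14$ if $i=n$, by $-1$ if $1\le i\le k_0$, by $1$ if $k_0<i<n-k$, by $\tfrac34$ if $i=n-k$, and by $0$ if $n-k<i<n$. So $\theta_\mu=\tfrac12$. Normalized integrals exist for $H$ and for $H_F$,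 and the equality of Kuperberg invariants holds for every choice of them. -/

import Mathlib

open scoped TensorProduct

/-- A 2-cocycle of `H`: an invertible `F ∈ H ⊗ H` with `(ε ⊗ id) F = (id ⊗ ε) F = 1` and
`1 = (1 ⊗ F) (id ⊗ Δ)(F) (Δ ⊗ id)(F⁻¹) (F⁻¹ ⊗ 1)`, the last identity being written in
`H ⊗ (H ⊗ H)`. -/
structure TwoCocycle (𝕜 H : Type*) [Field 𝕜] [Ring H] [HopfAlgebra 𝕜 H] where
  toUnits : (H ⊗[𝕜] H)ˣ
  counit_left : TensorProduct.lid 𝕜 H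
    ((Coalgebra.counit (R := 𝕜) (A := H)).rTensor H (toUnits : H ⊗[𝕜] H)) = 1
  counit_right : TensorProduct.rid 𝕜 H
    ((Coalgebra.counit (R := 𝕜) (A := H)).lTensor H (toUnits : H ⊗[𝕜] H)) = 1
  cocycle :
    (1 : H ⊗[𝕜] (H ⊗[𝕜] H)) =
      ((1 : H) ⊗ₜ[𝕜] (toUnits : H ⊗[𝕜] H))
        * (Coalgebra.comul (R := 𝕜) (A := H)).lTensor H (toUnits : H ⊗[𝕜] H)
        * TensorProduct.assoc 𝕜 H H H
            ((Coalgebra.comul (R := 𝕜) (A := H)).rTensor H ((toUnits⁻¹ : (H ⊗[𝕜] H)ˣ) : H ⊗[𝕜] H))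
        * TensorProduct.assoc 𝕜 H H H (((toUnits⁻¹ : (H ⊗[𝕜] H)ˣ) : H ⊗[𝕜] H) ⊗ₜ[𝕜] (1 : H))

namespace TwoCocycle

variable {𝕜 H : Type*} [Field 𝕜] [Ring H] [HopfAlgebra 𝕜 H]

/-- The twisted comultiplication `h ↦ F Δ(h) F⁻¹`. -/
noncomputable def twistComul (F : TwoCocycle 𝕜 H) : H →ₐ[𝕜] H ⊗[𝕜] H :=
  AlgHom.ofLinearMap
    (LinearMap.mulLeftRight 𝕜
        ((F.toUnits : H ⊗[𝕜] H), ((F.toUnits⁻¹ : (H ⊗[𝕜] H)ˣ) : H ⊗[𝕜] H))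
      ∘ₗ Coalgebra.comul)
    (by simp)
    (by
      intro x y
      simp only [LinearMap.comp_apply, LinearMap.mulLeftRight_apply, Bialgebra.comul_mul]
      simp [mul_assoc])

theorem twistComul_apply (F : TwoCocycle 𝕜 H) (h : H) :
    F.twistComul h = (F.toUnits : H ⊗[𝕜] H) * Coalgebra.comul (R := 𝕜) h *
      ((F.toUnits⁻¹ : (H ⊗[𝕜] H)ˣ) : H ⊗[𝕜] H) := rfl

/-- `u = ∑ f¹ S(f²)` for `F = ∑ f¹ ⊗ f²`. -/
noncomputable def u (F : TwoCocycle 𝕜 H) : H :=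
  LinearMap.mul' 𝕜 H ((HopfAlgebra.antipode 𝕜 (A := H)).lTensor H (F.toUnits : H ⊗[𝕜] H))

/-- `∑ S(d¹) d²` for `F⁻¹ = ∑ d¹ ⊗ d²`; it is the inverse of `u`. -/
noncomputable def uInv (F : TwoCocycle 𝕜 H) : H :=
  LinearMap.mul' 𝕜 H ((HopfAlgebra.antipode 𝕜 (A := H)).rTensor H
    ((F.toUnits⁻¹ : (H ⊗[𝕜] H)ˣ) : H ⊗[𝕜] H))

/-- The twisted antipode `h ↦ u S(h) u⁻¹`. -/
noncomputable def twistAntipode (F : TwoCocycle 𝕜 H) : H →ₗ[𝕜] H :=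
  LinearMap.mulLeftRight 𝕜 (F.u, F.uInv) ∘ₗ HopfAlgebra.antipode 𝕜

open Coalgebra HopfAlgebra

/-- `a ⊗ b ↦ S(a) w b`. -/
noncomputable def sandwichLeft (w : H) : H ⊗[𝕜] H →ₗ[𝕜] H :=
  LinearMap.mul' 𝕜 H ∘ₗ (LinearMap.mulRight 𝕜 w ∘ₗ antipode 𝕜 (A := H)).rTensor H

/-- `a ⊗ b ↦ a w S(b)`. -/
noncomputable def sandwichRight (w : H) : H ⊗[𝕜] H →ₗ[𝕜] H :=
  LinearMap.mul' 𝕜 H ∘ₗ (LinearMap.mulLeft 𝕜 w ∘ₗ antipode 𝕜 (A := H)).lTensor H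

theorem sandwichLeft_mul (w : H) (X Y : H ⊗[𝕜] H) :
    sandwichLeft w (X * Y) = sandwichLeft (sandwichLeft w X) Y := by
  induction X with
  | zero => induction Y with
    | zero => simp
    | tmul c d => simp [sandwichLeft]
    | add x y hx hy => rw [mul_add, map_add, map_add, hx, hy]
  | tmul a b => induction Y with
    | zero => simp
    | tmul c d => simp [sandwichLeft, antipode_mul_antidistrib, mul_assoc]
    | add x y hx hy => rw [mul_add, map_add, map_add, hx, hy]
  | add x y hx hy =>
    have : sandwichLeft (𝕜 := 𝕜) (sandwichLeft w (x + y)) Y =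
        sandwichLeft (sandwichLeft w x) Y + sandwichLeft (sandwichLeft w y) Y := by
      rw [map_add]
      clear hx hy
      induction Y with
      | zero => simp
      | tmul c d => simp [sandwichLeft, mul_add, add_mul]
      | add a b ha hb => rw [map_add, map_add, map_add, ha, hb]; abel
    rw [this, add_mul, map_add, hx, hy]

theorem sandwichRight_mul (w : H) (X Y : H ⊗[𝕜] H) :
    sandwichRight w (X * Y) = sandwichRight (sandwichRight w Y) X := by
  induction Y with
  | zero => induction X with
    | zero => simp
    | tmul c d => simp [sandwichRight]
    | add x y hx hy => rw [add_mul, map_add, map_add, hx, hy]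
  | tmul a b => induction X with
    | zero => simp
    | tmul c d => simp [sandwichRight, antipode_mul_antidistrib, mul_assoc]
    | add x y hx hy => rw [add_mul, map_add, map_add, hx, hy]
  | add x y hx hy =>
    have : sandwichRight (𝕜 := 𝕜) (sandwichRight w (x + y)) X =
        sandwichRight (sandwichRight w x) X + sandwichRight (sandwichRight w y) X := by
      rw [map_add]
      clear hx hy
      induction X with
      | zero => simp
      | tmul c d => simp [sandwichRight, mul_add, add_mul]
      | add a b ha hb => rw [map_add, map_add, map_add, ha, hb]; abel
    rw [this, mul_add, map_add, hx, hy]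

theorem sandwichLeft_smul (c : 𝕜) (X : H ⊗[𝕜] H) :
    sandwichLeft (c • (1 : H)) X = c • sandwichLeft 1 X := by
  induction X with
  | zero => simp
  | tmul a b => simp [sandwichLeft]
  | add x y hx hy => simp [hx, hy]

theorem sandwichRight_smul (c : 𝕜) (X : H ⊗[𝕜] H) :
    sandwichRight (c • (1 : H)) X = c • sandwichRight 1 X := by
  induction X with
  | zero => simp
  | tmul a b => simp [sandwichRight]
  | add x y hx hy => simp [hx, hy]

theorem sandwichLeft_comul (h : H) :
    sandwichLeft 1 (comul (R := 𝕜) h) = counit (R := 𝕜) h • (1 : H) := by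
  have := mul_antipode_rTensor_comul_apply (R := 𝕜) h
  rw [Algebra.algebraMap_eq_smul_one] at this
  simpa [sandwichLeft] using this

theorem sandwichRight_comul (h : H) :
    sandwichRight 1 (comul (R := 𝕜) h) = counit (R := 𝕜) h • (1 : H) := by
  have := mul_antipode_lTensor_comul_apply (R := 𝕜) h
  rw [Algebra.algebraMap_eq_smul_one] at this
  simpa [sandwichRight] using this

theorem sandwichLeft_one_one : sandwichLeft (𝕜 := 𝕜) (1 : H) 1 = 1 := by
  simp [sandwichLeft, Algebra.TensorProduct.one_def]

theorem sandwichRight_one_one : sandwichRight (𝕜 := 𝕜) (1 : H) 1 = 1 := by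
  simp [sandwichRight, Algebra.TensorProduct.one_def]

theorem u_eq (F : TwoCocycle 𝕜 H) : F.u = sandwichRight 1 (F.toUnits : H ⊗[𝕜] H) := by
  simp [u, sandwichRight]

theorem uInv_eq (F : TwoCocycle 𝕜 H) :
    F.uInv = sandwichLeft 1 ((F.toUnits⁻¹ : (H ⊗[𝕜] H)ˣ) : H ⊗[𝕜] H) := by
  simp [uInv, sandwichLeft]

theorem cocycle_mul (F : TwoCocycle 𝕜 H) :
    TensorProduct.assoc 𝕜 H H H ((F.toUnits : H ⊗[𝕜] H) ⊗ₜ[𝕜] (1 : H))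
     * TensorProduct.assoc 𝕜 H H H
            ((Coalgebra.comul (R := 𝕜) (A := H)).rTensor H (F.toUnits : H ⊗[𝕜] H)) =
      ((1 : H) ⊗ₜ[𝕜] (F.toUnits : H ⊗[𝕜] H))
        * (Coalgebra.comul (R := 𝕜) (A := H)).lTensor H (F.toUnits : H ⊗[𝕜] H) := by
  have h := F.cocycle
  let A := Algebra.TensorProduct.assoc 𝕜 𝕜 𝕜 H H H
  let D : H ⊗[𝕜] H →ₐ[𝕜] H ⊗[𝕜] (H ⊗[𝕜] H) :=
    A.toAlgHom.comp (Algebra.TensorProduct.map (Bialgebra.comulAlgHom 𝕜 H) (.id 𝕜 H))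
  let E : H ⊗[𝕜] H →ₐ[𝕜] H ⊗[𝕜] (H ⊗[𝕜] H) :=
    A.toAlgHom.comp (Algebra.TensorProduct.includeLeft)
  change 1 = _ * D ((F.toUnits⁻¹ : (H ⊗[𝕜] H)ˣ) : H ⊗[𝕜] H) *
    E ((F.toUnits⁻¹ : (H ⊗[𝕜] H)ˣ) : H ⊗[𝕜] H) at h
  change E F.toUnits * D F.toUnits = _
  have h1 : E ((F.toUnits⁻¹ : (H ⊗[𝕜] H)ˣ) : H ⊗[𝕜] H) * E F.toUnits = 1 := by
    rw [← map_mul]; simp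
  have h2 : D ((F.toUnits⁻¹ : (H ⊗[𝕜] H)ˣ) : H ⊗[𝕜] H) * D F.toUnits = 1 := by
    rw [← map_mul]; simp
  rw [← one_mul (E _), h, mul_assoc _ (E _) (E _), h1, mul_one, mul_assoc _ (D _) (D _), h2,
    mul_one]

/-- `a ⊗ b ⊗ c ↦ a S(b) c`. -/
noncomputable def triple : H ⊗[𝕜] (H ⊗[𝕜] H) →ₗ[𝕜] H :=
  LinearMap.mul' 𝕜 H ∘ₗ (sandwichLeft (𝕜 := 𝕜) (1 : H)).lTensor H

theorem triple_mul (a d : H) (P Q : H ⊗[𝕜] H) :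
    triple ((a ⊗ₜ[𝕜] P) * TensorProduct.assoc 𝕜 H H H (Q ⊗ₜ[𝕜] d)) =
      a * sandwichRight 1 Q * sandwichLeft 1 P * d := by
  induction P with
  | zero => simp
  | add x y hx hy => simp [TensorProduct.tmul_add, add_mul, mul_add, hx, hy]
  | tmul p₁ p₂ => induction Q with
    | zero => simp
    | add x y hx hy => simp [TensorProduct.add_tmul, add_mul, mul_add, hx, hy]
    | tmul q₁ q₂ =>
      simp [triple, sandwichLeft, sandwichRight, antipode_mul_antidistrib, mul_assoc]

theorem triple_comul (X Y : H ⊗[𝕜] H) :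
    triple ((comul (R := 𝕜) (A := H)).lTensor H X *
        TensorProduct.assoc 𝕜 H H H ((comul (R := 𝕜) (A := H)).rTensor H Y)) =
      TensorProduct.rid 𝕜 H ((counit (R := 𝕜) (A := H)).lTensor H X) *
        TensorProduct.lid 𝕜 H ((counit (R := 𝕜) (A := H)).rTensor H Y) := by
  induction X with
  | zero => simp
  | add x y hx hy => simp [add_mul, hx, hy]
  | tmul a b => induction Y with
    | zero => simp
    | add x y hx hy => simp only [map_add, mul_add, hx, hy]
    | tmul c d =>
      simp only [LinearMap.lTensor_tmul, LinearMap.rTensor_tmul, triple_mul, sandwichRight_comul,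
        sandwichLeft_comul, TensorProduct.rid_tmul, TensorProduct.lid_tmul]
      simp [smul_smul, mul_comm]

theorem inv_counit_left (F : TwoCocycle 𝕜 H) :
    TensorProduct.lid 𝕜 H ((counit (R := 𝕜) (A := H)).rTensor H
      ((F.toUnits⁻¹ : (H ⊗[𝕜] H)ˣ) : H ⊗[𝕜] H)) = 1 := by
  let φ : H ⊗[𝕜] H →ₐ[𝕜] H := (Algebra.TensorProduct.lid 𝕜 H).toAlgHom.comp
    (Algebra.TensorProduct.map (Bialgebra.counitAlgHom 𝕜 H) (.id 𝕜 H))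
  have h1 : φ F.toUnits = 1 := F.counit_left
  change φ ((F.toUnits⁻¹ : (H ⊗[𝕜] H)ˣ) : H ⊗[𝕜] H) = 1
  have h2 : φ F.toUnits * φ ((F.toUnits⁻¹ : (H ⊗[𝕜] H)ˣ) : H ⊗[𝕜] H) = 1 := by
    rw [← map_mul]; simp
  rwa [h1, one_mul] at h2

theorem inv_counit_right (F : TwoCocycle 𝕜 H) :
    TensorProduct.rid 𝕜 H ((counit (R := 𝕜) (A := H)).lTensor H
      ((F.toUnits⁻¹ : (H ⊗[𝕜] H)ˣ) : H ⊗[𝕜] H)) = 1 := by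
  let φ : H ⊗[𝕜] H →ₐ[𝕜] H := (Algebra.TensorProduct.rid 𝕜 𝕜 H).toAlgHom.comp
    (Algebra.TensorProduct.map (.id 𝕜 H) (Bialgebra.counitAlgHom 𝕜 H))
  have h1 : φ F.toUnits = 1 := F.counit_right
  change φ ((F.toUnits⁻¹ : (H ⊗[𝕜] H)ˣ) : H ⊗[𝕜] H) = 1
  have h2 : φ F.toUnits * φ ((F.toUnits⁻¹ : (H ⊗[𝕜] H)ˣ) : H ⊗[𝕜] H) = 1 := by
    rw [← map_mul]; simp
  rwa [h1, one_mul] at h2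

theorem u_mul_uInv (F : TwoCocycle 𝕜 H) : F.u * F.uInv = 1 := by
  let A := Algebra.TensorProduct.assoc 𝕜 𝕜 𝕜 H H H
  let D : H ⊗[𝕜] H →ₐ[𝕜] H ⊗[𝕜] (H ⊗[𝕜] H) :=
    A.toAlgHom.comp (Algebra.TensorProduct.map (Bialgebra.comulAlgHom 𝕜 H) (.id 𝕜 H))
  let E : H ⊗[𝕜] H →ₐ[𝕜] H ⊗[𝕜] (H ⊗[𝕜] H) :=
    A.toAlgHom.comp (Algebra.TensorProduct.includeLeft)
  let I : H ⊗[𝕜] H →ₐ[𝕜] H ⊗[𝕜] (H ⊗[𝕜] H) := Algebra.TensorProduct.includeRight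
  let D' : H ⊗[𝕜] H →ₐ[𝕜] H ⊗[𝕜] (H ⊗[𝕜] H) :=
    Algebra.TensorProduct.map (.id 𝕜 H) (Bialgebra.comulAlgHom 𝕜 H)
  let G : H ⊗[𝕜] H := ((F.toUnits⁻¹ : (H ⊗[𝕜] H)ˣ) : H ⊗[𝕜] H)
  have h : E F.toUnits * D F.toUnits = I F.toUnits * D' F.toUnits := F.cocycle_mul
  have h1 : D F.toUnits * D G = 1 := by rw [← map_mul]; simp [G]
  have h2 : I G * I F.toUnits = 1 := by rw [← map_mul]; simp [G]
  have h3 : I G * E F.toUnits = D' F.toUnits * D G := by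
    rw [← mul_one (E _), ← h1, ← mul_assoc (E _), h, ← mul_assoc (I G), ← mul_assoc (I G), h2,
      one_mul]
  have h4 : triple (I G * E F.toUnits) = _ := triple_mul (𝕜 := 𝕜) (1 : H) 1 G F.toUnits
  rw [one_mul, mul_one, ← u_eq, ← uInv_eq] at h4
  rw [← h4, h3]
  refine (triple_comul _ _).trans ?_
  rw [F.counit_right, F.inv_counit_left, one_mul]

theorem twist_mul_antipode_rTensor (F : TwoCocycle 𝕜 H) (h : H) :
    LinearMap.mul' 𝕜 H (F.twistAntipode.rTensor H (F.twistComul h)) =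
      algebraMap 𝕜 H (counit (R := 𝕜) h) := by
  have key : ∀ X : H ⊗[𝕜] H, LinearMap.mul' 𝕜 H (F.twistAntipode.rTensor H X) =
      F.u * sandwichLeft F.uInv X := by
    intro X
    induction X with
    | zero => simp
    | tmul a b => simp [twistAntipode, sandwichLeft, mul_assoc]
    | add x y hx hy => simp [hx, hy, mul_add]
  rw [key, twistComul_apply, sandwichLeft_mul, sandwichLeft_mul]
  have h1 : sandwichLeft F.uInv (F.toUnits : H ⊗[𝕜] H) = 1 := by
    rw [uInv_eq, ← sandwichLeft_mul, Units.inv_mul, sandwichLeft_one_one]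
  rw [h1, sandwichLeft_comul, sandwichLeft_smul, ← uInv_eq, mul_smul_comm, u_mul_uInv,
    Algebra.algebraMap_eq_smul_one]

theorem twist_mul_antipode_lTensor (F : TwoCocycle 𝕜 H) (h : H) :
    LinearMap.mul' 𝕜 H (F.twistAntipode.lTensor H (F.twistComul h)) =
      algebraMap 𝕜 H (counit (R := 𝕜) h) := by
  have key : ∀ X : H ⊗[𝕜] H, LinearMap.mul' 𝕜 H (F.twistAntipode.lTensor H X) =
      sandwichRight F.u X * F.uInv := by
    intro X
    induction X with
    | zero => simp
    | tmul a b => simp [twistAntipode, sandwichRight, mul_assoc]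
    | add x y hx hy => simp [hx, hy, add_mul]
  rw [key, twistComul_apply, sandwichRight_mul, sandwichRight_mul]
  have h1 : sandwichRight F.u ((F.toUnits⁻¹ : (H ⊗[𝕜] H)ˣ) : H ⊗[𝕜] H) = 1 := by
    rw [u_eq, ← sandwichRight_mul, Units.inv_mul, sandwichRight_one_one]
  rw [h1, sandwichRight_comul, sandwichRight_smul, ← u_eq, smul_mul_assoc, u_mul_uInv,
    Algebra.algebraMap_eq_smul_one]

theorem twist_coassoc (F : TwoCocycle 𝕜 H) :
    (Algebra.TensorProduct.assoc 𝕜 𝕜 𝕜 H H H).toAlgHom.comp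
      ((Algebra.TensorProduct.map F.twistComul (.id 𝕜 H)).comp F.twistComul) =
    (Algebra.TensorProduct.map (.id 𝕜 H) F.twistComul).comp F.twistComul := by
  let A := Algebra.TensorProduct.assoc 𝕜 𝕜 𝕜 H H H
  let D : H ⊗[𝕜] H →ₐ[𝕜] H ⊗[𝕜] (H ⊗[𝕜] H) :=
    A.toAlgHom.comp (Algebra.TensorProduct.map (Bialgebra.comulAlgHom 𝕜 H) (.id 𝕜 H))
  let E : H ⊗[𝕜] H →ₐ[𝕜] H ⊗[𝕜] (H ⊗[𝕜] H) :=
    A.toAlgHom.comp (Algebra.TensorProduct.includeLeft)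
  let I : H ⊗[𝕜] H →ₐ[𝕜] H ⊗[𝕜] (H ⊗[𝕜] H) := Algebra.TensorProduct.includeRight
  let D' : H ⊗[𝕜] H →ₐ[𝕜] H ⊗[𝕜] (H ⊗[𝕜] H) :=
    Algebra.TensorProduct.map (.id 𝕜 H) (Bialgebra.comulAlgHom 𝕜 H)
  let G : H ⊗[𝕜] H := ((F.toUnits⁻¹ : (H ⊗[𝕜] H)ˣ) : H ⊗[𝕜] H)
  have hL : ∀ X : H ⊗[𝕜] H, A (Algebra.TensorProduct.map F.twistComul (.id 𝕜 H) X) =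
      E F.toUnits * D X * E G := by
    intro X
    induction X with
    | zero => simp
    | tmul a b =>
      change A (F.twistComul a ⊗ₜ b) = A (_ ⊗ₜ 1) * A (_ ⊗ₜ b) * A (_ ⊗ₜ 1)
      rw [← map_mul, ← map_mul]
      simp [twistComul_apply, G]
    | add x y hx hy => simp only [map_add, hx, hy, mul_add, add_mul]
  have hR : ∀ X : H ⊗[𝕜] H, Algebra.TensorProduct.map (.id 𝕜 H) F.twistComul X =
      I F.toUnits * D' X * I G := by
    intro X
    induction X with
    | zero => simp
    | tmul a b => simp [I, D', twistComul_apply, G]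
    | add x y hx hy => simp only [map_add, hx, hy, mul_add, add_mul]
  have hc : E F.toUnits * D F.toUnits = I F.toUnits * D' F.toUnits := F.cocycle_mul
  have hFG : (F.toUnits : H ⊗[𝕜] H) * G = 1 := by simp [G]
  have hGF : G * (F.toUnits : H ⊗[𝕜] H) = 1 := by simp [G]
  have hc' : D G * E G = D' G * I G := by
    have e1 : (E F.toUnits * D F.toUnits) * (D G * E G) = 1 := by
      rw [mul_assoc, ← mul_assoc (D _) (D G), ← map_mul, hFG, map_one, one_mul, ← map_mul, hFG,
        map_one]
    have e2 : (D' G * I G) * (I F.toUnits * D' F.toUnits) = 1 := by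
      rw [mul_assoc, ← mul_assoc (I G), ← map_mul, hGF, map_one, one_mul, ← map_mul, hGF, map_one]
    rw [← one_mul (D G * E G), ← e2, ← hc, mul_assoc, e1, mul_one]
  have hco : ∀ h : H, D (comul (R := 𝕜) h) = D' (comul (R := 𝕜) h) := fun h =>
    Coalgebra.coassoc_apply h
  ext h
  change A (Algebra.TensorProduct.map F.twistComul (.id 𝕜 H) (F.twistComul h)) =
    Algebra.TensorProduct.map (.id 𝕜 H) F.twistComul (F.twistComul h)
  rw [hL, hR, twistComul_apply]
  change E _ * D (_ * _ * G) * E G = I _ * D' (_ * _ * G) * I G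
  simp only [map_mul, hco]
  calc _ = (E F.toUnits * D F.toUnits) * D' (comul (R := 𝕜) h) * (D G * E G) := by
        simp only [mul_assoc]
    _ = _ := by rw [hc, hc']; simp only [mul_assoc]

theorem twist_rTensor (F : TwoCocycle 𝕜 H) :
    (Algebra.TensorProduct.map (Bialgebra.counitAlgHom 𝕜 H) (.id 𝕜 H)).comp F.twistComul =
      ((Algebra.TensorProduct.lid 𝕜 H).symm : H →ₐ[𝕜] 𝕜 ⊗[𝕜] H) := by
  ext h
  apply (Algebra.TensorProduct.lid 𝕜 H).injective
  let φ : H ⊗[𝕜] H →ₐ[𝕜] H := (Algebra.TensorProduct.lid 𝕜 H).toAlgHom.comp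
    (Algebra.TensorProduct.map (Bialgebra.counitAlgHom 𝕜 H) (.id 𝕜 H))
  have h1 : φ F.toUnits = 1 := F.counit_left
  have h2 : φ ((F.toUnits⁻¹ : (H ⊗[𝕜] H)ˣ) : H ⊗[𝕜] H) = 1 := F.inv_counit_left
  have h3 : φ (comul (R := 𝕜) h) = h := by
    change TensorProduct.lid 𝕜 H ((counit (R := 𝕜) (A := H)).rTensor H _) = h
    rw [Coalgebra.rTensor_counit_comul]; simp
  change φ (F.twistComul h) = _
  rw [twistComul_apply, map_mul, map_mul, h1, h2, h3]
  simp

theorem twist_lTensor (F : TwoCocycle 𝕜 H) :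
    (Algebra.TensorProduct.map (.id 𝕜 H) (Bialgebra.counitAlgHom 𝕜 H)).comp F.twistComul =
      ((Algebra.TensorProduct.rid 𝕜 𝕜 H).symm : H →ₐ[𝕜] H ⊗[𝕜] 𝕜) := by
  ext h
  apply (Algebra.TensorProduct.rid 𝕜 𝕜 H).injective
  let φ : H ⊗[𝕜] H →ₐ[𝕜] H := (Algebra.TensorProduct.rid 𝕜 𝕜 H).toAlgHom.comp
    (Algebra.TensorProduct.map (.id 𝕜 H) (Bialgebra.counitAlgHom 𝕜 H))
  have h1 : φ F.toUnits = 1 := F.counit_right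
  have h2 : φ ((F.toUnits⁻¹ : (H ⊗[𝕜] H)ˣ) : H ⊗[𝕜] H) = 1 := F.inv_counit_right
  have h3 : φ (comul (R := 𝕜) h) = h := by
    change TensorProduct.rid 𝕜 H ((counit (R := 𝕜) (A := H)).lTensor H _) = h
    rw [Coalgebra.lTensor_counit_comul]; simp
  change φ (F.twistComul h) = _
  rw [twistComul_apply, map_mul, map_mul, h1, h2, h3]
  simp

/-- The algebra and the counit of `H` with the twisted comultiplication. -/
noncomputable abbrev twistBialgebra (F : TwoCocycle 𝕜 H) : Bialgebra 𝕜 H :=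
  Bialgebra.ofAlgHom F.twistComul (Bialgebra.counitAlgHom 𝕜 H)
    F.twist_coassoc F.twist_rTensor F.twist_lTensor

/-- The Hopf algebra structure of the Drinfeld twist, on the algebra `H`. -/
noncomputable abbrev twistHopfAlgebra (F : TwoCocycle 𝕜 H) : HopfAlgebra 𝕜 H :=
  { F.twistBialgebra with
    antipode := F.twistAntipode
    mul_antipode_rTensor_comul := LinearMap.ext F.twist_mul_antipode_rTensor
    mul_antipode_lTensor_comul := LinearMap.ext F.twist_mul_antipode_lTensor }

end TwoCocycle

section Twist

variable {𝕜 H : Type*} [Field 𝕜] [Ring H] [HopfAlgebra 𝕜 H]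

/-- The Drinfeld twist `H_F` of `H` by the 2-cocycle `F`: a copy of `H` that carries the same
algebra and counit, the comultiplication `h ↦ F Δ(h) F⁻¹` and the antipode `h ↦ u S(h) u⁻¹`. -/
def DrinfeldTwist (_F : TwoCocycle 𝕜 H) : Type _ := H

noncomputable instance (F : TwoCocycle 𝕜 H) : Ring (DrinfeldTwist F) := inferInstanceAs (Ring H)

noncomputable instance (F : TwoCocycle 𝕜 H) : HopfAlgebra 𝕜 (DrinfeldTwist F) :=
  F.twistHopfAlgebra

theorem DrinfeldTwist.comul_apply (F : TwoCocycle 𝕜 H) (h : H) :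
    (Coalgebra.comul (R := 𝕜) (A := DrinfeldTwist F) h : H ⊗[𝕜] H) =
      (F.toUnits : H ⊗[𝕜] H) * Coalgebra.comul (R := 𝕜) h *
        ((F.toUnits⁻¹ : (H ⊗[𝕜] H)ˣ) : H ⊗[𝕜] H) := rfl

theorem DrinfeldTwist.antipode_apply (F : TwoCocycle 𝕜 H) (h : H) :
    (HopfAlgebra.antipode 𝕜 (A := DrinfeldTwist F) h : H) =
      F.u * HopfAlgebra.antipode 𝕜 h * F.uInv := rfl

end Twist

/-- `x ^ m` for an integer `m`, where negative powers are powers of the inverse of `x`. -/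
noncomputable def intPow {M : Type*} [MonoidWithZero M] (x : M) : ℤ → M
  | Int.ofNat m => x ^ m
  | Int.negSucc m => Ring.inverse x ^ (m + 1)

section Hopf

variable (𝕜 H : Type*) [Field 𝕜] [Ring H] [HopfAlgebra 𝕜 H]

/-- The linear map `H ⊗ H^{⊗ n} → H^{⊗ (n + 1)}`. -/
noncomputable def tensorCons (n : ℕ) :
    H ⊗[𝕜] (⨂[𝕜] (_ : Fin n), H) →ₗ[𝕜] ⨂[𝕜] (_ : Fin (n + 1)), H :=
  TensorProduct.lift
    ((PiTensorProduct.lift (R := 𝕜) (s := fun _ : Fin n => H)).toLinearMap ∘ₗ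
      (PiTensorProduct.tprod 𝕜 (s := fun _ : Fin (n + 1) => H)).curryLeft)

theorem tensorCons_tmul (n : ℕ) (h : H) (v : Fin n → H) :
    tensorCons 𝕜 H n (h ⊗ₜ[𝕜] PiTensorProduct.tprod 𝕜 v) =
      PiTensorProduct.tprod 𝕜 (Fin.cons h v : Fin (n + 1) → H) := by
  simp only [tensorCons, TensorProduct.lift.tmul, LinearMap.comp_apply,
    LinearEquiv.coe_coe]
  erw [PiTensorProduct.lift.tprod]
  rfl

/-- The iterated comultiplication `Δ^{(n)} : H → H^{⊗ n}`, with `Δ^{(0)} = ε` and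
`Δ^{(n + 1)} = (id ⊗ Δ^{(n)}) ∘ Δ`; in particular `Δ^{(1)} = id`. -/
noncomputable def iterComul : (n : ℕ) → H →ₗ[𝕜] ⨂[𝕜] (_ : Fin n), H
  | 0 => (PiTensorProduct.isEmptyEquiv (Fin 0)).symm.toLinearMap ∘ₗ Coalgebra.counit
  | n + 1 => tensorCons 𝕜 H n ∘ₗ (iterComul n).lTensor H ∘ₗ Coalgebra.comul

theorem iterComul_one (h : H) :
    iterComul 𝕜 H 1 h = PiTensorProduct.tprod 𝕜 (fun _ => h) := by
  have h1 : iterComul 𝕜 H 1 h = tensorCons 𝕜 H 0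
      ((PiTensorProduct.isEmptyEquiv (Fin 0)).symm.toLinearMap.lTensor H
        (Coalgebra.counit.lTensor H (Coalgebra.comul (R := 𝕜) h))) := by
    simp only [iterComul, LinearMap.comp_apply, LinearMap.lTensor_comp]
  rw [h1, Coalgebra.lTensor_counit_comul, LinearMap.lTensor_tmul]
  have h2 : (PiTensorProduct.isEmptyEquiv (R := 𝕜) (s := fun _ : Fin 0 => H) (Fin 0)).symm 1 =
      PiTensorProduct.tprod 𝕜 Fin.elim0 := by
    rw [LinearEquiv.symm_apply_eq, PiTensorProduct.isEmptyEquiv_apply_tprod]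
  erw [h2, tensorCons_tmul]
  congr 1
  ext i
  fin_cases i
  rfl

/-- The iterated product `v₁ ⊗ ⋯ ⊗ vₙ ↦ v₁ ⋯ vₙ`. -/
noncomputable def tensorMul (n : ℕ) : (⨂[𝕜] (_ : Fin n), H) →ₗ[𝕜] H :=
  PiTensorProduct.lift (MultilinearMap.mkPiAlgebraFin 𝕜 n H)

variable {n : ℕ}

/-- The action `v₁ ⊗ ⋯ ⊗ vₙ ↦ v_{σ 1} ⊗ ⋯ ⊗ v_{σ n}` of a permutation. -/
noncomputable def tensorPerm (σ : Equiv.Perm (Fin n)) :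
    (⨂[𝕜] (_ : Fin n), H) →ₗ[𝕜] ⨂[𝕜] (_ : Fin n), H :=
  (PiTensorProduct.reindex 𝕜 (fun _ : Fin n => H) σ.symm).toLinearMap

theorem tensorPerm_tprod (σ : Equiv.Perm (Fin n)) (v : Fin n → H) :
    tensorPerm 𝕜 H σ (PiTensorProduct.tprod 𝕜 v) = PiTensorProduct.tprod 𝕜 (fun t => v (σ t)) := by
  simp [tensorPerm]

end Hopf

/-- The representative in `{1, …, n}` of the residue class of `a` modulo `n`, for `n > 0`. -/
def posRes (n : ℕ) (a : ℤ) : ℕ := ((a - 1) % n).toNat + 1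

theorem posRes_pos (n : ℕ) (a : ℤ) : 0 < posRes n a := Nat.succ_pos _

theorem posRes_le {n : ℕ} (hn : 0 < n) (a : ℤ) : posRes n a ≤ n := by
  have h := Int.emod_lt_of_pos (a - 1) (by exact_mod_cast hn : (0 : ℤ) < n)
  unfold posRes
  omega

theorem posRes_modEq {n : ℕ} (hn : 0 < n) (a : ℤ) : (posRes n a : ℤ) ≡ a [ZMOD n] := by
  have h0 := Int.emod_nonneg (a - 1) (by exact_mod_cast hn.ne' : (n : ℤ) ≠ 0)
  have h : (posRes n a : ℤ) = (a - 1) % n + 1 := by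
    unfold posRes
    push_cast
    rw [Int.toNat_of_nonneg h0]
  rw [h]
  simpa using (Int.mod_modEq (a - 1) n).add_right 1

theorem posRes_cast {n : ℕ} (hn : 0 < n) (a : ℤ) : ((posRes n a : ℕ) : ZMod n) = (a : ZMod n) := by
  have := (ZMod.intCast_eq_intCast_iff _ _ n).2 (posRes_modEq hn a)
  simpa using this

theorem posRes_unique {n : ℕ} {a : ℤ} {i : ℕ} (h0 : 0 < i) (hi : i ≤ n)
    (h : (i : ℤ) ≡ a [ZMOD n]) : posRes n a = i := by
  have hn : 0 < n := by omega
  have h1 : (posRes n a : ℤ) - 1 ≡ (i : ℤ) - 1 [ZMOD n] :=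
    ((posRes_modEq hn a).trans h.symm).sub_right 1
  have h2 := posRes_le hn a
  have h3 := posRes_pos n a
  have h4 := h1
  unfold Int.ModEq at h4
  rw [Int.emod_eq_of_lt (by omega) (by omega), Int.emod_eq_of_lt (by omega) (by omega)] at h4
  omega

theorem mul_modEq_cancel {n : ℕ} {l a b : ℤ} (hl : IsCoprime (n : ℤ) l)
    (h : a * l ≡ b * l [ZMOD n]) : a ≡ b [ZMOD n] := by
  have h1 := h.dvd
  rw [← sub_mul] at h1
  exact Int.modEq_of_dvd (hl.dvd_of_dvd_mul_right h1)

/-- The permutation `σ_{(n,l)}` of `{1, …, n - 1}`, `i ↦` positive residue of `i * l` modulo `n`;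
the element `i` of `{1, …, n - 1}` is `i - 1 : Fin (n - 1)`. -/
noncomputable def sigmaPerm (n : ℕ) (l : ℤ) (hl : IsCoprime (n : ℤ) l) :
    Equiv.Perm (Fin (n - 1)) :=
  Equiv.ofBijective
    (fun t => ⟨posRes n (((t : ℕ) + 1 : ℕ) * l) - 1, by
      have ht := t.isLt
      have hn : 0 < n := by omega
      have h1 := posRes_le hn (((t : ℕ) + 1 : ℕ) * l)
      have h2 := posRes_pos n (((t : ℕ) + 1 : ℕ) * l)
      have h3 : posRes n (((t : ℕ) + 1 : ℕ) * l) ≠ n := by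
        intro h
        have h4 := posRes_modEq hn (((t : ℕ) + 1 : ℕ) * l)
        rw [h] at h4
        have h5 : ((0 : ℤ)) * l ≡ (((t : ℕ) + 1 : ℕ) : ℤ) * l [ZMOD n] :=
          (by simp [Int.ModEq] : (0 : ℤ) * l ≡ n [ZMOD n]).trans h4
        have h6 := (mul_modEq_cancel hl h5).dvd
        rw [sub_zero] at h6
        have h7 := Nat.le_of_dvd (Nat.succ_pos _) (Int.natCast_dvd_natCast.1 h6)
        omega
      omega⟩)
    (Finite.injective_iff_bijective.1 (by
      intro t t' h
      have ht := t.isLt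
      have ht' := t'.isLt
      have hn : 0 < n := by omega
      have h1 := posRes_pos n (((t : ℕ) + 1 : ℕ) * l)
      have h1' := posRes_pos n (((t' : ℕ) + 1 : ℕ) * l)
      have h2 : posRes n (((t : ℕ) + 1 : ℕ) * l) = posRes n (((t' : ℕ) + 1 : ℕ) * l) := by
        have := Fin.mk.inj_iff.1 h
        omega
      have h3 := (posRes_modEq hn (((t : ℕ) + 1 : ℕ) * l)).symm
      rw [h2] at h3
      have h4 := mul_modEq_cancel hl (h3.trans (posRes_modEq hn _))
      have h5 : (t : ℕ) + 1 = (t' : ℕ) + 1 := by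
        unfold Int.ModEq at h4
        rw [Int.emod_eq_of_lt (by omega) (by omega), Int.emod_eq_of_lt (by omega) (by omega)] at h4
        exact_mod_cast h4
      exact Fin.ext (by omega)))

/-- The recursive relations that determine the exponents `c_1, …, c_n`, where `k₀ = (n - k - 1) / 2`.
The index `i` in `{1, …, n}` is represented by its class in `ZMod n`, so `c (i + k)` is the entry at
the positive residue of `i + k`. -/
structure IsExponentSeq (n k : ℕ) (c : ZMod n → ℤ) : Prop where
  last : c (n : ZMod n) = 0
  up : ∀ i : ℕ, 1 ≤ i → i ≤ (n - k - 1) / 2 → c ((i : ZMod n) + k) = c i + 1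
  down : ∀ i : ℕ, (n - k - 1) / 2 + 1 ≤ i → i ≤ 2 * ((n - k - 1) / 2) →
    c ((i : ZMod n) + k) = c i - 1
  stay : ∀ i : ℕ, 2 * ((n - k - 1) / 2) + 1 ≤ i → i ≤ n → c ((i : ZMod n) + k) = c i

/-- The difference `c_{i + k} - c_i`. -/
def expStep (n k i : ℕ) : ℤ :=
  if 1 ≤ i ∧ i ≤ (n - k - 1) / 2 then 1
  else if (n - k - 1) / 2 + 1 ≤ i ∧ i ≤ 2 * ((n - k - 1) / 2) then -1 else 0

theorem isExponentSeq_iff {n k : ℕ} (hn : 0 < n) (c : ZMod n → ℤ) :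
    IsExponentSeq n k c ↔ c 0 = 0 ∧ ∀ x : ZMod n, c (x + k) = c x + expStep n k x.val := by
  have : NeZero n := ⟨hn.ne'⟩
  constructor
  · intro h
    refine ⟨by simpa using h.last, fun x => ?_⟩
    have hx := ZMod.val_lt x
    have hx' : ((x.val : ℕ) : ZMod n) = x := ZMod.natCast_zmod_val x
    unfold expStep
    split_ifs with h1 h2
    · have := h.up x.val h1.1 h1.2
      rwa [hx'] at this
    · have := h.down x.val h2.1 h2.2
      rw [hx'] at this
      rw [this]
      ring
    · rcases Nat.eq_zero_or_pos x.val with h0 | h0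
      · have := h.stay n (by omega) le_rfl
        have hx0 : x = (n : ZMod n) := by
          rw [← hx', h0]
          simp
        rw [hx0, this, add_zero]
      · have := h.stay x.val (by omega) hx.le
        rw [hx'] at this
        rw [this, add_zero]
  · rintro ⟨h0, h⟩
    have key : ∀ i : ℕ, i ≤ n → c ((i : ZMod n) + k) = c i + expStep n k i := by
      intro i hi
      rcases hi.lt_or_eq with h1 | h1
      · have := h (i : ZMod n)
        rwa [ZMod.val_natCast_of_lt h1] at this
      · have h2 := h (i : ZMod n)
        rw [h2, h1]
        simp [expStep]
        omega
    refine ⟨by simpa using h0, ?_, ?_, ?_⟩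
    · intro i h1 h2
      rw [key i (by omega), expStep, if_pos ⟨h1, h2⟩]
    · intro i h1 h2
      rw [key i (by omega), expStep, if_neg (by omega), if_pos ⟨h1, h2⟩]
      ring
    · intro i h1 h2
      rw [key i h2, expStep, if_neg (by omega), if_neg (by omega), add_zero]

theorem sum_expStep {n k : ℕ} (hkn : k < n) : ∑ i ∈ Finset.range n, expStep n k i = 0 := by
  obtain ⟨m, hm⟩ : ∃ m, m = (n - k - 1) / 2 := ⟨_, rfl⟩
  obtain ⟨r, hr⟩ : ∃ r, n = 1 + (m + (m + r)) := ⟨n - 1 - m - m, by omega⟩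
  have hf : ∀ i, expStep n k i = if 1 ≤ i ∧ i ≤ m then 1
      else if m + 1 ≤ i ∧ i ≤ 2 * m then -1 else 0 := by
    intro i
    rw [expStep, ← hm]
  have s1 : ∑ x ∈ Finset.range m, expStep n k (1 + x) = m := by
    rw [Finset.sum_congr rfl (g := fun _ => (1 : ℤ)) (fun x hx => by
      rw [Finset.mem_range] at hx; rw [hf, if_pos (by omega)])]
    simp
  have s2 : ∑ x ∈ Finset.range m, expStep n k (1 + (m + x)) = -m := by
    rw [Finset.sum_congr rfl (g := fun _ => (-1 : ℤ)) (fun x hx => by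
      rw [Finset.mem_range] at hx; rw [hf, if_neg (by omega), if_pos (by omega)])]
    simp
  have s3 : ∑ x ∈ Finset.range r, expStep n k (1 + (m + (m + x))) = 0 :=
    Finset.sum_eq_zero (fun x hx => by
      rw [Finset.mem_range] at hx; rw [hf, if_neg (by omega), if_neg (by omega)])
  have s0 : expStep n k 0 = 0 := by rw [hf, if_neg (by omega), if_neg (by omega)]
  have e : ∑ i ∈ Finset.range n, expStep n k i =
      ∑ i ∈ Finset.range (1 + (m + (m + r))), expStep n k i := by rw [← hr]
  rw [e, Finset.sum_range_add, Finset.sum_range_add, Finset.sum_range_add, s1, s2, s3,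
    Finset.sum_range_one, s0]
  ring

theorem existsUnique_exponentSeq {n k : ℕ} (hkn : k < n) (h : n.Coprime k) :
    ∃! c : ZMod n → ℤ, IsExponentSeq n k c := by
  have hn : 0 < n := by omega
  have : NeZero n := ⟨hn.ne'⟩
  simp only [isExponentSeq_iff hn]
  let κ : (ZMod n)ˣ := ZMod.unitOfCoprime k h.symm
  have hκ : (κ : ZMod n) = k := ZMod.coe_unitOfCoprime k h.symm
  have hsum : ∑ j ∈ Finset.range n, expStep n k ((j : ZMod n) * k).val = 0 := by
    rw [← sum_expStep hkn]
    refine Finset.sum_nbij (fun j => ((j : ZMod n) * k).val) ?_ ?_ ?_ ?_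
    · intro j _
      exact Finset.mem_range.2 (ZMod.val_lt _)
    · intro a ha b hb hab
      have h1 := ZMod.val_injective n hab
      rw [← hκ] at h1
      have h2 := κ.isUnit.mul_right_cancel h1
      have ha' : a < n := by simpa using ha
      have hb' : b < n := by simpa using hb
      have h3 := congrArg ZMod.val h2
      rwa [ZMod.val_natCast_of_lt ha', ZMod.val_natCast_of_lt hb'] at h3
    · intro b hb
      have hb' : b < n := by simpa using hb
      refine ⟨((b : ZMod n) * (κ⁻¹ : (ZMod n)ˣ)).val, ?_, ?_⟩
      · simpa using ZMod.val_lt _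
      · simp only [ZMod.natCast_val, ZMod.cast_id', id_eq]
        rw [← hκ, Units.inv_mul_cancel_right, ZMod.val_natCast_of_lt hb']
    · intro j _
      rfl
  refine ⟨fun x => ∑ j ∈ Finset.range (x * (κ⁻¹ : (ZMod n)ˣ)).val,
    expStep n k ((j : ZMod n) * k).val, ⟨by simp, fun x => ?_⟩, ?_⟩
  · obtain ⟨y, rfl⟩ : ∃ y, x = y * κ := ⟨x * (κ⁻¹ : (ZMod n)ˣ), by simp⟩
    have e1 : y * (κ : ZMod n) + k = (y + 1) * κ := by rw [hκ]; ring
    rw [e1]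
    simp only [Units.mul_inv_cancel_right]
    have hy := ZMod.val_lt y
    have hyv : ((y.val : ℕ) : ZMod n) = y := ZMod.natCast_zmod_val y
    have e2 : ∑ j ∈ Finset.range (y.val + 1), expStep n k ((j : ZMod n) * k).val =
        ∑ j ∈ Finset.range y.val, expStep n k ((j : ZMod n) * k).val +
          expStep n k (y * (κ : ZMod n)).val := by
      rw [Finset.sum_range_succ, hyv, hκ]
    rw [← e2]
    have e3 : y + 1 = ((y.val + 1 : ℕ) : ZMod n) := by push_cast; rw [hyv]
    rcases Nat.lt_or_ge (y.val + 1) n with h1 | h1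
    · rw [e3, ZMod.val_natCast_of_lt h1]
    · have h2 : y.val + 1 = n := by omega
      rw [h2, hsum, e3, h2]
      simp
  · rintro c ⟨h0, hc⟩
    have key : ∀ (d : ZMod n → ℤ), d 0 = 0 → (∀ x, d (x + k) = d x + expStep n k x.val) →
        ∀ r : ℕ, d (r * k) = ∑ j ∈ Finset.range r, expStep n k ((j : ZMod n) * k).val := by
      intro d hd0 hd r
      induction r with
      | zero => simpa using hd0
      | succ r ih =>
        rw [Finset.sum_range_succ, ← ih, ← hd]
        congr 1
        push_cast
        ring
    funext x
    have := key c h0 hc (x * (κ⁻¹ : (ZMod n)ˣ)).val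
    rw [← this]
    congr 1
    rw [ZMod.natCast_zmod_val, ← hκ]
    simp

/-- The sequence `c` that is determined by the recursive relations. -/
noncomputable def exponentSeq (n k : ℕ) (hkn : k < n) (h : n.Coprime k) : ZMod n → ℤ :=
  (existsUnique_exponentSeq hkn h).choose

theorem exponentSeq_spec (n k : ℕ) (hkn : k < n) (h : n.Coprime k) :
    IsExponentSeq n k (exponentSeq n k hkn h) :=
  (existsUnique_exponentSeq hkn h).choose_spec.1

section Operators

variable (𝕜 H : Type*) [Field 𝕜] [Ring H] [HopfAlgebra 𝕜 H]

/-- The antipode, as an element of the ring of linear endomorphisms. -/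
noncomputable def antipodeEnd : Module.End 𝕜 H := HopfAlgebra.antipode 𝕜

theorem isCoprime_neg_of_coprime {n k : ℕ} (h : n.Coprime k) : IsCoprime (n : ℤ) (-(k : ℤ)) :=
  (Nat.isCoprime_iff_coprime.2 h).neg_right

/-- The shuffled Sweedler power
`P^{(n,-k)} = m ∘ σ_{(n,-k)} ∘ (S^{2 c_1} ⊗ ⋯ ⊗ S^{2 c_{n-1}}) ∘ Δ^{(n-1)}`. -/
noncomputable def shuffledSweedlerPower (n k : ℕ) (hkn : k < n) (hcop : n.Coprime k) :
    Module.End 𝕜 H :=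
  tensorMul 𝕜 H (n - 1) ∘ₗ
    tensorPerm 𝕜 H (sigmaPerm n (-(k : ℤ)) (isCoprime_neg_of_coprime hcop)) ∘ₗ
    PiTensorProduct.map (fun i : Fin (n - 1) =>
      intPow (antipodeEnd 𝕜 H) (2 * exponentSeq n k hkn hcop (((i : ℕ) + 1 : ℕ) : ZMod n))) ∘ₗ
    iterComul 𝕜 H (n - 1)

variable {𝕜 H}

/-- `f ⇀ h = ∑ h₁ f(h₂)`. -/
noncomputable def hitLeft (f : Module.Dual 𝕜 H) : Module.End 𝕜 H :=
  (TensorProduct.rid 𝕜 H).toLinearMap ∘ₗ f.lTensor H ∘ₗ Coalgebra.comul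

/-- `h ↼ f = ∑ f(h₁) h₂`. -/
noncomputable def hitRight (f : Module.Dual 𝕜 H) : Module.End 𝕜 H :=
  (TensorProduct.lid 𝕜 H).toLinearMap ∘ₗ f.rTensor H ∘ₗ Coalgebra.comul

/-- Integer powers in the dual algebra `H^*`, that is, with respect to convolution. -/
noncomputable def dualPow (f : Module.Dual 𝕜 H) (m : ℤ) : Module.Dual 𝕜 H :=
  WithConv.ofConv (intPow (WithConv.toConv f) m)

variable (𝕜 H) in
/-- A pair of normalized integrals: a left integral `Λ` of `H` and a right integral `λ` of `H^*`
with `λ(Λ) = 1`, together with the distinguished grouplike elements `α ∈ H^*` and `g ∈ H` that they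
determine. -/
structure NormalizedIntegrals where
  Lam : H
  lam : Module.Dual 𝕜 H
  alpha : Module.Dual 𝕜 H
  g : H
  mul_Lam : ∀ h : H, h * Lam = Coalgebra.counit (R := 𝕜) h • Lam
  hitRight_lam : ∀ h : H, hitRight lam h = lam h • (1 : H)
  lam_Lam : lam Lam = 1
  Lam_mul : ∀ h : H, Lam * h = alpha h • Lam
  hitLeft_lam : ∀ h : H, hitLeft lam h = lam h • g

namespace NormalizedIntegrals

variable (I : NormalizedIntegrals 𝕜 H)

/-- `Λ_{m - 1/2} = α^{-m} ⇀ S(Λ)`. -/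
noncomputable def LamHalf (m : ℤ) : H :=
  hitLeft (dualPow I.alpha (-m)) (HopfAlgebra.antipode 𝕜 I.Lam)

/-- `λ_{m - 1/2} = g^m ⇀ λ`, that is, the functional `x ↦ λ(x g^m)`. -/
noncomputable def lamHalf (m : ℤ) : Module.Dual 𝕜 H :=
  I.lam ∘ₗ LinearMap.mulRight 𝕜 (intPow I.g m)

/-- `T(x) = ∑ α⁻¹(x₁) S⁻²(x₂) α(x₃)`. -/
noncomputable def T : Module.End 𝕜 H :=
  intPow (antipodeEnd 𝕜 H) (-2) ∘ₗ hitLeft I.alpha ∘ₗ hitRight (dualPow I.alpha (-1))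

end NormalizedIntegrals

end Operators

/-- The combinatorial data of a framed Heegaard diagram of genus one, with one oriented lower curve
`η` and one oriented upper curve `μ`, as they enter the Kuperberg invariant. The `n` intersection
points are numbered `p_1, …, p_n` in the order in which `η` meets them after its base point
(`p_i` is `i - 1 : Fin n`), and `p_{σ r}` is the `r`-th of them on `μ` after its base point.
`thetaLower p`, `thetaUpper p` are the counterclockwise rotations of the tangents of `η` and `μ`
relative to the first combing from the base point to `p`, in units of a full turn, and `phiLower p`,
`phiUpper p` are the rotations of the second combing around the first one, counted by signed
crossings with the twist front. The totals are the rotations along the full curves, back to the base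
point. -/
structure FramedDiagram where
  n : ℕ
  σ : Equiv.Perm (Fin n)
  thetaLower : Fin n → ℚ
  thetaUpper : Fin n → ℚ
  phiLower : Fin n → ℤ
  phiUpper : Fin n → ℤ
  thetaLowerTotal : ℚ
  thetaUpperTotal : ℚ
  phiLowerTotal : ℚ
  phiUpperTotal : ℚ
  /-- The total rotations of the tangents are half-integers. -/
  half_lower : ∃ m : ℤ, thetaLowerTotal = m - 1 / 2
  half_upper : ∃ m : ℤ, thetaUpperTotal = m - 1 / 2
  /-- At an intersection point the curves are perpendicular. -/
  quarter : ∀ p, ∃ s : ℤ, 2 * (thetaLower p - thetaUpper p) + 1 / 2 = s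
  /-- The admissibility conditions `θ_η = φ_η` and `θ_μ = -φ_μ`. -/
  admissible_lower : thetaLowerTotal = phiLowerTotal
  admissible_upper : thetaUpperTotal = -phiUpperTotal

namespace FramedDiagram

variable {𝕜 H : Type*} [Field 𝕜] [Ring H] [HopfAlgebra 𝕜 H] (D : FramedDiagram)

/-- The exponent `s_p = 2 (θ_η(p) - θ_μ(p)) + 1/2`, an integer. -/
def sExp (p : Fin D.n) : ℤ := ⌊2 * (D.thetaLower p - D.thetaUpper p) + 1 / 2⌋

/-- The exponent `t_p = φ_η(p) - φ_μ(p)`. -/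
def tExp (p : Fin D.n) : ℤ := D.phiLower p - D.phiUpper p

/-- The operator `m ∘ σ_D ∘ (⨂_r S^{s_r} T^{t_r}) ∘ Δ^{(n)}` of the diagram. -/
noncomputable def diagramOperator (I : NormalizedIntegrals 𝕜 H) : Module.End 𝕜 H :=
  tensorMul 𝕜 H D.n ∘ₗ tensorPerm 𝕜 H D.σ ∘ₗ
    PiTensorProduct.map (fun r : Fin D.n =>
      intPow (antipodeEnd 𝕜 H) (D.sExp r) ∘ₗ intPow I.T (D.tExp r)) ∘ₗ
    iterComul 𝕜 H D.n

/-- The Kuperberg invariant `λ_{-θ_μ}(P(Λ_{θ_η}))` of the diagram, where `P` is its operator. The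
half-integers `θ_η` and `-θ_μ` are written as `m - 1/2` with `m` the floor of `θ_η + 1/2` and of
`-θ_μ + 1/2`. -/
noncomputable def kuperberg (I : NormalizedIntegrals 𝕜 H) : 𝕜 :=
  I.lamHalf ⌊-D.thetaUpperTotal + 1 / 2⌋
    (D.diagramOperator I (I.LamHalf ⌊D.thetaLowerTotal + 1 / 2⌋))

end FramedDiagram

/-- The order of the `n` intersection points on the upper curve in the diagram of `L(n,k)`: the `i`-th
one is `p_j` with `j` the positive residue of `k (i - 1)`, that is, the upper curve starts at `p_n`
and proceeds from `p_i` to `p_{i + k}`, indices modulo `n`. -/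
noncomputable def lensPerm (n k : ℕ) (h : n.Coprime k) : Equiv.Perm (Fin n) :=
  Equiv.ofBijective
    (fun r => ⟨posRes n (k * (r : ℕ)) - 1, by
      have hr := r.isLt
      have h1 := posRes_le (by omega : 0 < n) (k * (r : ℕ))
      have h2 := posRes_pos n (k * (r : ℕ))
      omega⟩)
    (Finite.injective_iff_bijective.1 (by
      intro t t' h'
      have ht := t.isLt
      have ht' := t'.isLt
      have hn : 0 < n := by omega
      have h1 := posRes_pos n (k * (t : ℕ))
      have h1' := posRes_pos n (k * (t' : ℕ))
      have h2 : posRes n (k * (t : ℕ)) = posRes n (k * (t' : ℕ)) := by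
        have := Fin.mk.inj_iff.1 h'
        omega
      have h3 := (posRes_modEq hn (k * (t : ℕ))).symm
      rw [h2] at h3
      have h3' := h3.trans (posRes_modEq hn _)
      rw [mul_comm (k : ℤ), mul_comm (k : ℤ)] at h3'
      have h4 := mul_modEq_cancel (Nat.isCoprime_iff_coprime.2 h) h3'
      unfold Int.ModEq at h4
      rw [Int.emod_eq_of_lt (by omega) (by omega), Int.emod_eq_of_lt (by omega) (by omega)] at h4
      exact Fin.ext (by exact_mod_cast h4)))

/-- The rotation of the tangent of the upper curve relative to the combing along the arc that leaves
`p_i` downwards and ends at the next intersection point or, for `i = n - k`, at the base point,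
for the framing `f_R`, with `k₀ = (n - k - 1) / 2`:
* `i = n`: into the right attaching circle (`1/2`), out of the left one (`-3/4`);
* `1 ≤ i ≤ k₀`: into the left circle (`-3/4`), out of the right one and back into it (`1/2`), out of
  the left circle (`-3/4`);
* `k₀ < i < n - k`: one positive turn;
* `i = n - k`: back to the base point (`3/4`);
* `n - k < i < n`: into the right circle (`3/4`), out of the left one (`-3/4`). -/
def arcRotation (n k i : ℕ) : ℚ :=
  if i = n then 1 / 2 - 3 / 4
  else if i ≤ (n - k - 1) / 2 then -(3 / 4) + 1 / 2 - 3 / 4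
  else if i ≤ n - k - 1 then 1
  else if i = n - k then 3 / 4
  else 3 / 4 - 3 / 4

theorem sum_arcRotation {n k : ℕ} (hk : 0 < k) (hkn : k < n) (hodd : Odd (n - k)) :
    ∑ i ∈ Finset.range n, arcRotation n k (i + 1) = 1 / 2 := by
  obtain ⟨m, hm⟩ := hodd
  obtain ⟨r, rfl⟩ : ∃ r, k = r + 1 := ⟨k - 1, by omega⟩
  have hn : n = m + (m + (1 + (r + 1))) := by omega
  have e1 : n - (r + 1) - 1 = 2 * m := by omega
  have e2 : 2 * m / 2 = m := by omega
  have e3 : n - (r + 1) = 2 * m + 1 := by omega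
  have hf : ∀ i, arcRotation n (r + 1) i = if i = n then 1 / 2 - 3 / 4
      else if i ≤ m then -(3 / 4) + 1 / 2 - 3 / 4
      else if i ≤ 2 * m then 1
      else if i = 2 * m + 1 then 3 / 4
      else 3 / 4 - 3 / 4 := by
    intro i
    rw [arcRotation, e1, e2, e3]
  have s1 : ∑ x ∈ Finset.range m, arcRotation n (r + 1) (x + 1) = -m := by
    rw [Finset.sum_congr rfl (g := fun _ => (-1 : ℚ)) (fun x hx => by
      rw [Finset.mem_range] at hx
      rw [hf, if_neg (by omega), if_pos (by omega)]
      norm_num)]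
    simp
  have s2 : ∑ x ∈ Finset.range m, arcRotation n (r + 1) (m + x + 1) = m := by
    rw [Finset.sum_congr rfl (g := fun _ => (1 : ℚ)) (fun x hx => by
      rw [Finset.mem_range] at hx
      rw [hf, if_neg (by omega), if_neg (by omega), if_pos (by omega)])]
    simp
  have s3 : arcRotation n (r + 1) (m + (m + 0) + 1) = 3 / 4 := by
    rw [hf, if_neg (by omega), if_neg (by omega), if_neg (by omega), if_pos (by omega)]
  have s4 : ∑ x ∈ Finset.range r, arcRotation n (r + 1) (m + (m + (1 + x)) + 1) = 0 :=
    Finset.sum_eq_zero (fun x hx => by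
      rw [Finset.mem_range] at hx
      rw [hf, if_neg (by omega), if_neg (by omega), if_neg (by omega), if_neg (by omega)]
      norm_num)
  have s5 : arcRotation n (r + 1) (m + (m + (1 + (r + 0))) + 1) = 1 / 2 - 3 / 4 := by
    rw [hf, if_pos (by omega)]
  have e : ∑ i ∈ Finset.range n, arcRotation n (r + 1) (i + 1) =
      ∑ i ∈ Finset.range (m + (m + (1 + (r + 1)))), arcRotation n (r + 1) (i + 1) := by rw [← hn]
  rw [e, Finset.sum_range_add, Finset.sum_range_add, Finset.sum_range_add, Finset.sum_range_add,
    Finset.sum_range_one, Finset.sum_range_one, s1]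
  simp only [← add_assoc] at *
  rw [s2, s3, s4, s5]
  ring

/-- The rotation number `θ_μ(p)`: the sum over the arcs of `μ` before `p`. The arc from the base point
to the first intersection point `p_n` contributes `0`. -/
noncomputable def lensThetaUpper (n k : ℕ) (h : n.Coprime k) (p : Fin n) : ℚ :=
  ∑ j ∈ Finset.Iio ((lensPerm n k h).symm p), arcRotation n k ((lensPerm n k h j : ℕ) + 1)

theorem lensPerm_add_one (n k : ℕ) (h : n.Coprime k) (j : Fin n) :
    (lensPerm n k h j : ℕ) + 1 = posRes n (k * (j : ℕ)) := by
  have := posRes_pos n (k * (j : ℕ))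
  change posRes n (k * (j : ℕ)) - 1 + 1 = _
  omega

theorem lens_quarter (n k : ℕ) (hk : 0 < k) (hkn : k < n) (h : n.Coprime k) (p : Fin n) :
    ∃ s : ℤ, 2 * ((if (p : ℕ) + 1 = n then 1 / 4 else 0) - lensThetaUpper n k h p) + 1 / 2 =
      (s : ℚ) := by
  have hn : 0 < n := by omega
  have : NeZero n := ⟨hn.ne'⟩
  obtain ⟨r, rfl⟩ := (lensPerm n k h).surjective p
  have h0 : (lensPerm n k h 0 : ℕ) + 1 = n := by
    rw [lensPerm_add_one]
    exact posRes_unique hn le_rfl (by simp [Int.ModEq])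
  unfold lensThetaUpper
  rw [Equiv.symm_apply_apply]
  rcases eq_or_ne r 0 with hr | hr
  · subst hr
    rw [if_pos h0]
    refine ⟨1, ?_⟩
    have : Finset.Iio (0 : Fin n) = ∅ := by
      ext x
      simp
    rw [this]
    norm_num
  · have hne : ¬ ((lensPerm n k h r : ℕ) + 1 = n) := by
      intro h1
      apply hr
      apply (lensPerm n k h).injective
      apply Fin.ext
      omega
    rw [if_neg hne]
    have hmem : (0 : Fin n) ∈ Finset.Iio r := by
      rw [Finset.mem_Iio]
      exact Fin.pos_iff_ne_zero.2 hr
    rw [← Finset.add_sum_erase _ _ hmem, h0]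
    have hint : ∀ s : Finset (Fin n), (∀ j ∈ s, j ≠ 0 ∧ j < r) → ∃ z : ℤ,
        ∑ j ∈ s, arcRotation n k ((lensPerm n k h j : ℕ) + 1) = z := by
      intro s hs
      have hj : ∀ j ∈ s, ∃ z : ℤ, arcRotation n k ((lensPerm n k h j : ℕ) + 1) = z := by
        intro j hj
        obtain ⟨h1, h2⟩ := hs j hj
        have a1 : (lensPerm n k h j : ℕ) + 1 ≠ n := by
          intro h3
          apply h1
          apply (lensPerm n k h).injective
          apply Fin.ext
          omega
        have a2 : (lensPerm n k h j : ℕ) + 1 ≠ n - k := by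
          intro h3
          rw [lensPerm_add_one] at h3
          have h4 := posRes_modEq hn (k * (j : ℕ))
          rw [h3, Nat.cast_sub hkn.le] at h4
          have h5 : (-1 : ℤ) * k ≡ (j : ℕ) * k [ZMOD n] := by
            rw [mul_comm ((j : ℕ) : ℤ)]
            refine Int.ModEq.trans ?_ h4
            simp [Int.ModEq]
          have h6 := (mul_modEq_cancel (Nat.isCoprime_iff_coprime.2 h) h5).dvd
          have h7 : (n : ℤ) ∣ (((j : ℕ) + 1 : ℕ) : ℤ) := by
            push_cast
            simpa using h6
          have h8 := Nat.le_of_dvd (Nat.succ_pos _) (Int.natCast_dvd_natCast.1 h7)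
          have h9 : (j : ℕ) < r := h2
          have := r.isLt
          omega
        unfold arcRotation
        rw [if_neg a1]
        split_ifs
        · exact ⟨-1, by norm_num⟩
        · exact ⟨1, by norm_num⟩
        · exact ⟨0, by norm_num⟩
      choose! z hz using hj
      exact ⟨∑ j ∈ s, z j, by rw [Int.cast_sum]; exact Finset.sum_congr rfl hz⟩
    obtain ⟨z, hz⟩ := hint ((Finset.Iio r).erase 0) (by
      intro j hj
      rw [Finset.mem_erase, Finset.mem_Iio] at hj
      exact hj)
    rw [hz]
    refine ⟨1 - 2 * z, ?_⟩
    rw [arcRotation, if_pos rfl]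
    push_cast
    ring

/-- The framed Heegaard diagram of the lens space `L(n,k)`, with `n - k` odd, that defines the framing
`f_R`. Along the lower curve the tangent is parallel to the combing at `p_1, …, p_{n-1}`, has made a
quarter turn at `p_n` and a half turn at the end. The curves meet the twist front only at their base
points, positively for the lower curve and negatively for the upper one. -/
noncomputable def lensDiagramR (n k : ℕ) (hk : 0 < k) (hkn : k < n) (h : n.Coprime k)
    (hodd : Odd (n - k)) : FramedDiagram where
  n := n
  σ := lensPerm n k h
  thetaLower p := if (p : ℕ) + 1 = n then 1 / 4 else 0
  thetaUpper := lensThetaUpper n k h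
  phiLower _ := 0
  phiUpper _ := 0
  thetaLowerTotal := 1 / 2
  thetaUpperTotal := ∑ j : Fin n, arcRotation n k ((lensPerm n k h j : ℕ) + 1)
  phiLowerTotal := 1 / 2
  phiUpperTotal := -(1 / 2)
  half_lower := ⟨1, by norm_num⟩
  half_upper := ⟨1, by
    rw [Equiv.sum_comp (lensPerm n k h) (fun i : Fin n => arcRotation n k ((i : ℕ) + 1)),
      Fin.sum_univ_eq_sum_range (fun i => arcRotation n k (i + 1)), sum_arcRotation hk hkn hodd]
    norm_num⟩
  quarter := lens_quarter n k hk hkn h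
  admissible_lower := rfl
  admissible_upper := by
    rw [Equiv.sum_comp (lensPerm n k h) (fun i : Fin n => arcRotation n k ((i : ℕ) + 1)),
      Fin.sum_univ_eq_sum_range (fun i => arcRotation n k (i + 1)), sum_arcRotation hk hkn hodd]
    norm_num

/-! Both claims rest on the same quantity. For normalized integrals the trace formula Tr(φ) = ∑
λ(S(Λ₂) φ(Λ₁)) (`IsIntegralPair.trace_eq`) identifies the Kuperberg invariant of the diagram with
Tr(S ∘ P) (`kuperberg_lensDiagramR`), so everything reduces to the invariance of that trace under
twisting (`trace_shuffledSweedlerPower_twist`).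

In the twist, the iterated comultiplication is conjugated by an iterated cocycle, and S_F² is S²
followed by conjugation with w = u S(u⁻¹). Hence P_F(x) is the shuffled product of G f(x) G⁻¹, where
f(x) = ∑ ⨂ S^{2c_i}(x_(i)) and G = `listCocycle` collects F and the units W of the powers of S_F².
Positions are classes in ℤ/n, multiplied in the order -k, -2k, …, 0. A factor on the right of a
position x ≠ 0 equals a factor on the left of the next position x - k, so G⁻¹ slides to the left end
with all its positions shifted by -k. Cyclicity of the trace, together with the conjugation by u in
S_F, adds position 0 to G and position -k to the shifted G⁻¹. The twisted trace becomes
Ψ(`listCocycleInv` L' · `listCocycle` L), where Ψ(z) = Tr(x ↦ S(chain(z f(x)))) and the untwisted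
one is Ψ(1).

L and L' fill the same positions 1, …, n with exponents c_i and c_{i+k}. By the recursion for c they
split into blocks A, B, Y, on which the exponent goes up by one, goes down by one, or stays; L is A,
B, Y and L' is Y', A', B'. Inside each block the two cocycles cancel up to w⁻¹ or S⁻²(w)
(`listCocycleInv_mul_twisted`), because Δ(w) is F⁻¹ (w ⊗ w) (S² ⊗ S²)(F). What remains is an
expression with only four copies of F^{±1}, and `functional_invariance` shows that Ψ sends it to
Ψ(1): the outer two copies cancel through position Y, and the inner two through
`IsTwistedTrace.cocycle_eq`.

The bijectivity of S and the existence and uniqueness of integrals are proved along the way,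
starting from an integral written as a trace (`traceIntegral`). -/

namespace HopfTrace

open Coalgebra HopfAlgebra

/-! ### Convolution of linear maps from a Hopf algebra to an algebra. -/

section Convolution

variable {𝕜 H R : Type*} [Field 𝕜] [Ring H] [HopfAlgebra 𝕜 H] [Ring R] [Algebra 𝕜 R]

/-- `a ⊗ b ↦ f(a) g(b)`. -/
noncomputable def pairMul (f g : H →ₗ[𝕜] R) : H ⊗[𝕜] H →ₗ[𝕜] R :=
  LinearMap.mul' 𝕜 R ∘ₗ TensorProduct.map f g

@[simp] theorem pairMul_tmul (f g : H →ₗ[𝕜] R) (a b : H) :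
    pairMul f g (a ⊗ₜ[𝕜] b) = f a * g b := by simp [pairMul]

/-- The convolution product `h ↦ ∑ f(h₁) g(h₂)`. -/
noncomputable def conv (f g : H →ₗ[𝕜] R) : H →ₗ[𝕜] R := pairMul f g ∘ₗ comul

theorem conv_apply (f g : H →ₗ[𝕜] R) (h : H) : conv f g h = pairMul f g (comul h) := rfl

variable (𝕜 H R) in
/-- The unit `h ↦ ε(h) 1` of the convolution product. -/
noncomputable def convUnit : H →ₗ[𝕜] R := Algebra.linearMap 𝕜 R ∘ₗ counit

theorem convUnit_apply (h : H) : convUnit 𝕜 H R h = algebraMap 𝕜 R (counit (R := 𝕜) h) := rfl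

/-- The product `conv` agrees definitionally with the multiplication of `WithConv`, so the monoid
laws are inherited from the convolution algebra. -/
theorem conv_assoc (f g h : H →ₗ[𝕜] R) : conv (conv f g) h = conv f (conv g h) := by
  have := mul_assoc (WithConv.toConv f) (WithConv.toConv g) (WithConv.toConv h)
  exact congrArg WithConv.ofConv this

theorem conv_unit (f : H →ₗ[𝕜] R) : conv f (convUnit 𝕜 H R) = f :=
  congrArg WithConv.ofConv (mul_one (WithConv.toConv f))

theorem unit_conv (f : H →ₗ[𝕜] R) : conv (convUnit 𝕜 H R) f = f :=
  congrArg WithConv.ofConv (one_mul (WithConv.toConv f))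

/-- A linear map that preserves products and the unit. -/
structure IsAlg (f : H →ₗ[𝕜] R) : Prop where
  map_one : f 1 = 1
  map_mul : ∀ x y, f (x * y) = f x * f y

theorem isAlg_algHom (f : H →ₐ[𝕜] R) : IsAlg f.toLinearMap := ⟨by simp, by simp⟩

theorem isAlg_convUnit : IsAlg (convUnit 𝕜 H R) :=
  ⟨by simp [convUnit], by simp [convUnit]⟩

theorem pairMul_commute {f g : H →ₗ[𝕜] R} {r : R} (hf : ∀ x, Commute (f x) r)
    (hg : ∀ x, Commute (g x) r) (X : H ⊗[𝕜] H) : Commute (pairMul f g X) r := by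
  induction X with
  | zero => simp
  | tmul a b => rw [pairMul_tmul]; exact (hf a).mul_left (hg b)
  | add x y hx hy => rw [map_add]; exact hx.add_left hy

theorem conv_commute {f g : H →ₗ[𝕜] R} {r : R} (hf : ∀ x, Commute (f x) r)
    (hg : ∀ x, Commute (g x) r) (x : H) : Commute (conv f g x) r :=
  pairMul_commute hf hg _

theorem convUnit_commute (r : R) (x : H) : Commute (convUnit 𝕜 H R x) r :=
  Algebra.commute_algebraMap_left _ _

/-- Two algebra maps with commuting images define an algebra map on the tensor square. This is how
identities in H ⊗ H are transported to R. -/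
theorem pairMul_mul {f g : H →ₗ[𝕜] R} (hf : IsAlg f) (hg : IsAlg g)
    (hc : ∀ x y, Commute (f x) (g y)) (X Y : H ⊗[𝕜] H) :
    pairMul f g (X * Y) = pairMul f g X * pairMul f g Y := by
  induction X with
  | zero => simp
  | add x y hx hy => rw [add_mul, map_add, map_add, hx, hy, add_mul]
  | tmul a b => induction Y with
    | zero => simp
    | add x y hx hy => rw [mul_add, map_add, map_add, hx, hy, mul_add]
    | tmul c d =>
      simp only [Algebra.TensorProduct.tmul_mul_tmul, pairMul_tmul, hf.map_mul, hg.map_mul]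
      rw [mul_assoc, mul_assoc, ← mul_assoc (f c), (hc c b).eq, mul_assoc]

theorem pairMul_one {f g : H →ₗ[𝕜] R} (hf : IsAlg f) (hg : IsAlg g) : pairMul f g 1 = 1 := by
  rw [Algebra.TensorProduct.one_def, pairMul_tmul, hf.map_one, hg.map_one, one_mul]

theorem isAlg_conv {f g : H →ₗ[𝕜] R} (hf : IsAlg f) (hg : IsAlg g)
    (hc : ∀ x y, Commute (f x) (g y)) : IsAlg (conv f g) where
  map_one := by rw [conv_apply, Bialgebra.comul_one, pairMul_one hf hg]
  map_mul x y := by rw [conv_apply, Bialgebra.comul_mul, pairMul_mul hf hg hc]; rfl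

theorem pairMul_comp (f g : H →ₗ[𝕜] R) (p q : H →ₗ[𝕜] H) (X : H ⊗[𝕜] H) :
    pairMul (f ∘ₗ p) (g ∘ₗ q) X = pairMul f g (TensorProduct.map p q X) := by
  rw [pairMul, TensorProduct.map_comp]; rfl

theorem conv_comp {f g : H →ₗ[𝕜] R} {p : H →ₗ[𝕜] H}
    (hp : ∀ x, comul (R := 𝕜) (p x) = TensorProduct.map p p (comul x)) :
    conv (f ∘ₗ p) (g ∘ₗ p) = conv f g ∘ₗ p := by
  ext x
  rw [conv_apply, pairMul_comp, ← hp]; rfl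

theorem convUnit_comp {p : H →ₗ[𝕜] H} (hp : ∀ x, counit (R := 𝕜) (p x) = counit (R := 𝕜) x) :
    convUnit 𝕜 H R ∘ₗ p = convUnit 𝕜 H R := by
  ext x
  simp [convUnit_apply, hp]

theorem map_counit_left (X : H ⊗[𝕜] H) (g : H →ₗ[𝕜] R) :
    pairMul (convUnit 𝕜 H R) g X =
      g (TensorProduct.lid 𝕜 H ((counit (R := 𝕜) (A := H)).rTensor H X)) := by
  induction X with
  | zero => simp
  | add x y hx hy => simp only [map_add, hx, hy]
  | tmul a b =>
    rw [LinearMap.rTensor_tmul, TensorProduct.lid_tmul, map_smul, pairMul_tmul, convUnit_apply,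
      Algebra.smul_def]

theorem map_counit_right (X : H ⊗[𝕜] H) (f : H →ₗ[𝕜] R) :
    pairMul f (convUnit 𝕜 H R) X =
      f (TensorProduct.rid 𝕜 H ((counit (R := 𝕜) (A := H)).lTensor H X)) := by
  induction X with
  | zero => simp
  | add x y hx hy => simp only [map_add, hx, hy]
  | tmul a b =>
    rw [LinearMap.lTensor_tmul, TensorProduct.rid_tmul, map_smul, pairMul_tmul, convUnit_apply,
      ← Algebra.commutes, Algebra.smul_def]

end Convolution

end HopfTrace

/-! ### The cocycle identities evaluated at commuting algebra maps. -/

namespace TwoCocycle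

open HopfTrace Coalgebra HopfAlgebra

variable {𝕜 H R : Type*} [Field 𝕜] [Ring H] [HopfAlgebra 𝕜 H] [Ring R] [Algebra 𝕜 R]

/-- The cocycle as an element of `H ⊗ H`. -/
abbrev val (F : TwoCocycle 𝕜 H) : H ⊗[𝕜] H := F.toUnits

/-- The inverse of the cocycle as an element of `H ⊗ H`. -/
abbrev inv (F : TwoCocycle 𝕜 H) : H ⊗[𝕜] H := ((F.toUnits⁻¹ : (H ⊗[𝕜] H)ˣ) : H ⊗[𝕜] H)

theorem val_mul_inv (F : TwoCocycle 𝕜 H) : F.val * F.inv = 1 := F.toUnits.mul_inv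
theorem inv_mul_val (F : TwoCocycle 𝕜 H) : F.inv * F.val = 1 := F.toUnits.inv_mul

theorem pairMul_val_mul_inv (F : TwoCocycle 𝕜 H) {f g : H →ₗ[𝕜] R} (hf : IsAlg f) (hg : IsAlg g)
    (hc : ∀ x y, Commute (f x) (g y)) : pairMul f g F.val * pairMul f g F.inv = 1 := by
  rw [← pairMul_mul hf hg hc, val_mul_inv, pairMul_one hf hg]

theorem pairMul_inv_mul_val (F : TwoCocycle 𝕜 H) {f g : H →ₗ[𝕜] R} (hf : IsAlg f) (hg : IsAlg g)
    (hc : ∀ x y, Commute (f x) (g y)) : pairMul f g F.inv * pairMul f g F.val = 1 := by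
  rw [← pairMul_mul hf hg hc, inv_mul_val, pairMul_one hf hg]

/-- The cocycle identity, evaluated at three commuting algebra maps. -/
theorem pairMul_cocycle (F : TwoCocycle 𝕜 H) {f g h : H →ₗ[𝕜] R} (hf : IsAlg f) (hg : IsAlg g)
    (hh : IsAlg h) (hfg : ∀ x y, Commute (f x) (g y)) (hfh : ∀ x y, Commute (f x) (h y))
    (hgh : ∀ x y, Commute (g x) (h y)) :
    pairMul f g F.val * pairMul (conv f g) h F.val =
      pairMul g h F.val * pairMul f (conv g h) F.val := by
  -- The three maps combine to f ⊗ (g ⊗ h) followed by multiplication, which is multiplicative since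
  -- the images commute. The claim is the image under τ of the cocycle identity.
  let τ : H ⊗[𝕜] (H ⊗[𝕜] H) →ₗ[𝕜] R := LinearMap.mul' 𝕜 R ∘ₗ TensorProduct.map f (pairMul g h)
  have hτ : ∀ a X, τ (a ⊗ₜ X) = f a * pairMul g h X := fun a X => by simp [τ]
  have hfX : ∀ a X, Commute (f a) (pairMul g h X) := fun a X =>
    (pairMul_commute (fun x => (hfg a x).symm) (fun x => (hfh a x).symm) X).symm
  have hmul : ∀ X Y, τ (X * Y) = τ X * τ Y := by
    intro X Y
    induction X with
    | zero => simp
    | add x y hx hy => rw [add_mul, map_add, map_add, hx, hy, add_mul]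
    | tmul a P => induction Y with
      | zero => simp
      | add x y hx hy => rw [mul_add, map_add, map_add, hx, hy, mul_add]
      | tmul b Q =>
        simp only [Algebra.TensorProduct.tmul_mul_tmul, hτ, hf.map_mul, pairMul_mul hg hh hgh]
        rw [mul_assoc, mul_assoc, ← mul_assoc (f b), (hfX b P).eq, mul_assoc]
  have h1 : ∀ (X : H ⊗[𝕜] H) (c : H), τ (TensorProduct.assoc 𝕜 H H H (X ⊗ₜ c)) =
      pairMul f g X * h c := by
    intro X c
    induction X with
    | zero => simp
    | add x y hx hy => simp only [TensorProduct.add_tmul, map_add, hx, hy, add_mul]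
    | tmul a b => simp [hτ, mul_assoc]
  have h2 : ∀ X : H ⊗[𝕜] H, τ (TensorProduct.assoc 𝕜 H H H
      ((comul (R := 𝕜) (A := H)).rTensor H X)) = pairMul (conv f g) h X := by
    intro X
    induction X with
    | zero => simp
    | add x y hx hy => simp only [map_add, hx, hy]
    | tmul a b => rw [LinearMap.rTensor_tmul, h1, pairMul_tmul, conv_apply]
  have h3 : ∀ X : H ⊗[𝕜] H, τ ((comul (R := 𝕜) (A := H)).lTensor H X) =
      pairMul f (conv g h) X := by
    intro X
    induction X with
    | zero => simp
    | add x y hx hy => simp only [map_add, hx, hy]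
    | tmul a b => rw [LinearMap.lTensor_tmul, hτ, pairMul_tmul, conv_apply]
  have := congrArg τ F.cocycle_mul
  rw [hmul, hmul, h1, h2, h3, hτ, hf.map_one, hh.map_one, mul_one, one_mul] at this
  exact this

/-- The cocycle identity for the inverse cocycle. -/
theorem pairMul_inv_cocycle (F : TwoCocycle 𝕜 H) {f g h : H →ₗ[𝕜] R} (hf : IsAlg f)
    (hg : IsAlg g) (hh : IsAlg h) (hfg : ∀ x y, Commute (f x) (g y))
    (hfh : ∀ x y, Commute (f x) (h y)) (hgh : ∀ x y, Commute (g x) (h y)) :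
    pairMul (conv f g) h F.inv * pairMul f g F.inv =
      pairMul f (conv g h) F.inv * pairMul g h F.inv := by
  have hc := F.pairMul_cocycle hf hg hh hfg hfh hgh
  have c1 : ∀ x y, Commute (conv f g x) (h y) := fun x y =>
    conv_commute (fun z => hfh z y) (fun z => hgh z y) x
  have c2 : ∀ x y, Commute (f x) (conv g h y) := fun x y =>
    (conv_commute (fun z => (hfg x z).symm) (fun z => (hfh x z).symm) y).symm
  -- The two sides are a left inverse and a right inverse of the same element, namely the common
  -- value in the cocycle identity for F.
  have e1 : (pairMul (conv f g) h F.inv * pairMul f g F.inv) *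
      (pairMul f g F.val * pairMul (conv f g) h F.val) = 1 := by
    rw [mul_assoc, ← mul_assoc (pairMul f g F.inv), F.pairMul_inv_mul_val hf hg hfg, one_mul,
      F.pairMul_inv_mul_val (isAlg_conv hf hg hfg) hh c1]
  have e2 : (pairMul g h F.val * pairMul f (conv g h) F.val) *
      (pairMul f (conv g h) F.inv * pairMul g h F.inv) = 1 := by
    rw [mul_assoc, ← mul_assoc (pairMul f (conv g h) F.val),
      F.pairMul_val_mul_inv hf (isAlg_conv hg hh hgh) c2, one_mul,
      F.pairMul_val_mul_inv hg hh hgh]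
  rw [hc] at e1
  exact left_inv_eq_right_inv e1 e2

end TwoCocycle

namespace HopfTrace

open Coalgebra HopfAlgebra

/-! ### Iterated cocycles along lists of commuting algebra maps. -/

section Slots

variable (𝕜 H R : Type*) [Field 𝕜] [Ring H] [HopfAlgebra 𝕜 H] [Ring R] [Algebra 𝕜 R]

/-- A linear map `H → R` together with a unit of `R`. -/
structure Slot where
  hom : H →ₗ[𝕜] R
  unit : Rˣ

variable {𝕜 H R}

/-- The element `r` commutes with the image and with the unit of the slot. -/
def Slot.CommutesWith (s : Slot 𝕜 H R) (r : R) : Prop :=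
  (∀ x, Commute (s.hom x) r) ∧ Commute (s.unit : R) r

/-- The two slots commute elementwise. -/
def Slot.Indep (s t : Slot 𝕜 H R) : Prop :=
  (∀ x, s.CommutesWith (t.hom x)) ∧ s.CommutesWith (t.unit : R)

/-- A list of algebra maps with units, such that distinct entries commute. -/
def IsIndep (l : List (Slot 𝕜 H R)) : Prop :=
  (∀ s ∈ l, IsAlg s.hom) ∧ l.Pairwise Slot.Indep

/-- The convolution product of the maps in the list. -/
noncomputable def listConv : List (Slot 𝕜 H R) → H →ₗ[𝕜] R
  | [] => convUnit 𝕜 H R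
  | s :: l => conv s.hom (listConv l)

/-- The iterated cocycle along a list, with the units of the slots on the left. -/
noncomputable def listCocycle (F : TwoCocycle 𝕜 H) : List (Slot 𝕜 H R) → R
  | [] => 1
  | s :: l => s.unit * listCocycle F l * pairMul s.hom (listConv l) F.val

/-- The inverse of `listCocycle`. -/
noncomputable def listCocycleInv (F : TwoCocycle 𝕜 H) : List (Slot 𝕜 H R) → R
  | [] => 1
  | s :: l => pairMul s.hom (listConv l) F.inv * listCocycleInv F l * (s.unit⁻¹ : Rˣ)

variable {l m : List (Slot 𝕜 H R)} (F : TwoCocycle 𝕜 H)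

theorem listConv_append (l m : List (Slot 𝕜 H R)) :
    listConv (l ++ m) = conv (listConv l) (listConv m) := by
  induction l with
  | nil => simp [listConv, unit_conv]
  | cons s l ih => simp [listConv, ih, conv_assoc]

theorem listConv_singleton (s : Slot 𝕜 H R) : listConv [s] = s.hom := by
  simp [listConv, conv_unit]

theorem listConv_commute {r : R} (h : ∀ s ∈ l, s.CommutesWith r) (x : H) :
    Commute (listConv l x) r := by
  induction l generalizing x with
  | nil => exact convUnit_commute r x
  | cons s l ih =>
    exact conv_commute (h s (by simp)).1 (ih fun t ht => h t (by simp [ht])) x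

theorem listCocycle_commute {r : R} (h : ∀ s ∈ l, s.CommutesWith r) :
    Commute (listCocycle F l) r := by
  induction l with
  | nil => exact Commute.one_left r
  | cons s l ih =>
    have hl : ∀ t ∈ l, t.CommutesWith r := fun t ht => h t (by simp [ht])
    exact (((h s (by simp)).2.mul_left (ih hl))).mul_left
      (pairMul_commute (h s (by simp)).1 (listConv_commute hl) _)

theorem listCocycleInv_commute {r : R} (h : ∀ s ∈ l, s.CommutesWith r) :
    Commute (listCocycleInv F l) r := by
  induction l with
  | nil => exact Commute.one_left r
  | cons s l ih =>
    have hl : ∀ t ∈ l, t.CommutesWith r := fun t ht => h t (by simp [ht])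
    exact ((pairMul_commute (h s (by simp)).1 (listConv_commute hl) _).mul_left (ih hl)).mul_left
      (h s (by simp)).2.units_inv_left

theorem IsIndep.tail {s : Slot 𝕜 H R} (h : IsIndep (s :: l)) : IsIndep l :=
  ⟨fun t ht => h.1 t (by simp [ht]), (List.pairwise_cons.1 h.2).2⟩

theorem IsIndep.append_left (h : IsIndep (l ++ m)) : IsIndep l :=
  ⟨fun t ht => h.1 t (by simp [ht]), (List.pairwise_append.1 h.2).1⟩

theorem IsIndep.append_right (h : IsIndep (l ++ m)) : IsIndep m :=
  ⟨fun t ht => h.1 t (by simp [ht]), (List.pairwise_append.1 h.2).2.1⟩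

theorem Slot.Indep.symm {s t : Slot 𝕜 H R} (h : s.Indep t) : t.Indep s :=
  ⟨fun x => ⟨fun y => ((h.1 y).1 x).symm, (h.2.1 x).symm⟩, fun y => ((h.1 y).2).symm, h.2.2.symm⟩

/-- Every slot in `l` commutes with every slot in `m`. -/
def ListIndep (l m : List (Slot 𝕜 H R)) : Prop := ∀ s ∈ l, ∀ t ∈ m, s.Indep t

theorem ListIndep.symm (h : ListIndep l m) : ListIndep m l :=
  fun s hs t ht => (h t ht s hs).symm

theorem IsIndep.listIndep (h : IsIndep (l ++ m)) : ListIndep l m :=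
  fun s hs t ht => (List.pairwise_append.1 h.2).2.2 s hs t ht

theorem IsIndep.listIndep_cons {s : Slot 𝕜 H R} (h : IsIndep (s :: m)) : ListIndep [s] m :=
  IsIndep.listIndep (l := [s]) h

theorem ListIndep.conv_commutesWith (h : ListIndep l m) {s : Slot 𝕜 H R} (hs : s ∈ l) (x : H) :
    s.CommutesWith (listConv m x) :=
  ⟨fun y => (listConv_commute (fun t ht => ((h s hs t ht).symm.1 y)) x).symm,
    (listConv_commute (fun t ht => ((h s hs t ht).symm.2)) x).symm⟩

theorem ListIndep.conv_conv (h : ListIndep l m) (x y : H) :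
    Commute (listConv l x) (listConv m y) :=
  listConv_commute (fun _ hs => h.conv_commutesWith hs y) x

theorem ListIndep.cocycle_commutesWith (h : ListIndep l m) {s : Slot 𝕜 H R} (hs : s ∈ l) :
    s.CommutesWith (listCocycle F m) :=
  ⟨fun y => (listCocycle_commute F (fun t ht => ((h s hs t ht).symm.1 y))).symm,
    (listCocycle_commute F (fun t ht => ((h s hs t ht).symm.2))).symm⟩

theorem ListIndep.cocycleInv_commutesWith (h : ListIndep l m) {s : Slot 𝕜 H R} (hs : s ∈ l) :
    s.CommutesWith (listCocycleInv F m) :=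
  ⟨fun y => (listCocycleInv_commute F (fun t ht => ((h s hs t ht).symm.1 y))).symm,
    (listCocycleInv_commute F (fun t ht => ((h s hs t ht).symm.2))).symm⟩

theorem IsIndep.conv_hom {s : Slot 𝕜 H R} (h : IsIndep (s :: l)) (x y : H) :
    Commute (s.hom x) (listConv l y) :=
  (h.listIndep_cons.conv_commutesWith (List.mem_singleton_self s) y).1 x

theorem isAlg_listConv (h : IsIndep l) : IsAlg (listConv l) := by
  induction l with
  | nil => exact isAlg_convUnit
  | cons s l ih => exact isAlg_conv (h.1 s (by simp)) (ih h.tail) h.conv_hom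

theorem listCocycleInv_mul (h : IsIndep l) : listCocycleInv F l * listCocycle F l = 1 := by
  induction l with
  | nil => simp [listCocycleInv, listCocycle]
  | cons s l ih =>
    have e : ∀ p b a q : R, p * b * (s.unit⁻¹ : Rˣ) * (s.unit * a * q) = p * (b * a) * q := by
      intro p b a q
      simp [mul_assoc]
    rw [listCocycleInv, listCocycle, e, ih h.tail, mul_one,
      F.pairMul_inv_mul_val (h.1 s (by simp)) (isAlg_listConv h.tail) h.conv_hom]

theorem listCocycle_mul (h : IsIndep l) : listCocycle F l * listCocycleInv F l = 1 := by
  induction l with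
  | nil => simp [listCocycleInv, listCocycle]
  | cons s l ih =>
    have e : ∀ p b a q : R, s.unit * a * p * (q * b * (s.unit⁻¹ : Rˣ)) =
        s.unit * (a * (p * q) * b) * (s.unit⁻¹ : Rˣ) := by
      intro p b a q
      simp [mul_assoc]
    rw [listCocycleInv, listCocycle, e,
      F.pairMul_val_mul_inv (h.1 s (by simp)) (isAlg_listConv h.tail) h.conv_hom, mul_one,
      ih h.tail, mul_one, Units.mul_inv]

/-- The iterated cocycle does not depend on the bracketing: a list can be cut anywhere, at the price
of one copy of F between the two halves. The induction moves one slot across the cut with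
`pairMul_cocycle`; the empty list uses the normalization of F. -/
theorem listCocycle_append (h : IsIndep (l ++ m)) :
    listCocycle F (l ++ m) =
      listCocycle F l * listCocycle F m * pairMul (listConv l) (listConv m) F.val := by
  induction l with
  | nil =>
    rw [List.nil_append, listCocycle, one_mul, listConv, map_counit_left, F.counit_left,
      (isAlg_listConv h.append_right).map_one, mul_one]
  | cons s l ih =>
    have h' : IsIndep (l ++ m) := h.tail
    have hs : IsIndep (s :: l) := IsIndep.append_left (l := s :: l) h
    have hlm := h'.listIndep
    have hsm : ListIndep (s :: l) m := IsIndep.listIndep (l := s :: l) h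
    have hc := F.pairMul_cocycle (h.1 s (by simp)) (isAlg_listConv h'.append_left)
      (isAlg_listConv h'.append_right) hs.conv_hom
      (fun x y => (hsm.conv_commutesWith (by simp) y).1 x) hlm.conv_conv
    have hcomm : Commute (pairMul s.hom (listConv l) F.val) (listCocycle F m) :=
      pairMul_commute (hsm.cocycle_commutesWith F (by simp)).1
        (listConv_commute fun t ht => hlm.cocycle_commutesWith F ht) _
    rw [List.cons_append, listCocycle, ih h', listConv_append, listCocycle, listConv]
    simp only [mul_assoc]
    -- The copy of F between s and l has to pass the cocycle of m, with which it commutes because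
    -- all slots of m are independent of s and l.
    rw [← hc, ← mul_assoc (pairMul s.hom _ _), hcomm.eq]
    simp only [mul_assoc]

theorem listCocycleInv_append (h : IsIndep (l ++ m)) :
    listCocycleInv F (l ++ m) =
      pairMul (listConv l) (listConv m) F.inv * listCocycleInv F m * listCocycleInv F l := by
  refine left_inv_eq_right_inv (listCocycleInv_mul F h) ?_
  rw [listCocycle_append F h]
  have e : ∀ a b p q c d : R, a * b * p * (q * c * d) = a * (b * (p * q) * c) * d := by
    intros; simp only [mul_assoc]
  rw [e, F.pairMul_val_mul_inv (isAlg_listConv h.append_left) (isAlg_listConv h.append_right)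
    h.listIndep.conv_conv, mul_one, listCocycle_mul F h.append_right, mul_one,
    listCocycle_mul F h.append_left]

theorem listCocycle_singleton (s : Slot 𝕜 H R) (h : IsAlg s.hom) :
    listCocycle F [s] = s.unit := by
  rw [listCocycle, listCocycle, listConv, map_counit_right, F.counit_right, h.map_one, mul_one,
    mul_one]

/-- The slot `t` arises from `s` by composing with `p`, and its unit differs from that of `s` by
`s(v)`. -/
structure Slot.Twisted (p : H →ₗ[𝕜] H) (v : H) (t s : Slot 𝕜 H R) : Prop where
  hom_eq : t.hom = s.hom ∘ₗ p
  unit_eq : ((t.unit⁻¹ : Rˣ) : R) * s.unit = s.hom v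

/-- The relation of the units reads t.unit⁻¹ = s(v) s.unit⁻¹, so everything that commutes with s
commutes with t. Independence therefore has to be assumed only for the untwisted list. -/
theorem Slot.Twisted.commutesWith {p : H →ₗ[𝕜] H} {v : H} {t s : Slot 𝕜 H R}
    (h : t.Twisted p v s) {r : R} (hr : s.CommutesWith r) : t.CommutesWith r := by
  refine ⟨fun x => by rw [h.hom_eq]; exact hr.1 (p x), ?_⟩
  have e : ((t.unit⁻¹ : Rˣ) : R) = s.hom v * ((s.unit⁻¹ : Rˣ) : R) := by
    rw [← h.unit_eq, mul_assoc, Units.mul_inv, mul_one]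
  have : Commute ((t.unit⁻¹ : Rˣ) : R) r := by
    rw [e]
    exact (hr.1 v).mul_left hr.2.units_inv_left
  simpa using this.units_inv_left

theorem listConv_twisted {p : H →ₗ[𝕜] H} {v : H}
    (hp : ∀ x, comul (R := 𝕜) (p x) = TensorProduct.map p p (comul x))
    (hε : ∀ x, counit (R := 𝕜) (p x) = counit (R := 𝕜) x)
    (h : List.Forall₂ (Slot.Twisted p v) m l) : listConv m = listConv l ∘ₗ p := by
  induction h with
  | nil => exact (convUnit_comp hε).symm
  | cons h1 _ ih => rw [listConv, listConv, h1.hom_eq, ih, conv_comp hp]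

theorem twisted_commutesWith {p : H →ₗ[𝕜] H} {v : H}
    (h : List.Forall₂ (Slot.Twisted p v) m l) {r : R} (hr : ∀ s ∈ l, s.CommutesWith r) :
    ∀ t ∈ m, t.CommutesWith r := by
  induction h with
  | nil => simp
  | cons h1 _ ih =>
    intro t ht
    rcases List.mem_cons.1 ht with rfl | ht
    · exact h1.commutesWith (hr _ (by simp))
    · exact ih (fun s hs => hr s (by simp [hs])) t ht

/-- Iterated cocycles along twisted lists cancel if `Δ(v) = (p ⊗ p)(F⁻¹) (v ⊗ v) F`. -/
theorem listCocycleInv_mul_twisted {p : H →ₗ[𝕜] H} {v : H}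
    (hp : ∀ x, comul (R := 𝕜) (p x) = TensorProduct.map p p (comul x))
    (hε : ∀ x, counit (R := 𝕜) (p x) = counit (R := 𝕜) x)
    (hv : comul (R := 𝕜) v = TensorProduct.map p p F.inv * (v ⊗ₜ[𝕜] v) * F.val)
    (hv1 : counit (R := 𝕜) v = 1) (hl : IsIndep l)
    (h : List.Forall₂ (Slot.Twisted p v) m l) :
    listCocycleInv F m * listCocycle F l = listConv l v := by
  induction h with
  | nil => simp [listCocycleInv, listCocycle, listConv, convUnit_apply, hv1]
  | @cons t s m l h1 h2 ih =>
    have hlp := hl.tail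
    have hc1 : Commute (listCocycleInv F m) (s.hom v) :=
      listCocycleInv_commute F (twisted_commutesWith h2 fun t ht =>
        (hl.listIndep_cons.symm t ht s (List.mem_singleton_self s)).1 v)
    have e : ∀ q b w a r : R, q * b * w * (s.unit * a * r) = q * (b * (w * s.unit) * a) * r := by
      intros; simp only [mul_assoc]
    -- The adjacent units give s(v) and the tails give `listConv l v` by induction. The rest is the
    -- value of s ⊗ `listConv l` at (p ⊗ p)(F⁻¹) (v ⊗ v) F, which is Δ(v) by assumption.
    rw [listCocycleInv, listCocycle, e, h1.unit_eq, hc1.eq, mul_assoc (s.hom v), ih hlp,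
      h1.hom_eq, listConv_twisted hp hε h2, pairMul_comp, ← pairMul_tmul,
      ← pairMul_mul (hl.1 s (by simp)) (isAlg_listConv hlp) hl.conv_hom,
      ← pairMul_mul (hl.1 s (by simp)) (isAlg_listConv hlp) hl.conv_hom, ← hv]
    rfl

end Slots

end HopfTrace

namespace HopfTrace

open Coalgebra HopfAlgebra

/-! ### The antipode, its square and its inverse. -/

section Antipode

variable {𝕜 H R : Type*} [Field 𝕜] [Ring H] [HopfAlgebra 𝕜 H] [Ring R] [Algebra 𝕜 R]

theorem pairMul_algHom_comp (f : H →ₗ[𝕜] R) (hf : IsAlg f) (p q : H →ₗ[𝕜] H) (X : H ⊗[𝕜] H) :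
    pairMul (f ∘ₗ p) (f ∘ₗ q) X = f (pairMul p q X) := by
  induction X with
  | zero => simp
  | add x y hx hy => simp only [map_add, hx, hy]
  | tmul a b => simp [hf.map_mul]

theorem isAlg_algebraMap {f : H →ₗ[𝕜] R} (hf : IsAlg f) (c : 𝕜) :
    f (algebraMap 𝕜 H c) = algebraMap 𝕜 R c := by
  rw [Algebra.algebraMap_eq_smul_one, map_smul, hf.map_one, Algebra.algebraMap_eq_smul_one]

theorem antipode_conv_self {f : H →ₗ[𝕜] R} (hf : IsAlg f) :
    conv (f ∘ₗ antipode 𝕜) f = convUnit 𝕜 H R := by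
  ext x
  have := pairMul_algHom_comp f hf (antipode 𝕜) LinearMap.id (comul x)
  rw [LinearMap.comp_id] at this
  rw [conv_apply, this, convUnit_apply, ← isAlg_algebraMap hf]
  congr 1
  exact mul_antipode_rTensor_comul_apply x

theorem self_conv_antipode {f : H →ₗ[𝕜] R} (hf : IsAlg f) :
    conv f (f ∘ₗ antipode 𝕜) = convUnit 𝕜 H R := by
  ext x
  have := pairMul_algHom_comp f hf LinearMap.id (antipode 𝕜) (comul x)
  rw [LinearMap.comp_id] at this
  rw [conv_apply, this, convUnit_apply, ← isAlg_algebraMap hf]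
  congr 1
  exact mul_antipode_lTensor_comul_apply x

/-- The antipode reverses the comultiplication. -/
theorem comul_antipode (x : H) : comul (R := 𝕜) (antipode 𝕜 x) =
    TensorProduct.map (antipode 𝕜) (antipode 𝕜) (TensorProduct.comm 𝕜 H H (comul x)) := by
  let i₁ : H →ₗ[𝕜] H ⊗[𝕜] H :=
    (Algebra.TensorProduct.includeLeft : H →ₐ[𝕜] H ⊗[𝕜] H).toLinearMap
  let i₂ : H →ₗ[𝕜] H ⊗[𝕜] H :=
    (Algebra.TensorProduct.includeRight : H →ₐ[𝕜] H ⊗[𝕜] H).toLinearMap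
  have h₁ : IsAlg i₁ := isAlg_algHom _
  have h₂ : IsAlg i₂ := isAlg_algHom _
  have hδ : conv i₁ i₂ = comul := by
    ext x
    rw [conv_apply]
    generalize comul (R := 𝕜) x = X
    induction X with
    | zero => simp
    | add x y hx hy => simp only [map_add, hx, hy]
    | tmul a b => simp [i₁, i₂]
  have hG : conv (i₂ ∘ₗ antipode 𝕜) (i₁ ∘ₗ antipode 𝕜) =
      TensorProduct.map (antipode 𝕜) (antipode 𝕜) ∘ₗ
        (TensorProduct.comm 𝕜 H H).toLinearMap ∘ₗ comul := by
    ext x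
    rw [conv_apply]
    simp only [LinearMap.comp_apply, LinearEquiv.coe_coe]
    generalize comul (R := 𝕜) x = X
    induction X with
    | zero => simp
    | add x y hx hy => simp only [map_add, hx, hy]
    | tmul a b => simp [i₁, i₂]
  -- With i₁, i₂ the two embeddings, Δ is i₁ * i₂. Hence (i₂ ∘ S) * (i₁ ∘ S) is a left convolution
  -- inverse of Δ, while Δ ∘ S is a right one.
  have hl : conv (conv (i₂ ∘ₗ antipode 𝕜) (i₁ ∘ₗ antipode 𝕜)) comul =
      convUnit 𝕜 H (H ⊗[𝕜] H) := by
    rw [← hδ, conv_assoc, ← conv_assoc (i₁ ∘ₗ antipode 𝕜), antipode_conv_self h₁, unit_conv,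
      antipode_conv_self h₂]
  have hr : conv comul (comul ∘ₗ antipode 𝕜) = convUnit 𝕜 H (H ⊗[𝕜] H) :=
    self_conv_antipode (isAlg_algHom (Bialgebra.comulAlgHom 𝕜 H))
  have key : conv (i₂ ∘ₗ antipode 𝕜) (i₁ ∘ₗ antipode 𝕜) =
      comul ∘ₗ antipode 𝕜 := by
    rw [← conv_unit (conv (i₂ ∘ₗ antipode 𝕜) (i₁ ∘ₗ antipode 𝕜)), ← hr, ← conv_assoc, hl,
      unit_conv]
  rw [hG] at key
  exact (LinearMap.congr_fun key x).symm

/-- `T` is the inverse of the antipode. -/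
structure IsAntipodeInv (T : H →ₗ[𝕜] H) : Prop where
  antipode_inv : ∀ x, antipode 𝕜 (T x) = x
  inv_antipode : ∀ x, T (antipode 𝕜 x) = x

/-- The square of the antipode. -/
noncomputable def antipodeSq (𝕜 H : Type*) [Field 𝕜] [Ring H] [HopfAlgebra 𝕜 H] : H →ₗ[𝕜] H :=
  antipode 𝕜 ∘ₗ antipode 𝕜

theorem antipodeSq_apply (x : H) : antipodeSq 𝕜 H x = antipode 𝕜 (antipode 𝕜 x) := rfl

theorem isAlg_antipodeSq : IsAlg (antipodeSq 𝕜 H) where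
  map_one := by simp [antipodeSq_apply]
  map_mul x y := by simp [antipodeSq_apply, antipode_mul_antidistrib]

theorem comul_antipodeSq (x : H) : comul (R := 𝕜) (antipodeSq 𝕜 H x) =
    TensorProduct.map (antipodeSq 𝕜 H) (antipodeSq 𝕜 H) (comul x) := by
  rw [antipodeSq_apply, comul_antipode, comul_antipode]
  generalize comul (R := 𝕜) x = X
  induction X with
  | zero => simp
  | add x y hx hy => simp only [map_add, hx, hy]
  | tmul a b => simp [antipodeSq]

theorem counit_antipodeSq (x : H) :
    counit (R := 𝕜) (antipodeSq 𝕜 H x) = counit (R := 𝕜) x := by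
  simp [antipodeSq]

namespace IsAntipodeInv

variable {T : H →ₗ[𝕜] H}

theorem injective (hT : IsAntipodeInv T) : Function.Injective (antipode 𝕜 (A := H)) :=
  Function.LeftInverse.injective hT.inv_antipode

theorem map_one (hT : IsAntipodeInv T) : T 1 = 1 := by
  have := hT.inv_antipode 1
  rwa [antipode_one] at this

theorem map_mul (hT : IsAntipodeInv T) (x y : H) : T (x * y) = T y * T x := by
  apply hT.injective
  rw [hT.antipode_inv, antipode_mul_antidistrib, hT.antipode_inv, hT.antipode_inv]

theorem counit (hT : IsAntipodeInv T) (x : H) : counit (R := 𝕜) (T x) = counit (R := 𝕜) x := by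
  rw [← counit_antipode, hT.antipode_inv]

theorem sq_inv (hT : IsAntipodeInv T) (x : H) : antipodeSq 𝕜 H (T (T x)) = x := by
  rw [antipodeSq_apply, hT.antipode_inv, hT.antipode_inv]

theorem inv_sq (hT : IsAntipodeInv T) (x : H) : T (T (antipodeSq 𝕜 H x)) = x := by
  rw [antipodeSq_apply, hT.inv_antipode, hT.inv_antipode]

theorem map_inv_sq (hT : IsAntipodeInv T) (X : H ⊗[𝕜] H) : TensorProduct.map (T ∘ₗ T) (T ∘ₗ T)
    (TensorProduct.map (antipodeSq 𝕜 H) (antipodeSq 𝕜 H) X) = X := by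
  induction X with
  | zero => simp
  | add x y hx hy => simp only [_root_.map_add, hx, hy]
  | tmul a b => simp [hT.inv_sq]

theorem isAlg_inv_sq (hT : IsAntipodeInv T) : IsAlg (T ∘ₗ T) where
  map_one := by simp [hT.map_one]
  map_mul x y := by simp [hT.map_mul]

theorem comul_inv_sq (hT : IsAntipodeInv T) (x : H) : comul (R := 𝕜) ((T ∘ₗ T) x) =
    TensorProduct.map (T ∘ₗ T) (T ∘ₗ T) (comul x) := by
  have h := comul_antipodeSq (𝕜 := 𝕜) (T (T x))
  rw [hT.sq_inv] at h
  rw [h, hT.map_inv_sq]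
  rfl

theorem counit_inv_sq (hT : IsAntipodeInv T) (x : H) :
    Coalgebra.counit (R := 𝕜) ((T ∘ₗ T) x) = Coalgebra.counit (R := 𝕜) x := by
  simp [hT.counit]

end IsAntipodeInv

theorem isAlg_map {p : H →ₗ[𝕜] H} {q : H →ₗ[𝕜] H} (hp : IsAlg p) (hq : IsAlg q)
    (X Y : H ⊗[𝕜] H) :
    TensorProduct.map p q (X * Y) = TensorProduct.map p q X * TensorProduct.map p q Y := by
  induction X with
  | zero => simp
  | add x y hx hy => rw [add_mul, map_add, map_add, hx, hy, add_mul]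
  | tmul a b => induction Y with
    | zero => simp
    | add x y hx hy => rw [mul_add, map_add, map_add, hx, hy, mul_add]
    | tmul c d => simp [hp.map_mul, hq.map_mul]

end Antipode

/-! ### Left and right multiplications on the tensor square. -/

section Operators

variable (𝕜 H : Type*) [Field 𝕜] [Ring H] [HopfAlgebra 𝕜 H]

/-- `a ↦ (z ↦ (a ⊗ 1) z)` -/
noncomputable def opLeft₁ : H →ₗ[𝕜] Module.End 𝕜 (H ⊗[𝕜] H) :=
  LinearMap.mul 𝕜 (H ⊗[𝕜] H) ∘ₗ
    (Algebra.TensorProduct.includeLeft : H →ₐ[𝕜] H ⊗[𝕜] H).toLinearMap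

/-- `a ↦ (z ↦ (1 ⊗ a) z)` -/
noncomputable def opLeft₂ : H →ₗ[𝕜] Module.End 𝕜 (H ⊗[𝕜] H) :=
  LinearMap.mul 𝕜 (H ⊗[𝕜] H) ∘ₗ
    (Algebra.TensorProduct.includeRight : H →ₐ[𝕜] H ⊗[𝕜] H).toLinearMap

/-- `a ↦ (z ↦ z (S(a) ⊗ 1))` -/
noncomputable def opRight₁ : H →ₗ[𝕜] Module.End 𝕜 (H ⊗[𝕜] H) :=
  (LinearMap.mul 𝕜 (H ⊗[𝕜] H)).flip ∘ₗ
    (Algebra.TensorProduct.includeLeft : H →ₐ[𝕜] H ⊗[𝕜] H).toLinearMap ∘ₗ antipode 𝕜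

/-- `a ↦ (z ↦ z (1 ⊗ S(a)))` -/
noncomputable def opRight₂ : H →ₗ[𝕜] Module.End 𝕜 (H ⊗[𝕜] H) :=
  (LinearMap.mul 𝕜 (H ⊗[𝕜] H)).flip ∘ₗ
    (Algebra.TensorProduct.includeRight : H →ₐ[𝕜] H ⊗[𝕜] H).toLinearMap ∘ₗ antipode 𝕜

variable {𝕜 H}

@[simp] theorem opLeft₁_apply (a : H) (z : H ⊗[𝕜] H) : opLeft₁ 𝕜 H a z = (a ⊗ₜ 1) * z := rfl
@[simp] theorem opLeft₂_apply (a : H) (z : H ⊗[𝕜] H) : opLeft₂ 𝕜 H a z = (1 ⊗ₜ a) * z := rfl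
@[simp] theorem opRight₁_apply (a : H) (z : H ⊗[𝕜] H) :
    opRight₁ 𝕜 H a z = z * (antipode 𝕜 a ⊗ₜ 1) := rfl
@[simp] theorem opRight₂_apply (a : H) (z : H ⊗[𝕜] H) :
    opRight₂ 𝕜 H a z = z * (1 ⊗ₜ antipode 𝕜 a) := rfl

theorem isAlg_opLeft₁ : IsAlg (opLeft₁ 𝕜 H) :=
  ⟨by ext; simp [← Algebra.TensorProduct.one_def],
    fun x y => LinearMap.ext fun z => by simp [← mul_assoc]⟩

theorem isAlg_opLeft₂ : IsAlg (opLeft₂ 𝕜 H) :=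
  ⟨by ext; simp [← Algebra.TensorProduct.one_def],
    fun x y => LinearMap.ext fun z => by simp [← mul_assoc]⟩

/-- Right multiplication reverses products, and the antipode in its definition reverses them once
more. -/
theorem isAlg_opRight₁ : IsAlg (opRight₁ 𝕜 H) :=
  ⟨by ext; simp [← Algebra.TensorProduct.one_def],
    fun x y => LinearMap.ext fun z => by simp [antipode_mul_antidistrib, mul_assoc]⟩

theorem isAlg_opRight₂ : IsAlg (opRight₂ 𝕜 H) :=
  ⟨by ext; simp [← Algebra.TensorProduct.one_def],
    fun x y => LinearMap.ext fun z => by simp [antipode_mul_antidistrib, mul_assoc]⟩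

theorem opLeft₁_opLeft₂ (x y : H) : Commute (opLeft₁ 𝕜 H x) (opLeft₂ 𝕜 H y) :=
  LinearMap.ext fun z => by simp [← mul_assoc]

theorem opLeft₁_opRight₁ (x y : H) : Commute (opLeft₁ 𝕜 H x) (opRight₁ 𝕜 H y) :=
  LinearMap.ext fun z => by simp [mul_assoc]

theorem opLeft₁_opRight₂ (x y : H) : Commute (opLeft₁ 𝕜 H x) (opRight₂ 𝕜 H y) :=
  LinearMap.ext fun z => by simp [mul_assoc]

theorem opLeft₂_opRight₁ (x y : H) : Commute (opLeft₂ 𝕜 H x) (opRight₁ 𝕜 H y) :=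
  LinearMap.ext fun z => by simp [mul_assoc]

theorem opLeft₂_opRight₂ (x y : H) : Commute (opLeft₂ 𝕜 H x) (opRight₂ 𝕜 H y) :=
  LinearMap.ext fun z => by simp [mul_assoc]

theorem opRight₂_opRight₁ (x y : H) : Commute (opRight₂ 𝕜 H x) (opRight₁ 𝕜 H y) :=
  LinearMap.ext fun z => by simp [mul_assoc]

theorem pairMul_opLeft (X z : H ⊗[𝕜] H) : pairMul (opLeft₁ 𝕜 H) (opLeft₂ 𝕜 H) X z = X * z := by
  induction X with
  | zero => simp
  | add x y hx hy => simp only [map_add, LinearMap.add_apply, hx, hy, add_mul]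
  | tmul a b => simp [← mul_assoc]

/-- The second leg is listed first because S reverses the comultiplication: in this order the
convolution of the two maps at x is right multiplication by Δ(S(x)). -/
theorem pairMul_opRight (X z : H ⊗[𝕜] H) : pairMul (opRight₂ 𝕜 H) (opRight₁ 𝕜 H) X z =
    z * TensorProduct.map (antipode 𝕜) (antipode 𝕜) (TensorProduct.comm 𝕜 H H X) := by
  induction X with
  | zero => simp
  | add x y hx hy => simp only [map_add, LinearMap.add_apply, hx, hy, mul_add]
  | tmul a b => simp [mul_assoc]

theorem pairMul_opLeft₂_opRight₂ (X : H ⊗[𝕜] H) (w z : H) :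
    pairMul (opLeft₂ 𝕜 H) (opRight₂ 𝕜 H) X (z ⊗ₜ w) =
      z ⊗ₜ TwoCocycle.sandwichRight w X := by
  induction X with
  | zero => simp
  | add x y hx hy => simp only [map_add, LinearMap.add_apply, hx, hy, TensorProduct.tmul_add]
  | tmul a b => simp [TwoCocycle.sandwichRight]

theorem pairMul_opLeft₁_opRight₁ (X : H ⊗[𝕜] H) (w z : H) :
    pairMul (opLeft₁ 𝕜 H) (opRight₁ 𝕜 H) X (w ⊗ₜ z) =
      TwoCocycle.sandwichRight w X ⊗ₜ z := by
  induction X with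
  | zero => simp
  | add x y hx hy => simp only [map_add, LinearMap.add_apply, hx, hy, TensorProduct.add_tmul]
  | tmul a b => simp [TwoCocycle.sandwichRight]

/-- The antipode axiom in the second leg. It removes this pair of maps from an iterated cocycle that
acts on a vector z ⊗ 1. -/
theorem conv_opLeft₂_opRight₂ (x z : H) : conv (opLeft₂ 𝕜 H) (opRight₂ 𝕜 H) x (z ⊗ₜ 1) =
    counit (R := 𝕜) x • (z ⊗ₜ[𝕜] (1 : H)) := by
  rw [conv_apply, pairMul_opLeft₂_opRight₂, TwoCocycle.sandwichRight_comul,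
    TensorProduct.tmul_smul]

end Operators

end HopfTrace

/-! ### The comultiplication of u. -/

namespace TwoCocycle

open HopfTrace Coalgebra HopfAlgebra

variable {𝕜 H : Type*} [Field 𝕜] [Ring H] [HopfAlgebra 𝕜 H] (F : TwoCocycle 𝕜 H)

/-- `F Δ(u) (S ⊗ S)(F₂₁) = u ⊗ u`. -/
theorem comul_u : F.val * comul (R := 𝕜) F.u *
    TensorProduct.map (antipode 𝕜) (antipode 𝕜) (TensorProduct.comm 𝕜 H H F.val) =
      F.u ⊗ₜ[𝕜] F.u := by
  let s (f : H →ₗ[𝕜] Module.End 𝕜 (H ⊗[𝕜] H)) : Slot 𝕜 H (Module.End 𝕜 (H ⊗[𝕜] H)) := ⟨f, 1⟩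
  have hs : ∀ f g : H →ₗ[𝕜] Module.End 𝕜 (H ⊗[𝕜] H), (∀ x y, Commute (f x) (g y)) →
      (s f).Indep (s g) := fun f g h =>
    ⟨fun y => ⟨fun x => h x y, Commute.one_left _⟩, fun x => Commute.one_right _,
      Commute.one_right _⟩
  have hind : IsIndep [s (opLeft₁ 𝕜 H), s (opLeft₂ 𝕜 H), s (opRight₂ 𝕜 H), s (opRight₁ 𝕜 H)] := by
    refine ⟨?_, ?_⟩
    · simp only [List.mem_cons, List.not_mem_nil, or_false]
      rintro _ (rfl | rfl | rfl | rfl)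
      exacts [isAlg_opLeft₁, isAlg_opLeft₂, isAlg_opRight₂, isAlg_opRight₁]
    · simp only [List.pairwise_cons, List.mem_cons, List.not_mem_nil, or_false,
        forall_eq_or_imp, forall_eq, List.Pairwise.nil, and_true, IsEmpty.forall_iff,
        implies_true]
      exact ⟨⟨hs _ _ opLeft₁_opLeft₂, hs _ _ opLeft₁_opRight₂, hs _ _ opLeft₁_opRight₁⟩,
        ⟨hs _ _ opLeft₂_opRight₂, hs _ _ opLeft₂_opRight₁⟩, hs _ _ opRight₂_opRight₁⟩
  -- Two bracketings of the iterated cocycle of the same four maps are compared on the vector 1 ⊗ 1.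
  -- Cutting 2 + 2 gives F Δ(u) (S ⊗ S)(F₂₁); cutting 1 + (2 + 1) gives u ⊗ u.
  have h1 := listCocycle_append F (l := [s (opLeft₁ 𝕜 H), s (opLeft₂ 𝕜 H)])
    (m := [s (opRight₂ 𝕜 H), s (opRight₁ 𝕜 H)]) hind
  have h2 := listCocycle_append F (l := [s (opLeft₂ 𝕜 H), s (opRight₂ 𝕜 H)])
    (m := [s (opRight₁ 𝕜 H)]) hind.tail
  simp only [List.cons_append, List.nil_append] at h1 h2
  rw [listCocycle, h2] at h1
  simp only [listCocycle, listConv, conv_unit, map_counit_right, F.counit_right, s,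
    Units.val_one, one_mul, mul_one, (isAlg_opRight₁ (𝕜 := 𝕜) (H := H)).map_one,
    (isAlg_opLeft₂ (𝕜 := 𝕜) (H := H)).map_one,
    (isAlg_opRight₂ (𝕜 := 𝕜) (H := H)).map_one] at h1
  have h3 := LinearMap.congr_fun h1 (1 : H ⊗[𝕜] H)
  simp only [Module.End.mul_apply] at h3
  -- The two middle maps act as the counit on vectors with second leg 1, so only the sandwich in the
  -- first leg survives.
  have e1 : pairMul (opLeft₁ 𝕜 H) (conv (opLeft₂ 𝕜 H) (conv (opRight₂ 𝕜 H) (opRight₁ 𝕜 H)))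
      F.val 1 = F.u ⊗ₜ 1 := by
    have a1 : ∀ q, conv (opLeft₂ 𝕜 H) (conv (opRight₂ 𝕜 H) (opRight₁ 𝕜 H)) q (1 : H ⊗[𝕜] H) =
        opRight₁ 𝕜 H q 1 := by
      intro q
      rw [← conv_assoc]
      have a2 : ∀ X, pairMul (conv (opLeft₂ 𝕜 H) (opRight₂ 𝕜 H)) (opRight₁ 𝕜 H) X
          (1 : H ⊗[𝕜] H) = pairMul (convUnit 𝕜 H _) (opRight₁ 𝕜 H) X 1 := by
        intro X
        induction X with
        | zero => simp
        | add x y hx hy => simp only [map_add, LinearMap.add_apply, hx, hy]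
        | tmul a b =>
          simp only [pairMul_tmul, Module.End.mul_apply, opRight₁_apply, one_mul,
            conv_opLeft₂_opRight₂, convUnit_apply, Module.algebraMap_end_apply]
      rw [conv_apply, a2, ← conv_apply, unit_conv]
    have a3 : ∀ X, pairMul (opLeft₁ 𝕜 H)
        (conv (opLeft₂ 𝕜 H) (conv (opRight₂ 𝕜 H) (opRight₁ 𝕜 H))) X (1 : H ⊗[𝕜] H) =
        pairMul (opLeft₁ 𝕜 H) (opRight₁ 𝕜 H) X 1 := by
      intro X
      induction X with
      | zero => simp
      | add x y hx hy => simp only [map_add, LinearMap.add_apply, hx, hy]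
      | tmul a b => simp only [pairMul_tmul, Module.End.mul_apply, a1]
    rw [a3, Algebra.TensorProduct.one_def, pairMul_opLeft₁_opRight₁, ← u_eq]
  have e2 : pairMul (conv (opLeft₂ 𝕜 H) (opRight₂ 𝕜 H)) (opRight₁ 𝕜 H) F.val (F.u ⊗ₜ 1) =
      F.u ⊗ₜ[𝕜] (1 : H) := by
    have a2 : ∀ X, pairMul (conv (opLeft₂ 𝕜 H) (opRight₂ 𝕜 H)) (opRight₁ 𝕜 H) X
        (F.u ⊗ₜ[𝕜] (1 : H)) = pairMul (convUnit 𝕜 H _) (opRight₁ 𝕜 H) X (F.u ⊗ₜ[𝕜] (1 : H)) := by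
      intro X
      induction X with
      | zero => simp
      | add x y hx hy => simp only [map_add, LinearMap.add_apply, hx, hy]
      | tmul a b =>
        simp only [pairMul_tmul, Module.End.mul_apply, opRight₁_apply,
          Algebra.TensorProduct.tmul_mul_tmul, mul_one,
          conv_opLeft₂_opRight₂, convUnit_apply, Module.algebraMap_end_apply]
    rw [a2, map_counit_left, F.counit_left, (isAlg_opRight₁ (𝕜 := 𝕜) (H := H)).map_one, Module.End.one_apply]
  have e3 : pairMul (conv (opLeft₁ 𝕜 H) (opLeft₂ 𝕜 H)) (conv (opRight₂ 𝕜 H) (opRight₁ 𝕜 H))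
      F.val (1 : H ⊗[𝕜] H) = comul (R := 𝕜) F.u := by
    have a1 : ∀ X, pairMul (conv (opLeft₁ 𝕜 H) (opLeft₂ 𝕜 H))
        (conv (opRight₂ 𝕜 H) (opRight₁ 𝕜 H)) X (1 : H ⊗[𝕜] H) =
        comul (R := 𝕜) (sandwichRight 1 X) := by
      intro X
      induction X with
      | zero => simp
      | add x y hx hy => simp only [map_add, LinearMap.add_apply, hx, hy]
      | tmul a b =>
        simp only [pairMul_tmul, Module.End.mul_apply, conv_apply, pairMul_opRight,
          pairMul_opLeft, one_mul, ← comul_antipode, ← Bialgebra.comul_mul]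
        simp [sandwichRight]
    rw [a1, ← u_eq]
  rw [e1, e2, pairMul_opLeft₂_opRight₂, ← u_eq, e3, pairMul_opRight, pairMul_opLeft] at h3
  rw [← mul_assoc] at h3
  exact h3.symm

end TwoCocycle

/-! ### The element w that implements the square of the twisted antipode. -/

namespace HopfTrace

open Coalgebra HopfAlgebra

variable {𝕜 H : Type*} [Field 𝕜] [Ring H] [HopfAlgebra 𝕜 H]

variable (𝕜 H) in
/-- `a ⊗ b ↦ S(b) ⊗ S(a)`. -/
noncomputable def flipAntipode : H ⊗[𝕜] H →ₗ[𝕜] H ⊗[𝕜] H :=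
  TensorProduct.map (antipode 𝕜) (antipode 𝕜) ∘ₗ (TensorProduct.comm 𝕜 H H).toLinearMap

@[simp] theorem flipAntipode_tmul (a b : H) :
    flipAntipode 𝕜 H (a ⊗ₜ b) = antipode 𝕜 b ⊗ₜ antipode 𝕜 a := by simp [flipAntipode]

theorem comul_antipode_eq_flip (x : H) :
    comul (R := 𝕜) (antipode 𝕜 x) = flipAntipode 𝕜 H (comul x) := comul_antipode x

theorem flipAntipode_mul (X Y : H ⊗[𝕜] H) :
    flipAntipode 𝕜 H (X * Y) = flipAntipode 𝕜 H Y * flipAntipode 𝕜 H X := by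
  induction X with
  | zero => simp
  | add x y hx hy => simp only [add_mul, mul_add, map_add, hx, hy]
  | tmul a b => induction Y with
    | zero => simp
    | add x y hx hy => simp only [add_mul, mul_add, map_add, hx, hy]
    | tmul c d => simp [antipode_mul_antidistrib]

theorem flipAntipode_one : flipAntipode 𝕜 H 1 = 1 := by
  simp [Algebra.TensorProduct.one_def]

theorem flipAntipode_flipAntipode (X : H ⊗[𝕜] H) :
    flipAntipode 𝕜 H (flipAntipode 𝕜 H X) =
      TensorProduct.map (antipodeSq 𝕜 H) (antipodeSq 𝕜 H) X := by
  induction X with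
  | zero => simp
  | add x y hx hy => simp only [map_add, hx, hy]
  | tmul a b => simp [antipodeSq_apply]

end HopfTrace

namespace TwoCocycle

open HopfTrace Coalgebra HopfAlgebra

variable {𝕜 H : Type*} [Field 𝕜] [Ring H] [HopfAlgebra 𝕜 H] (F : TwoCocycle 𝕜 H)

/-- A finite-dimensional algebra is Dedekind finite, so the one-sided inverse is two-sided. -/
theorem uInv_mul_u [Module.Finite 𝕜 H] : F.uInv * F.u = 1 := by
  have := IsNoetherianRing.of_finite 𝕜 H
  exact mul_eq_one_comm.1 F.u_mul_uInv

/-- The element `u S(u⁻¹)`, which implements the square of the twisted antipode. -/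
noncomputable def w : H := F.u * antipode 𝕜 F.uInv

/-- The inverse `S(u) u⁻¹` of `w`. -/
noncomputable def wInv : H := antipode 𝕜 F.u * F.uInv

theorem w_mul_wInv : F.w * F.wInv = 1 := by
  rw [w, wInv, mul_assoc, ← mul_assoc (antipode 𝕜 F.uInv), ← antipode_mul_antidistrib,
    u_mul_uInv, antipode_one, one_mul, u_mul_uInv]

theorem wInv_mul_w [Module.Finite 𝕜 H] : F.wInv * F.w = 1 := by
  rw [w, wInv, mul_assoc, ← mul_assoc F.uInv, uInv_mul_u, one_mul, ← antipode_mul_antidistrib,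
    uInv_mul_u, antipode_one]

theorem twistAntipode_sq (x : H) :
    F.twistAntipode (F.twistAntipode x) = F.w * antipodeSq 𝕜 H x * F.wInv := by
  simp [twistAntipode, w, wInv, antipodeSq_apply, antipode_mul_antidistrib, mul_assoc]

theorem counit_pairing (p : H →ₗ[𝕜] H) (q : H →ₗ[𝕜] H)
    (hp : ∀ x, counit (R := 𝕜) (p x) = counit (R := 𝕜) x)
    (hq : ∀ x, counit (R := 𝕜) (q x) = counit (R := 𝕜) x) (X : H ⊗[𝕜] H) :
    counit (R := 𝕜) (pairMul p q X) = counit (R := 𝕜)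
      (TensorProduct.lid 𝕜 H ((counit (R := 𝕜) (A := H)).rTensor H X)) := by
  induction X with
  | zero => simp
  | add x y hx hy => simp only [map_add, hx, hy]
  | tmul a b => simp [hp, hq]

theorem counit_u : counit (R := 𝕜) F.u = 1 := by
  have h : F.u = pairMul LinearMap.id (antipode 𝕜) F.val := rfl
  rw [h, counit_pairing _ _ (fun _ => rfl) (by simp), F.counit_left, Bialgebra.counit_one]

theorem counit_uInv : counit (R := 𝕜) F.uInv = 1 := by
  have h : F.uInv = pairMul (antipode 𝕜) LinearMap.id F.inv := rfl
  rw [h, counit_pairing _ _ (by simp) (fun _ => rfl), F.inv_counit_left, Bialgebra.counit_one]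

theorem counit_w : counit (R := 𝕜) F.w = 1 := by simp [w, counit_u, counit_uInv]

theorem counit_wInv : counit (R := 𝕜) F.wInv = 1 := by simp [wInv, counit_u, counit_uInv]

theorem flip_val_mul_inv : flipAntipode 𝕜 H F.val * flipAntipode 𝕜 H F.inv = 1 := by
  rw [← flipAntipode_mul, inv_mul_val, flipAntipode_one]

theorem flip_inv_mul_val : flipAntipode 𝕜 H F.inv * flipAntipode 𝕜 H F.val = 1 := by
  rw [← flipAntipode_mul, val_mul_inv, flipAntipode_one]

theorem comul_u' : comul (R := 𝕜) F.u =
    F.inv * (F.u ⊗ₜ[𝕜] F.u) * flipAntipode 𝕜 H F.inv := by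
  have h : F.val * comul (R := 𝕜) F.u * flipAntipode 𝕜 H F.val = F.u ⊗ₜ[𝕜] F.u := F.comul_u
  rw [← h, ← mul_assoc, ← mul_assoc, inv_mul_val, one_mul, mul_assoc, flip_val_mul_inv, mul_one]

theorem comul_uInv [Module.Finite 𝕜 H] : comul (R := 𝕜) F.uInv =
    flipAntipode 𝕜 H F.val * (F.uInv ⊗ₜ[𝕜] F.uInv) * F.val := by
  refine left_inv_eq_right_inv (a := comul (R := 𝕜) F.u) ?_ ?_
  · rw [← Bialgebra.comul_mul, uInv_mul_u, Bialgebra.comul_one]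
  · have e : ∀ G U X X' U' V : H ⊗[𝕜] H, G * U * X * (X' * U' * V) = G * (U * (X * X') * U') * V := by
      intros; simp only [mul_assoc]
    rw [comul_u', e, flip_inv_mul_val, mul_one, Algebra.TensorProduct.tmul_mul_tmul, u_mul_uInv,
      ← Algebra.TensorProduct.one_def, mul_one, inv_mul_val]

/-- The flipped factor (S ⊗ S)(F₂₁⁻¹) at the end of Δ(u) cancels against the one at the beginning of
Δ(S(u⁻¹)). The factor that remains on the right has been flipped twice, which leaves S² ⊗ S². -/
theorem comul_w [Module.Finite 𝕜 H] : comul (R := 𝕜) F.w =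
    F.inv * (F.w ⊗ₜ[𝕜] F.w) * TensorProduct.map (antipodeSq 𝕜 H) (antipodeSq 𝕜 H) F.val := by
  have e : ∀ G U X X' U' V : H ⊗[𝕜] H, G * U * X * (X' * U' * V) = G * (U * (X * X') * U') * V := by
    intros; simp only [mul_assoc]
  rw [w, Bialgebra.comul_mul, comul_antipode_eq_flip, comul_uInv, comul_u', flipAntipode_mul,
    flipAntipode_mul, flipAntipode_flipAntipode, ← mul_assoc (flipAntipode 𝕜 H F.val), e,
    flip_inv_mul_val, mul_one, flipAntipode_tmul, Algebra.TensorProduct.tmul_mul_tmul]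

/-- The hypothesis of `listCocycleInv_mul_twisted` for p = S² and v = w⁻¹, used on the block where
the exponents increase. -/
theorem comul_wInv [Module.Finite 𝕜 H] : comul (R := 𝕜) F.wInv =
    TensorProduct.map (antipodeSq 𝕜 H) (antipodeSq 𝕜 H) F.inv * (F.wInv ⊗ₜ[𝕜] F.wInv) *
      F.val := by
  refine left_inv_eq_right_inv (a := comul (R := 𝕜) F.w) ?_ ?_
  · rw [← Bialgebra.comul_mul, wInv_mul_w, Bialgebra.comul_one]
  · have e : ∀ G U X X' U' V : H ⊗[𝕜] H, G * U * X * (X' * U' * V) = G * (U * (X * X') * U') * V := by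
      intros; simp only [mul_assoc]
    rw [comul_w, e, ← isAlg_map isAlg_antipodeSq isAlg_antipodeSq, val_mul_inv,
      Algebra.TensorProduct.one_def, TensorProduct.map_tmul, isAlg_antipodeSq.map_one,
      ← Algebra.TensorProduct.one_def, mul_one, Algebra.TensorProduct.tmul_mul_tmul, w_mul_wInv,
      ← Algebra.TensorProduct.one_def, mul_one, inv_mul_val]

/-- The same hypothesis for p = S⁻² and v = S⁻²(w), used on the block where the exponents decrease.
-/
theorem comul_inv_sq_w [Module.Finite 𝕜 H] {T : H →ₗ[𝕜] H} (hT : IsAntipodeInv T) :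
    comul (R := 𝕜) ((T ∘ₗ T) F.w) = TensorProduct.map (T ∘ₗ T) (T ∘ₗ T) F.inv *
      ((T ∘ₗ T) F.w ⊗ₜ[𝕜] (T ∘ₗ T) F.w) * F.val := by
  rw [hT.comul_inv_sq, comul_w, isAlg_map hT.isAlg_inv_sq hT.isAlg_inv_sq,
    isAlg_map hT.isAlg_inv_sq hT.isAlg_inv_sq, hT.map_inv_sq, TensorProduct.map_tmul]

/-- `∑ Δ(d¹) F⁻¹ (1 ⊗ u S(d²)) = 1 ⊗ 1` for `F⁻¹ = ∑ d¹ ⊗ d²`. -/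
theorem comul_inv_sandwich :
    pairMul (conv (opLeft₁ 𝕜 H) (opLeft₂ 𝕜 H)) (opRight₂ 𝕜 H) F.inv
      (F.inv * (1 ⊗ₜ[𝕜] F.u)) = 1 := by
  have h := F.pairMul_inv_cocycle (R := Module.End 𝕜 (H ⊗[𝕜] H)) isAlg_opLeft₁ isAlg_opLeft₂
    isAlg_opRight₂ opLeft₁_opLeft₂ opLeft₁_opRight₂ opLeft₂_opRight₂
  -- Multiplying by the copy of F in the maps `opLeft₂`, `opRight₂` cancels one factor of the
  -- inverse cocycle identity. On the vector 1 ⊗ 1 that copy produces 1 ⊗ u.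
  have h1 := congrArg (fun z => z * pairMul (opLeft₂ 𝕜 H) (opRight₂ 𝕜 H) F.val) h
  simp only [mul_assoc] at h1
  rw [F.pairMul_inv_mul_val isAlg_opLeft₂ isAlg_opRight₂ opLeft₂_opRight₂, mul_one] at h1
  have h2 := LinearMap.congr_fun h1 (1 : H ⊗[𝕜] H)
  simp only [Module.End.mul_apply] at h2
  rw [Algebra.TensorProduct.one_def, pairMul_opLeft₂_opRight₂, ← u_eq, pairMul_opLeft] at h2
  rw [h2]
  have a : ∀ X, pairMul (opLeft₁ 𝕜 H) (conv (opLeft₂ 𝕜 H) (opRight₂ 𝕜 H)) X (1 ⊗ₜ[𝕜] (1 : H)) =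
      pairMul (opLeft₁ 𝕜 H) (convUnit 𝕜 H _) X (1 ⊗ₜ[𝕜] (1 : H)) := by
    intro X
    induction X with
    | zero => simp
    | add x y hx hy => simp only [map_add, LinearMap.add_apply, hx, hy]
    | tmul a b =>
      simp only [pairMul_tmul, Module.End.mul_apply, conv_opLeft₂_opRight₂, convUnit_apply,
        Module.algebraMap_end_apply]
  rw [a, map_counit_right, F.inv_counit_right, (isAlg_opLeft₁ (𝕜 := 𝕜) (H := H)).map_one]
  rfl

end TwoCocycle

namespace HopfTrace

open Coalgebra HopfAlgebra

/-! ### Multiplication operators in the opposite endomorphism ring, and the inverse antipode. -/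

section MulOps

variable (𝕜 R : Type*) [Field 𝕜] [Ring R] [Algebra 𝕜 R]

/-- Right multiplication, as a homomorphism to the opposite of the ring of endomorphisms. -/
noncomputable def rightOp : R →ₗ[𝕜] (Module.End 𝕜 R)ᵐᵒᵖ :=
  (MulOpposite.opLinearEquiv 𝕜).toLinearMap ∘ₗ (LinearMap.mul 𝕜 R).flip

/-- Left multiplication, as an antihomomorphism to the opposite of the ring of endomorphisms. -/
noncomputable def leftOp : R →ₗ[𝕜] (Module.End 𝕜 R)ᵐᵒᵖ :=
  (MulOpposite.opLinearEquiv 𝕜).toLinearMap ∘ₗ LinearMap.mul 𝕜 R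

variable {𝕜 R}

@[simp] theorem unop_rightOp (a z : R) : (rightOp 𝕜 R a).unop z = z * a := rfl
@[simp] theorem unop_leftOp (a z : R) : (leftOp 𝕜 R a).unop z = a * z := rfl

theorem rightOp_leftOp (a b : R) : Commute (rightOp 𝕜 R a) (leftOp 𝕜 R b) :=
  MulOpposite.unop_injective (LinearMap.ext fun z => by simp [mul_assoc])

theorem rightOp_one : rightOp 𝕜 R 1 = 1 :=
  MulOpposite.unop_injective (LinearMap.ext fun z => by simp)

theorem rightOp_mul (a b : R) : rightOp 𝕜 R (a * b) = rightOp 𝕜 R a * rightOp 𝕜 R b :=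
  MulOpposite.unop_injective (LinearMap.ext fun z => by simp [mul_assoc])

theorem leftOp_one : leftOp 𝕜 R 1 = 1 :=
  MulOpposite.unop_injective (LinearMap.ext fun z => by simp)

theorem leftOp_mul (a b : R) : leftOp 𝕜 R (b * a) = leftOp 𝕜 R a * leftOp 𝕜 R b :=
  MulOpposite.unop_injective (LinearMap.ext fun z => by simp [mul_assoc])

theorem rightOp_commute {a b : R} (h : Commute a b) :
    Commute (rightOp 𝕜 R a) (rightOp 𝕜 R b) := by
  rw [Commute, SemiconjBy, ← rightOp_mul, ← rightOp_mul, h.eq]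

end MulOps

section

variable {𝕜 H R : Type*} [Field 𝕜] [Ring H] [HopfAlgebra 𝕜 H] [Ring R] [Algebra 𝕜 R]

theorem isAlg_rightOp_comp {f : H →ₗ[𝕜] R} (hf : IsAlg f) : IsAlg (rightOp 𝕜 R ∘ₗ f) :=
  ⟨by simp [hf.map_one, rightOp_one], fun x y => by simp [hf.map_mul, rightOp_mul]⟩

/-- In the opposite ring left multiplication reverses products, and S⁻¹ undoes this. Cocycle
identities can thus be evaluated with S⁻¹ acting from the left, while right multiplication needs no
antipode. -/
theorem isAlg_leftOp_comp_inv {T : H →ₗ[𝕜] H} (hT : IsAntipodeInv T) {f : H →ₗ[𝕜] R}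
    (hf : IsAlg f) : IsAlg (leftOp 𝕜 R ∘ₗ f ∘ₗ T) :=
  ⟨by simp [hT.map_one, hf.map_one, leftOp_one],
    fun x y => by simp [hT.map_mul, hf.map_mul, leftOp_mul]⟩

variable {T : H →ₗ[𝕜] H} (hT : IsAntipodeInv T)

/-- The rule ∑ S⁻¹(x₂) x₁ = ε(x): applying the injective map S turns it into the antipode axiom. -/
theorem IsAntipodeInv.pairMul_comm_comul (hT : IsAntipodeInv T) (x : H) :
    pairMul T LinearMap.id (TensorProduct.comm 𝕜 H H (comul x)) =
      algebraMap 𝕜 H (Coalgebra.counit (R := 𝕜) x) := by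
  apply hT.injective
  have h : ∀ X : H ⊗[𝕜] H,
      antipode 𝕜 (pairMul T LinearMap.id (TensorProduct.comm 𝕜 H H X)) =
        pairMul (antipode 𝕜) LinearMap.id X := by
    intro X
    induction X with
    | zero => simp
    | add x y hx hy => simp only [_root_.map_add, hx, hy]
    | tmul a b => simp [antipode_mul_antidistrib, hT.antipode_inv]
  rw [h, Algebra.algebraMap_eq_smul_one, map_smul, antipode_one, ← Algebra.algebraMap_eq_smul_one]
  exact mul_antipode_rTensor_comul_apply x

theorem IsAntipodeInv.pairMul_comm_comul' (hT : IsAntipodeInv T) (x : H) :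
    pairMul LinearMap.id T (TensorProduct.comm 𝕜 H H (comul x)) =
      algebraMap 𝕜 H (Coalgebra.counit (R := 𝕜) x) := by
  apply hT.injective
  have h : ∀ X : H ⊗[𝕜] H,
      antipode 𝕜 (pairMul LinearMap.id T (TensorProduct.comm 𝕜 H H X)) =
        pairMul LinearMap.id (antipode 𝕜) X := by
    intro X
    induction X with
    | zero => simp
    | add x y hx hy => simp only [_root_.map_add, hx, hy]
    | tmul a b => simp [antipode_mul_antidistrib, hT.antipode_inv]
  rw [h, Algebra.algebraMap_eq_smul_one, map_smul, antipode_one, ← Algebra.algebraMap_eq_smul_one]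
  exact mul_antipode_lTensor_comul_apply x

/-- An antihomomorphism `p`, and its composition with the inverse antipode on the right. -/
theorem conv_anti_inv (hT : IsAntipodeInv T) {p : H →ₗ[𝕜] R} (h1 : p 1 = 1)
    (hp : ∀ x y, p (x * y) = p y * p x) : conv p (p ∘ₗ T) = convUnit 𝕜 H R := by
  ext x
  have h : ∀ X : H ⊗[𝕜] H, pairMul p (p ∘ₗ T) X =
      p (pairMul T LinearMap.id (TensorProduct.comm 𝕜 H H X)) := by
    intro X
    induction X with
    | zero => simp
    | add x y hx hy => simp only [_root_.map_add, hx, hy]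
    | tmul a b => simp [hp]
  rw [conv_apply, h, hT.pairMul_comm_comul, Algebra.algebraMap_eq_smul_one, map_smul, h1,
    convUnit_apply, Algebra.algebraMap_eq_smul_one]

/-- An antihomomorphism `p`, and its composition with the inverse antipode on the left. -/
theorem conv_inv_anti (hT : IsAntipodeInv T) {p : H →ₗ[𝕜] R} (h1 : p 1 = 1)
    (hp : ∀ x y, p (x * y) = p y * p x) : conv (p ∘ₗ T) p = convUnit 𝕜 H R := by
  ext x
  have h : ∀ X : H ⊗[𝕜] H, pairMul (p ∘ₗ T) p X =
      p (pairMul LinearMap.id T (TensorProduct.comm 𝕜 H H X)) := by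
    intro X
    induction X with
    | zero => simp
    | add x y hx hy => simp only [_root_.map_add, hx, hy]
    | tmul a b => simp [hp]
  rw [conv_apply, h, hT.pairMul_comm_comul', Algebra.algebraMap_eq_smul_one, map_smul, h1,
    convUnit_apply, Algebra.algebraMap_eq_smul_one]

end

end HopfTrace

/-! ### An expression for the cocycle in terms of the coproduct of its inverse. -/

namespace TwoCocycle

open HopfTrace Coalgebra HopfAlgebra

variable {𝕜 H : Type*} [Field 𝕜] [Ring H] [HopfAlgebra 𝕜 H] (F : TwoCocycle 𝕜 H)
  {T : H →ₗ[𝕜] H}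

theorem inv_u (hT : IsAntipodeInv T) (X : H ⊗[𝕜] H) :
    T (sandwichRight 1 X) = pairMul LinearMap.id T (TensorProduct.comm 𝕜 H H X) := by
  induction X with
  | zero => simp
  | add x y hx hy => simp only [_root_.map_add, hx, hy]
  | tmul a b => simp [sandwichRight, hT.map_mul, hT.inv_antipode]

theorem inv_uInv (hT : IsAntipodeInv T) (X : H ⊗[𝕜] H) :
    T (sandwichLeft 1 X) = pairMul T LinearMap.id (TensorProduct.comm 𝕜 H H X) := by
  induction X with
  | zero => simp
  | add x y hx hy => simp only [_root_.map_add, hx, hy]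
  | tmul a b => simp [sandwichLeft, hT.map_mul, hT.inv_antipode]

/-- `(1 ⊗ S⁻¹(u⁻¹)) F = ∑ (1 ⊗ S⁻¹(d²)) Δ(d¹)` for `F⁻¹ = ∑ d¹ ⊗ d²`. -/
theorem inv_uInv_mul_val (hT : IsAntipodeInv T) :
    (1 ⊗ₜ[𝕜] T F.uInv) * F.val = LinearMap.mul' 𝕜 (H ⊗[𝕜] H) (TensorProduct.map
      ((TensorProduct.mk 𝕜 H H 1) ∘ₗ T) comul (TensorProduct.comm 𝕜 H H F.inv)) := by
  let i₁ : H →ₗ[𝕜] H ⊗[𝕜] H :=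
    (Algebra.TensorProduct.includeLeft : H →ₐ[𝕜] H ⊗[𝕜] H).toLinearMap
  let i₂ : H →ₗ[𝕜] H ⊗[𝕜] H :=
    (Algebra.TensorProduct.includeRight : H →ₐ[𝕜] H ⊗[𝕜] H).toLinearMap
  have hi₁ : IsAlg i₁ := isAlg_algHom _
  have hi₂ : IsAlg i₂ := isAlg_algHom _
  -- Right multiplications in the two legs, and left multiplication by S⁻¹ in the second leg. The
  -- inverse cocycle identity for these maps, multiplied by the copy of F at s₁, s₂, is evaluated at
  -- 1 ⊗ 1. In the opposite ring the leftmost factor acts first.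
  let s₁ := rightOp 𝕜 (H ⊗[𝕜] H) ∘ₗ i₁
  let s₂ := rightOp 𝕜 (H ⊗[𝕜] H) ∘ₗ i₂
  let s₃ := leftOp 𝕜 (H ⊗[𝕜] H) ∘ₗ i₂ ∘ₗ T
  have a₁ : IsAlg s₁ := isAlg_rightOp_comp hi₁
  have a₂ : IsAlg s₂ := isAlg_rightOp_comp hi₂
  have a₃ : IsAlg s₃ := isAlg_leftOp_comp_inv hT hi₂
  have c₁₂ : ∀ x y, Commute (s₁ x) (s₂ y) := fun x y =>
    rightOp_commute (by simp [Commute, SemiconjBy, i₁, i₂])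
  have c₁₃ : ∀ x y, Commute (s₁ x) (s₃ y) := fun x y => rightOp_leftOp _ _
  have c₂₃ : ∀ x y, Commute (s₂ x) (s₃ y) := fun x y => rightOp_leftOp _ _
  have h := F.pairMul_inv_cocycle a₁ a₂ a₃ c₁₂ c₁₃ c₂₃
  have h1 := congrArg (fun z => z * pairMul s₁ s₂ F.val) h
  rw [mul_assoc, F.pairMul_inv_mul_val a₁ a₂ c₁₂, mul_one] at h1
  have h2 := LinearMap.congr_fun (congrArg MulOpposite.unop h1) (1 : H ⊗[𝕜] H)
  simp only [MulOpposite.unop_mul, Module.End.mul_apply] at h2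
  have e12 : ∀ X z : H ⊗[𝕜] H, (pairMul s₁ s₂ X).unop z = z * X := by
    intro X z
    induction X with
    | zero => simp
    | add x y hx hy => simp only [_root_.map_add, MulOpposite.unop_add, LinearMap.add_apply, hx, hy, mul_add]
    | tmul a b => simp [s₁, s₂, i₁, i₂, mul_assoc]
  have e23 : ∀ (X : H ⊗[𝕜] H) (z : H), (pairMul s₂ s₃ X).unop (z ⊗ₜ 1) =
      z ⊗ₜ pairMul T LinearMap.id (TensorProduct.comm 𝕜 H H X) := by
    intro X z
    induction X with
    | zero => simp
    | add x y hx hy => simp only [_root_.map_add, MulOpposite.unop_add, LinearMap.add_apply, hx, hy, TensorProduct.tmul_add]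
    | tmul a b => simp [s₂, s₃, i₂]
  have e1 : ∀ X, (pairMul s₁ (conv s₂ s₃) X).unop (1 ⊗ₜ[𝕜] (1 : H)) =
      (pairMul s₁ (convUnit 𝕜 H _) X).unop (1 ⊗ₜ[𝕜] (1 : H)) := by
    intro X
    induction X with
    | zero => simp
    | add x y hx hy => simp only [_root_.map_add, MulOpposite.unop_add, LinearMap.add_apply, hx, hy]
    | tmul a b =>
      simp only [pairMul_tmul, MulOpposite.unop_mul, Module.End.mul_apply]
      have : (s₁ a).unop (1 ⊗ₜ[𝕜] (1 : H)) = a ⊗ₜ 1 := by simp [s₁, i₁]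
      rw [this, conv_apply, e23, hT.pairMul_comm_comul, convUnit_apply]
      simp [Algebra.algebraMap_eq_smul_one]
  have e3 : ∀ X, (pairMul (conv s₁ s₂) s₃ X).unop 1 = LinearMap.mul' 𝕜 (H ⊗[𝕜] H)
      (TensorProduct.map ((TensorProduct.mk 𝕜 H H 1) ∘ₗ T) comul
        (TensorProduct.comm 𝕜 H H X)) := by
    intro X
    induction X with
    | zero => simp
    | add x y hx hy => simp only [_root_.map_add, MulOpposite.unop_add, LinearMap.add_apply, hx, hy]
    | tmul a b =>
      simp only [pairMul_tmul, MulOpposite.unop_mul, Module.End.mul_apply, conv_apply, e12, one_mul]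
      simp [s₃, i₂]
  rw [e3, e12, Algebra.TensorProduct.one_def, e1, map_counit_right, F.inv_counit_right,
    a₁.map_one, MulOpposite.unop_one, Module.End.one_apply, e23, ← inv_uInv hT, ← uInv_eq] at h2
  exact h2.symm

end TwoCocycle

namespace HopfTrace

open Coalgebra HopfAlgebra

/-! ### Twisted traces on the tensor square. -/

section Invariant

variable {𝕜 H : Type*} [Field 𝕜] [Ring H] [HopfAlgebra 𝕜 H] {T : H →ₗ[𝕜] H}

/-- A functional on `H ⊗ H` with `N(X Δ(y)) = N((S² ⊗ S⁻²)(Δ(y)) X)`. -/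
def IsTwistedTrace (T : H →ₗ[𝕜] H) (N : H ⊗[𝕜] H →ₗ[𝕜] 𝕜) : Prop :=
  ∀ X y, N (X * comul (R := 𝕜) y) =
    N (TensorProduct.map (antipodeSq 𝕜 H) (T ∘ₗ T) (comul y) * X)

/-- Apply the twisted trace property to X = r ⊗ S⁻¹(y₂) and Δ(y₁), summed over the coproduct of y.
The second leg collapses on both sides, by S⁻¹(y₃) y₂ on one and by S⁻²(y₂) S⁻¹(y₃) on the other,
and only the first leg is left. -/
theorem IsTwistedTrace.restrict {N : H ⊗[𝕜] H →ₗ[𝕜] 𝕜} (hN : IsTwistedTrace T N)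
    (hT : IsAntipodeInv T) (r y : H) :
    N ((r * y) ⊗ₜ 1) = N ((antipodeSq 𝕜 H y * r) ⊗ₜ 1) := by
  let L : (H ⊗[𝕜] H) →ₗ[𝕜] Module.End 𝕜 (H ⊗[𝕜] H) := LinearMap.mul 𝕜 (H ⊗[𝕜] H)
  let Rt : (H ⊗[𝕜] H) →ₗ[𝕜] Module.End 𝕜 (H ⊗[𝕜] H) := (LinearMap.mul 𝕜 (H ⊗[𝕜] H)).flip
  let i₁ : H →ₗ[𝕜] H ⊗[𝕜] H :=
    (Algebra.TensorProduct.includeLeft : H →ₐ[𝕜] H ⊗[𝕜] H).toLinearMap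
  let i₂ : H →ₗ[𝕜] H ⊗[𝕜] H :=
    (Algebra.TensorProduct.includeRight : H →ₐ[𝕜] H ⊗[𝕜] H).toLinearMap
  let l := L ∘ₗ i₂ ∘ₗ T
  have hl : ∀ (a : H) (X : H ⊗[𝕜] H), l a X = (1 ⊗ₜ T a) * X := fun _ _ => rfl
  have e1 : ∀ x, conv (Rt ∘ₗ i₂) l x (r ⊗ₜ[𝕜] (1 : H)) =
      counit (R := 𝕜) x • (r ⊗ₜ[𝕜] (1 : H)) := by
    intro x
    have : ∀ X : H ⊗[𝕜] H, pairMul (Rt ∘ₗ i₂) l X (r ⊗ₜ[𝕜] (1 : H)) =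
        r ⊗ₜ pairMul T LinearMap.id (TensorProduct.comm 𝕜 H H X) := by
      intro X
      induction X with
      | zero => simp
      | add x y hx hy =>
        simp only [_root_.map_add, LinearMap.add_apply, hx, hy, TensorProduct.tmul_add]
      | tmul a b => simp [hl, Rt, i₂]
    rw [conv_apply, this, hT.pairMul_comm_comul, Algebra.algebraMap_eq_smul_one,
      TensorProduct.tmul_smul]
  have e2 : ∀ x, conv (L ∘ₗ i₂ ∘ₗ T ∘ₗ T) l x (r ⊗ₜ[𝕜] (1 : H)) =
      counit (R := 𝕜) x • (r ⊗ₜ[𝕜] (1 : H)) := by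
    intro x
    have : ∀ X : H ⊗[𝕜] H, pairMul (L ∘ₗ i₂ ∘ₗ T ∘ₗ T) l X (r ⊗ₜ[𝕜] (1 : H)) =
        r ⊗ₜ T (pairMul LinearMap.id T (TensorProduct.comm 𝕜 H H X)) := by
      intro X
      induction X with
      | zero => simp
      | add x y hx hy =>
        simp only [_root_.map_add, LinearMap.add_apply, hx, hy, TensorProduct.tmul_add]
      | tmul a b => simp [hl, L, i₂, hT.map_mul]
    rw [conv_apply, this, hT.pairMul_comm_comul', Algebra.algebraMap_eq_smul_one, map_smul,
      hT.map_one, TensorProduct.tmul_smul]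
  have hR : ∀ x X, conv (Rt ∘ₗ i₁) (Rt ∘ₗ i₂) x X = X * comul (R := 𝕜) x := by
    intro x X
    rw [conv_apply]
    generalize comul (R := 𝕜) x = Y
    induction Y with
    | zero => simp
    | add x y hx hy => simp only [_root_.map_add, LinearMap.add_apply, hx, hy, mul_add]
    | tmul a b => simp [Rt, i₁, i₂, mul_assoc]
  have hL : ∀ x X, conv (L ∘ₗ i₁ ∘ₗ antipodeSq 𝕜 H) (L ∘ₗ i₂ ∘ₗ T ∘ₗ T) x X =
      TensorProduct.map (antipodeSq 𝕜 H) (T ∘ₗ T) (comul x) * X := by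
    intro x X
    rw [conv_apply]
    generalize comul (R := 𝕜) x = Y
    induction Y with
    | zero => simp
    | add x y hx hy => simp only [_root_.map_add, LinearMap.add_apply, hx, hy, add_mul]
    | tmul a b => simp [L, i₁, i₂, ← mul_assoc]
  have absorb : ∀ (p q : H →ₗ[𝕜] Module.End 𝕜 (H ⊗[𝕜] H)) (z : H ⊗[𝕜] H),
      (∀ x, q x z = counit (R := 𝕜) x • z) → conv p q y z = p y z := by
    intro p q z hq
    have : ∀ X : H ⊗[𝕜] H, pairMul p q X z = pairMul p (convUnit 𝕜 H _) X z := by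
      intro X
      induction X with
      | zero => simp
      | add x y hx hy => simp only [_root_.map_add, LinearMap.add_apply, hx, hy]
      | tmul a b => simp [hq, convUnit_apply]
    rw [conv_apply, this, ← conv_apply, conv_unit]
  have key : ∀ (X : H ⊗[𝕜] H) (z : H ⊗[𝕜] H),
      N (pairMul (conv (Rt ∘ₗ i₁) (Rt ∘ₗ i₂)) l X z) =
        N (pairMul (conv (L ∘ₗ i₁ ∘ₗ antipodeSq 𝕜 H) (L ∘ₗ i₂ ∘ₗ T ∘ₗ T)) l X z) := by
    intro X z
    induction X with
    | zero => simp
    | add x y hx hy => simp only [_root_.map_add, LinearMap.add_apply, hx, hy]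
    | tmul a b => simp only [pairMul_tmul, Module.End.mul_apply, hR, hL, hN _ a]
  have k := key (comul y) (r ⊗ₜ 1)
  rw [← conv_apply, ← conv_apply, conv_assoc, conv_assoc, absorb _ _ _ e1, absorb _ _ _ e2] at k
  simpa [Rt, L, i₁] using k

/-- A twisted trace takes the same value on `1` and on the product of twisted cocycles. -/
theorem IsTwistedTrace.cocycle_eq {N : H ⊗[𝕜] H →ₗ[𝕜] 𝕜} (hN : IsTwistedTrace T N)
    (hT : IsAntipodeInv T) (F : TwoCocycle 𝕜 H) :
    N (TensorProduct.map (antipodeSq 𝕜 H) (T ∘ₗ T) F.inv *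
      (F.wInv ⊗ₜ (T ∘ₗ T) F.w) * F.val) = N 1 := by
  let M := TensorProduct.map (antipodeSq 𝕜 H) (T ∘ₗ T)
  have hM : ∀ X Y, M (X * Y) = M X * M Y := isAlg_map isAlg_antipodeSq hT.isAlg_inv_sq
  -- Splitting S⁻²(w) as S⁻²(u) S⁻¹(u⁻¹) exposes the factor 1 ⊗ S⁻¹(u⁻¹) next to F, where
  -- `inv_uInv_mul_val` applies.
  have hw : (T ∘ₗ T) F.w = T (T F.u) * T F.uInv := by
    simp [TwoCocycle.w, hT.map_mul, hT.inv_antipode]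
  have h1 : (F.wInv ⊗ₜ[𝕜] (T ∘ₗ T) F.w) * F.val =
      (F.wInv ⊗ₜ[𝕜] T (T F.u)) * ((1 ⊗ₜ[𝕜] T F.uInv) * F.val) := by
    rw [hw, ← mul_assoc, Algebra.TensorProduct.tmul_mul_tmul, mul_one]
  -- Now Δ(d¹) stands at the right end, and N moves it to the front as (S² ⊗ S⁻²)(Δ(d¹)). Up to w⁻¹
  -- ⊗ 1 the argument of N becomes the image under S² ⊗ S⁻² of the sum in `comul_inv_sandwich`,
  -- which is 1.
  have h2 : ∀ X : H ⊗[𝕜] H, N (M F.inv * ((F.wInv ⊗ₜ[𝕜] T (T F.u)) *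
      LinearMap.mul' 𝕜 (H ⊗[𝕜] H) (TensorProduct.map
        ((TensorProduct.mk 𝕜 H H 1) ∘ₗ T) comul (TensorProduct.comm 𝕜 H H X)))) =
      N (M (pairMul (conv (opLeft₁ 𝕜 H) (opLeft₂ 𝕜 H)) (opRight₂ 𝕜 H) X
        (F.inv * (1 ⊗ₜ[𝕜] F.u))) * (F.wInv ⊗ₜ 1)) := by
    intro X
    induction X with
    | zero => simp
    | add x y hx hy =>
      simp only [_root_.map_add, LinearMap.add_apply, mul_add, add_mul, hx, hy]
    | tmul a b =>
      have h3 : M (1 ⊗ₜ[𝕜] (F.u * antipode 𝕜 b)) * (F.wInv ⊗ₜ[𝕜] (1 : H)) =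
          (F.wInv ⊗ₜ[𝕜] T (T F.u)) * (1 ⊗ₜ T b) := by
        simp [M, hT.map_mul, hT.inv_antipode, isAlg_antipodeSq.map_one]
      have h4 : (F.inv * (1 ⊗ₜ[𝕜] F.u)) * (1 ⊗ₜ antipode 𝕜 b) =
          F.inv * (1 ⊗ₜ[𝕜] (F.u * antipode 𝕜 b)) := by
        rw [mul_assoc, Algebra.TensorProduct.tmul_mul_tmul, one_mul]
      simp only [TensorProduct.comm_tmul, TensorProduct.map_tmul, LinearMap.mul'_apply,
        LinearMap.comp_apply, TensorProduct.mk_apply, pairMul_tmul, Module.End.mul_apply,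
        opRight₂_apply, conv_apply, pairMul_opLeft]
      rw [h4, hM, hM, mul_assoc, mul_assoc, h3, ← mul_assoc, ← mul_assoc, hN]
      simp only [mul_assoc]
      rfl
  rw [mul_assoc, h1, F.inv_uInv_mul_val hT, h2, F.comul_inv_sandwich]
  have h5 : M 1 = 1 := by
    simp [M, Algebra.TensorProduct.one_def, isAlg_antipodeSq.map_one, hT.map_one]
  -- What remains is N(S(u) u⁻¹ ⊗ 1). Here S(u) = ∑ S²(f²) S(f¹), and `restrict` moves S²(f²) to the
  -- right end as f². The result ∑ S(f¹) u⁻¹ f² is the sandwich of F⁻¹F, that is, 1.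
  have h6 : ∀ X : H ⊗[𝕜] H, N ((antipode 𝕜 (TwoCocycle.sandwichRight 1 X) * F.uInv) ⊗ₜ 1) =
      N (TwoCocycle.sandwichLeft F.uInv X ⊗ₜ 1) := by
    intro X
    induction X with
    | zero => simp
    | add x y hx hy => simp only [_root_.map_add, add_mul, TensorProduct.add_tmul, hx, hy]
    | tmul a b =>
      have := hN.restrict hT (antipode 𝕜 a * F.uInv) b
      simpa [TwoCocycle.sandwichRight, TwoCocycle.sandwichLeft, antipode_mul_antidistrib,
        mul_assoc, antipodeSq_apply] using this.symm
  rw [h5, one_mul, TwoCocycle.wInv, TwoCocycle.u_eq, h6, TwoCocycle.uInv_eq,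
    ← TwoCocycle.sandwichLeft_mul, Units.inv_mul, TwoCocycle.sandwichLeft_one_one]
  rfl

end Invariant

/-! ### Functionals that absorb convolution products. -/

section Functional

variable {𝕜 H R : Type*} [Field 𝕜] [Ring H] [HopfAlgebra 𝕜 H] [Ring R] [Algebra 𝕜 R]
  {T : H →ₗ[𝕜] H}

/-- Right multiplications, acting on the ring. -/
noncomputable def mulRightOp (𝕜 R : Type*) [Field 𝕜] [Ring R] [Algebra 𝕜 R] :
    R →ₗ[𝕜] Module.End 𝕜 R := (LinearMap.mul 𝕜 R).flip

/-- The transposes of left multiplications, acting on functionals. -/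
noncomputable def mulLeftDual (𝕜 R : Type*) [Field 𝕜] [Ring R] [Algebra 𝕜 R] :
    R →ₗ[𝕜] Module.End 𝕜 (Module.Dual 𝕜 R) :=
  Module.Dual.transpose (R := 𝕜) (M := R) (M' := R) ∘ₗ LinearMap.mul 𝕜 R

@[simp] theorem mulRightOp_apply (a z : R) : mulRightOp 𝕜 R a z = z * a := rfl
@[simp] theorem mulLeftDual_apply (a : R) (φ : Module.Dual 𝕜 R) (z : R) :
    mulLeftDual 𝕜 R a φ z = φ (a * z) := rfl

theorem conv_eq_of_counit_left {Ψ : R →ₗ[𝕜] 𝕜} {p q : H →ₗ[𝕜] Module.End 𝕜 R}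
    (h : ∀ y z, Ψ (p y z) = counit (R := 𝕜) y * Ψ z) (y : H) (z : R) :
    Ψ (conv p q y z) = Ψ (q y z) := by
  have : ∀ X : H ⊗[𝕜] H, Ψ (pairMul p q X z) = Ψ (pairMul (convUnit 𝕜 H _) q X z) := by
    intro X
    induction X with
    | zero => simp
    | add x y hx hy => simp only [_root_.map_add, LinearMap.add_apply, hx, hy]
    | tmul a b => simp [h, convUnit_apply]
  rw [conv_apply, this, ← conv_apply, unit_conv]

theorem conv_eq_of_counit_right {M : Type*} [AddCommGroup M] [Module 𝕜 M] {v : M}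
    {p q : H →ₗ[𝕜] Module.End 𝕜 M}
    (h : ∀ y, q y v = counit (R := 𝕜) y • v) (y : H) :
    conv p q y v = p y v := by
  have : ∀ X : H ⊗[𝕜] H, pairMul p q X v = pairMul p (convUnit 𝕜 H _) X v := by
    intro X
    induction X with
    | zero => simp
    | add x y hx hy => simp only [_root_.map_add, LinearMap.add_apply, hx, hy]
    | tmul a b => simp [h, convUnit_apply]
  rw [conv_apply, this, ← conv_apply, conv_unit]

theorem conv_mulRightOp {f g : H →ₗ[𝕜] R} (hc : ∀ x y, Commute (f x) (g y)) :
    conv (mulRightOp 𝕜 R ∘ₗ f) (mulRightOp 𝕜 R ∘ₗ g) = mulRightOp 𝕜 R ∘ₗ conv f g := by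
  ext x z
  simp only [conv_apply, LinearMap.comp_apply]
  generalize comul (R := 𝕜) x = X
  induction X with
  | zero => simp
  | add x y hx hy => simp only [_root_.map_add, LinearMap.add_apply, hx, hy]
  | tmul a b => simp [mul_assoc, (hc a b).eq]

theorem conv_mulLeftDual {f g : H →ₗ[𝕜] R} (hc : ∀ x y, Commute (f x) (g y)) :
    conv (R := Module.End 𝕜 (Module.Dual 𝕜 R)) (mulLeftDual 𝕜 R ∘ₗ f) (mulLeftDual 𝕜 R ∘ₗ g) =
      mulLeftDual 𝕜 R ∘ₗ conv f g := by
  apply LinearMap.ext; intro x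
  simp only [conv_apply, LinearMap.comp_apply]
  generalize comul (R := 𝕜) x = X
  induction X with
  | zero => simp
  | add x y hx hy => simp only [_root_.map_add, hx, hy]
  | tmul a b =>
    ext φ z
    simp [← mul_assoc, (hc a b).eq]

/-- A functional that absorbs `(f * h)(y)` on the right converts `f(y)` into `h(S⁻¹(y))`. -/
theorem right_exchange (hT : IsAntipodeInv T) {Ψ : R →ₗ[𝕜] 𝕜} {f h : H →ₗ[𝕜] R}
    (hh : IsAlg h) (hc : ∀ x y, Commute (f x) (h y))
    (hΨ : ∀ y z, Ψ (z * conv f h y) = counit (R := 𝕜) y * Ψ z) (y : H) (z : R) :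
    Ψ (z * f y) = Ψ (z * h (T y)) := by
  have h1 : conv (mulRightOp 𝕜 R ∘ₗ h) ((mulRightOp 𝕜 R ∘ₗ h) ∘ₗ T) = convUnit 𝕜 H _ :=
    conv_anti_inv hT (by ext; simp [hh.map_one])
      (fun x y => LinearMap.ext fun z => by simp [hh.map_mul, mul_assoc])
  have h2 : conv (mulRightOp 𝕜 R ∘ₗ conv f h) ((mulRightOp 𝕜 R ∘ₗ h) ∘ₗ T) =
      mulRightOp 𝕜 R ∘ₗ f := by
    rw [← conv_mulRightOp hc, conv_assoc, h1, conv_unit]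
  have h3 := conv_eq_of_counit_left (Ψ := Ψ) (p := mulRightOp 𝕜 R ∘ₗ conv f h)
    (q := (mulRightOp 𝕜 R ∘ₗ h) ∘ₗ T) hΨ y z
  rw [h2] at h3
  exact h3

/-- A functional that absorbs `(h * k)(y)` on the left converts `k(y)` into `h(S⁻¹(y))`. -/
theorem left_exchange (hT : IsAntipodeInv T) {Ψ : R →ₗ[𝕜] 𝕜} {h k : H →ₗ[𝕜] R}
    (hh : IsAlg h) (hc : ∀ x y, Commute (h x) (k y))
    (hΨ : ∀ y z, Ψ (conv h k y * z) = counit (R := 𝕜) y * Ψ z) (y : H) (z : R) :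
    Ψ (k y * z) = Ψ (h (T y) * z) := by
  -- Transposed left multiplication reverses products, as `conv_inv_anti` requires. The operators
  -- act on functionals, with Ψ as the vector on which the convolution h * k acts by the counit.
  let p : H →ₗ[𝕜] Module.End 𝕜 (Module.Dual 𝕜 R) := mulLeftDual 𝕜 R ∘ₗ h
  have p1 : p 1 = 1 := LinearMap.ext fun φ => LinearMap.ext fun z => by simp [p, hh.map_one]
  have pm : ∀ x y, p (x * y) = p y * p x := fun x y =>
    LinearMap.ext fun φ => LinearMap.ext fun z => by simp [p, hh.map_mul, mul_assoc]
  have h1 : conv (R := Module.End 𝕜 (Module.Dual 𝕜 R)) (p ∘ₗ T) p =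
      convUnit 𝕜 H (Module.End 𝕜 (Module.Dual 𝕜 R)) :=
    conv_inv_anti (R := Module.End 𝕜 (Module.Dual 𝕜 R)) hT p1 pm
  let q : H →ₗ[𝕜] Module.End 𝕜 (Module.Dual 𝕜 R) := mulLeftDual 𝕜 R ∘ₗ conv h k
  have hq : conv (R := Module.End 𝕜 (Module.Dual 𝕜 R)) p (mulLeftDual 𝕜 R ∘ₗ k) = q :=
    conv_mulLeftDual hc
  have h2 : conv (R := Module.End 𝕜 (Module.Dual 𝕜 R)) (p ∘ₗ T) q = mulLeftDual 𝕜 R ∘ₗ k := by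
    rw [← hq, ← conv_assoc, h1, unit_conv]
  let φ : Module.Dual 𝕜 R := Ψ
  have hφ : ∀ y, q y φ = counit (R := 𝕜) y • φ := by
    intro y
    apply LinearMap.ext
    intro z
    simp only [q, LinearMap.comp_apply, mulLeftDual_apply, LinearMap.smul_apply, smul_eq_mul]
    exact hΨ y z
  have h3 : conv (R := Module.End 𝕜 (Module.Dual 𝕜 R)) (p ∘ₗ T) q y φ = (p ∘ₗ T) y φ := conv_eq_of_counit_right hφ y
  rw [h2] at h3
  have h4 := LinearMap.congr_fun h3 z
  simp only [p, LinearMap.comp_apply, mulLeftDual_apply] at h4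
  exact h4

/-- The exchange rule turns h(f²) f(f¹) at the right end into h(f² S⁻¹(f¹)), and ∑ f² S⁻¹(f¹) =
S⁻¹(u). -/
theorem right_exchange_u (hT : IsAntipodeInv T) {Ψ : R →ₗ[𝕜] 𝕜} {f h : H →ₗ[𝕜] R}
    (hh : IsAlg h) (hc : ∀ x y, Commute (f x) (h y))
    (hR : ∀ y z, Ψ (z * f y) = Ψ (z * h (T y))) (F : TwoCocycle 𝕜 H) (z : R) :
    Ψ (z * pairMul f h F.val) = Ψ (z * h (T F.u)) := by
  rw [TwoCocycle.u_eq, TwoCocycle.inv_u hT]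
  change Ψ (z * pairMul f h (F.toUnits : H ⊗[𝕜] H)) = _
  generalize (F.toUnits : H ⊗[𝕜] H) = X
  induction X with
  | zero => simp
  | add x y hx hy => simp only [_root_.map_add, mul_add, hx, hy]
  | tmul a b =>
    rw [pairMul_tmul, (hc a b).eq, ← mul_assoc, hR]
    simp [hh.map_mul, mul_assoc]

/-- The mirror image: k(d²) h(d¹) at the left end becomes h(S⁻¹(d²) d¹), and ∑ S⁻¹(d²) d¹ =
S⁻¹(u⁻¹). -/
theorem left_exchange_uInv (hT : IsAntipodeInv T) {Ψ : R →ₗ[𝕜] 𝕜} {h k : H →ₗ[𝕜] R}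
    (hh : IsAlg h) (hc : ∀ x y, Commute (h x) (k y))
    (hL : ∀ y z, Ψ (k y * z) = Ψ (h (T y) * z)) (F : TwoCocycle 𝕜 H) (z : R) :
    Ψ (pairMul h k F.inv * z) = Ψ (h (T F.uInv) * z) := by
  rw [TwoCocycle.uInv_eq, TwoCocycle.inv_uInv hT]
  change Ψ (pairMul h k ((F.toUnits⁻¹ : (H ⊗[𝕜] H)ˣ) : H ⊗[𝕜] H) * z) = _
  generalize ((F.toUnits⁻¹ : (H ⊗[𝕜] H)ˣ) : H ⊗[𝕜] H) = X
  induction X with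
  | zero => simp
  | add x y hx hy => simp only [_root_.map_add, add_mul, hx, hy]
  | tmul a b =>
    rw [pairMul_tmul, (hc a b).eq, mul_assoc, hL]
    simp [hh.map_mul, mul_assoc]

/-- Invariance of a functional that absorbs `f * g * h` on the right and
`h * (f ∘ S²) * (g ∘ S⁻²)` on the left. -/
theorem functional_invariance [Module.Finite 𝕜 H] (hT : IsAntipodeInv T) (F : TwoCocycle 𝕜 H)
    {Ψ : R →ₗ[𝕜] 𝕜}
    {f g h : H →ₗ[𝕜] R} (hf : IsAlg f) (hg : IsAlg g) (hh : IsAlg h)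
    (cfg : ∀ x y, Commute (f x) (g y)) (cfh : ∀ x y, Commute (f x) (h y))
    (cgh : ∀ x y, Commute (g x) (h y))
    (hr : ∀ y z, Ψ (z * conv (conv f g) h y) = counit (R := 𝕜) y * Ψ z)
    (hl : ∀ y z, Ψ (conv h (conv (f ∘ₗ antipodeSq 𝕜 H) (g ∘ₗ T ∘ₗ T)) y * z) =
      counit (R := 𝕜) y * Ψ z) :
    Ψ (pairMul h (conv (f ∘ₗ antipodeSq 𝕜 H) (g ∘ₗ T ∘ₗ T)) F.inv *
      pairMul (f ∘ₗ antipodeSq 𝕜 H) (g ∘ₗ T ∘ₗ T) F.inv * (f F.wInv * g ((T ∘ₗ T) F.w)) *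
      pairMul f g F.val * pairMul (conv f g) h F.val) = Ψ 1 := by
  set k := conv (f ∘ₗ antipodeSq 𝕜 H) (g ∘ₗ T ∘ₗ T) with hk
  have cfgh : ∀ x y, Commute (conv f g x) (h y) := fun x y =>
    conv_commute (fun z => cfh z y) (fun z => cgh z y) x
  have chk : ∀ x y, Commute (h x) (k y) := fun x y =>
    (conv_commute (f := f ∘ₗ antipodeSq 𝕜 H) (g := g ∘ₗ T ∘ₗ T) (fun z => cfh _ x)
      (fun z => cgh _ x) y).symm
  have cX : ∀ X y, Commute (pairMul f g X) (h y) := fun X y =>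
    pairMul_commute (fun z => cfh z y) (fun z => cgh z y) X
  have R := right_exchange hT hh cfgh hr
  have L := left_exchange hT hh chk hl
  have eX : pairMul (f ∘ₗ antipodeSq 𝕜 H) (g ∘ₗ T ∘ₗ T) F.inv *
      (f F.wInv * g ((T ∘ₗ T) F.w)) * pairMul f g F.val =
      pairMul f g (TensorProduct.map (antipodeSq 𝕜 H) (T ∘ₗ T) F.inv *
        (F.wInv ⊗ₜ (T ∘ₗ T) F.w) * F.val) := by
    rw [pairMul_mul hf hg cfg, pairMul_mul hf hg cfg, pairMul_tmul, pairMul_comp]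
  -- On the right end (f * g)(y) becomes h(S⁻¹(y)), which commutes past the values of f and g; on
  -- the left end h(S⁻¹(y)) becomes ((f ∘ S²) * (g ∘ S⁻²))(y).
  have hN : IsTwistedTrace T (Ψ ∘ₗ pairMul f g) := by
    intro X y
    simp only [LinearMap.comp_apply]
    rw [pairMul_mul hf hg cfg, ← conv_apply, R, (cX X _).eq, ← L, hk, conv_apply, pairMul_comp,
      ← pairMul_mul hf hg cfg]
  -- The outer copies of F and F⁻¹ become h(S⁻¹(u)) and h(S⁻¹(u⁻¹)). Both commute with the inner
  -- part, so they meet and cancel; the inner part is then treated by `cocycle_eq`.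
  rw [right_exchange_u hT hh cfgh R, mul_assoc, mul_assoc, mul_assoc,
    left_exchange_uInv hT hh chk L,
    ← mul_assoc (f F.wInv * _), ← mul_assoc (pairMul _ _ _), ← mul_assoc (pairMul _ _ _), eX,
    (cX _ _).eq, ← mul_assoc, ← hh.map_mul, ← hT.map_mul, F.u_mul_uInv, hT.map_one, hh.map_one,
    one_mul]
  have := hN.cocycle_eq hT F
  simp only [LinearMap.comp_apply, pairMul_one hf hg] at this
  exact this

end Functional

end HopfTrace

namespace HopfTrace

open Coalgebra HopfAlgebra

/-! ### Multiplication along a chain and its trace functional. -/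

section Chain

variable (𝕜 H R : Type*) [Field 𝕜] [Ring H] [HopfAlgebra 𝕜 H] [Ring R] [Algebra 𝕜 R]

/-- Commuting embeddings `j x` of an algebra into `R`, for `x` in `ℤ/n`, and a linear map from `R`
that multiplies the factors in the order `-k, -2k, …, -nk = 0`. -/
structure ChainSystem (n k : ℕ) where
  j : ZMod n → H →ₐ[𝕜] R
  chain : R →ₗ[𝕜] H
  commute : ∀ x y, x ≠ y → ∀ a b, Commute (j x a) (j y b)
  chain_one : chain 1 = 1
  chain_slide : ∀ x, x ≠ 0 → ∀ z b, chain (z * j x b) = chain (j (x - k) b * z)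
  chain_last : ∀ z b, chain (z * j 0 b) = chain z * b
  chain_first : ∀ z b, chain (j (-k) b * z) = b * chain z

variable {𝕜 H R} {n k : ℕ}

namespace ChainSystem

variable (C : ChainSystem 𝕜 H R n k)

/-- The slot at the position `x` with the automorphism `φ` and the unit `v`. -/
noncomputable def slot (x : ZMod n) (φ : H ≃ₐ[𝕜] H) (v : Hˣ) : Slot 𝕜 H R where
  hom := ((C.j x).comp (φ : H →ₐ[𝕜] H)).toLinearMap
  unit := Units.map (C.j x : H →* R) v

theorem slot_hom (x : ZMod n) (φ : H ≃ₐ[𝕜] H) (v : Hˣ) (a : H) :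
    (C.slot x φ v).hom a = C.j x (φ a) := rfl

theorem slot_unit (x : ZMod n) (φ : H ≃ₐ[𝕜] H) (v : Hˣ) :
    ((C.slot x φ v).unit : R) = C.j x v := rfl

theorem slot_unit_inv (x : ZMod n) (φ : H ≃ₐ[𝕜] H) (v : Hˣ) :
    (((C.slot x φ v).unit⁻¹ : Rˣ) : R) = C.j x (v⁻¹ : Hˣ) := rfl

theorem slot_indep {x y : ZMod n} (h : x ≠ y) (φ ψ : H ≃ₐ[𝕜] H) (v w : Hˣ) :
    (C.slot x φ v).Indep (C.slot y ψ w) :=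
  ⟨fun _ => ⟨fun _ => C.commute x y h _ _, C.commute x y h _ _⟩,
    fun _ => C.commute x y h _ _, C.commute x y h _ _⟩

theorem isIndep_map {ι : Type*} (p : ι → ZMod n) (φ : ι → H ≃ₐ[𝕜] H) (v : ι → Hˣ) (l : List ι)
    (hl : (l.map p).Nodup) : IsIndep (l.map fun i => C.slot (p i) (φ i) (v i)) := by
  constructor
  · intro s hs
    obtain ⟨i, -, rfl⟩ := List.mem_map.1 hs
    exact isAlg_algHom _
  · rw [List.pairwise_map]
    have h := List.pairwise_map.1 hl
    exact h.imp fun h => C.slot_indep h _ _ _ _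

/-- The element `r` can be moved from the right end to the left end, where it becomes `r'`. -/
def Slides (r r' : R) : Prop := ∀ z, C.chain (z * r) = C.chain (r' * z)

variable {C}

theorem Slides.one : C.Slides 1 1 := fun z => by rw [mul_one, one_mul]

/-- In moving r s from the right to the left, s goes first and r follows, so the order of the
product is kept. -/
theorem Slides.mul {r r' s s' : R} (hr : C.Slides r r') (hs : C.Slides s s') :
    C.Slides (r * s) (r' * s') := fun z => by
  rw [← mul_assoc, hs, ← mul_assoc, hr, mul_assoc]

theorem Slides.pairMul {f f' g g' : H →ₗ[𝕜] R} (hf : ∀ x, C.Slides (f x) (f' x))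
    (hg : ∀ x, C.Slides (g x) (g' x)) (X : H ⊗[𝕜] H) :
    C.Slides (pairMul f g X) (pairMul f' g' X) := by
  induction X with
  | zero => intro z; simp
  | add x y hx hy => intro z; simp only [map_add, mul_add, add_mul, hx z, hy z]
  | tmul a b => simpa using (hf a).mul (hg b)

theorem Slides.convUnit (x : H) : C.Slides (convUnit 𝕜 H R x) (HopfTrace.convUnit 𝕜 H R x) :=
  fun z => by rw [(convUnit_commute z x).eq]

/-- The maps and the units of the two slots correspond to each other. -/
def SlotSlides (s s' : Slot 𝕜 H R) : Prop :=
  (∀ x, C.Slides (s.hom x) (s'.hom x)) ∧ C.Slides (s.unit⁻¹ : Rˣ) (s'.unit⁻¹ : Rˣ)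

theorem slotSlides {x : ZMod n} (hx : x ≠ 0) (φ : H ≃ₐ[𝕜] H) (v : Hˣ) :
    SlotSlides (C := C) (C.slot x φ v) (C.slot (x - k) φ v) :=
  ⟨fun _ z => C.chain_slide x hx z _, fun z => C.chain_slide x hx z _⟩

theorem Slides.listConv {l l' : List (Slot 𝕜 H R)}
    (h : List.Forall₂ (SlotSlides (C := C)) l l') (x : H) :
    C.Slides (listConv l x) (HopfTrace.listConv l' x) := by
  induction h generalizing x with
  | nil => exact Slides.convUnit x
  | cons h1 _ ih => exact Slides.pairMul h1.1 ih _

theorem Slides.listCocycleInv (F : TwoCocycle 𝕜 H) {l l' : List (Slot 𝕜 H R)}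
    (h : List.Forall₂ (SlotSlides (C := C)) l l') :
    C.Slides (listCocycleInv F l) (HopfTrace.listCocycleInv F l') := by
  induction h with
  | nil => exact Slides.one
  | cons h1 h2 ih => exact ((Slides.pairMul h1.1 (Slides.listConv h2) _).mul ih).mul h1.2

variable (C)

/-- The functional `z ↦ Tr(x ↦ S(chain(z f(x))))`. -/
noncomputable def traceForm (f : H →ₗ[𝕜] R) : R →ₗ[𝕜] 𝕜 where
  toFun z := LinearMap.trace 𝕜 H (antipode 𝕜 ∘ₗ C.chain ∘ₗ LinearMap.mulLeft 𝕜 z ∘ₗ f)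
  map_add' z z' := by
    rw [← map_add]
    congr 1
    ext x
    simp [add_mul]
  map_smul' c z := by
    rw [RingHom.id_apply, ← map_smul]
    congr 1
    ext x
    simp

theorem traceForm_apply (f : H →ₗ[𝕜] R) (z : R) : C.traceForm f z =
    LinearMap.trace 𝕜 H (antipode 𝕜 ∘ₗ C.chain ∘ₗ LinearMap.mulLeft 𝕜 z ∘ₗ f) := rfl

variable {T : H →ₗ[𝕜] H} (hT : IsAntipodeInv T) {f f' : H →ₗ[𝕜] R}

/-- Since f is multiplicative, f(y) is precomposition with left multiplication by y. Cyclicity of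
the trace moves y in front of S, where it equals S applied to a factor S⁻¹(y) at the right end of
the chain, that is, at position 0. -/
theorem traceForm_mul_last (hT : IsAntipodeInv T) (hf : IsAlg f)
    (hc : ∀ x y, Commute (f x) (C.j 0 y)) (y : H) (z : R) :
    C.traceForm f (z * f y) = C.traceForm f (z * C.j 0 (T y)) := by
  let g : H →ₗ[𝕜] H := antipode 𝕜 ∘ₗ C.chain ∘ₗ LinearMap.mulLeft 𝕜 z ∘ₗ f
  have h1 : antipode 𝕜 ∘ₗ C.chain ∘ₗ LinearMap.mulLeft 𝕜 (z * f y) ∘ₗ f =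
      g * LinearMap.mulLeft 𝕜 y := by
    ext x
    simp [g, hf.map_mul]
  have h2 : antipode 𝕜 ∘ₗ C.chain ∘ₗ LinearMap.mulLeft 𝕜 (z * C.j 0 (T y)) ∘ₗ f =
      LinearMap.mulLeft 𝕜 y * g := by
    ext x
    simp only [LinearMap.comp_apply, LinearMap.mulLeft_apply, Module.End.mul_apply, g]
    rw [mul_assoc, ← (hc _ _).eq, ← mul_assoc, C.chain_last, antipode_mul_antidistrib,
      hT.antipode_inv]
  rw [traceForm_apply, traceForm_apply, h1, h2, LinearMap.trace_mul_comm]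

/-- At the left end, f'(y) slides back to f(y) on the right and becomes precomposition with right
multiplication by y. Cyclicity and S turn it into a factor S⁻¹(y) at the first position -k. -/
theorem traceForm_first_mul (hT : IsAntipodeInv T) (hf : IsAlg f)
    (hs : ∀ x, C.Slides (f x) (f' x)) (y : H) (z : R) :
    C.traceForm f (f' y * z) = C.traceForm f (C.j (-k) (T y) * z) := by
  let g : H →ₗ[𝕜] H := antipode 𝕜 ∘ₗ C.chain ∘ₗ LinearMap.mulLeft 𝕜 z ∘ₗ f
  have h1 : antipode 𝕜 ∘ₗ C.chain ∘ₗ LinearMap.mulLeft 𝕜 (f' y * z) ∘ₗ f =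
      g * LinearMap.mulRight 𝕜 y := by
    ext x
    simp only [LinearMap.comp_apply, LinearMap.mulLeft_apply, Module.End.mul_apply, g,
      LinearMap.mulRight_apply]
    rw [mul_assoc, ← hs y, hf.map_mul, mul_assoc]
  have h2 : antipode 𝕜 ∘ₗ C.chain ∘ₗ LinearMap.mulLeft 𝕜 (C.j (-k) (T y) * z) ∘ₗ f =
      LinearMap.mulRight 𝕜 y * g := by
    ext x
    simp only [LinearMap.comp_apply, LinearMap.mulLeft_apply, Module.End.mul_apply, g,
      LinearMap.mulRight_apply]
    rw [mul_assoc, C.chain_first, antipode_mul_antidistrib, hT.antipode_inv]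
  rw [traceForm_apply, traceForm_apply, h1, h2, LinearMap.trace_mul_comm]

/-- By the previous exchange f(y₁) j₀(y₂) acts as j₀(y₂ S⁻¹(y₁)), which sums to ε(y). The
convolution f * j₀ is that of the list extended by position 0. -/
theorem traceForm_absorb_right (hT : IsAntipodeInv T) (hf : IsAlg f)
    (hc : ∀ x y, Commute (f x) (C.j 0 y)) (y : H) (z : R) :
    C.traceForm f (z * conv f (C.j 0).toLinearMap y) = counit (R := 𝕜) y * C.traceForm f z := by
  have h : ∀ X : H ⊗[𝕜] H, C.traceForm f (z * pairMul f (C.j 0).toLinearMap X) =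
      C.traceForm f (z * C.j 0 (pairMul LinearMap.id T (TensorProduct.comm 𝕜 H H X))) := by
    intro X
    induction X with
    | zero => simp
    | add x y hx hy => simp only [map_add, mul_add, hx, hy]
    | tmul a b =>
      rw [pairMul_tmul, AlgHom.toLinearMap_apply, (hc a b).eq, ← mul_assoc,
        C.traceForm_mul_last hT hf hc]
      simp [mul_assoc]
  rw [conv_apply, h, hT.pairMul_comm_comul', AlgHom.commutes, ← Algebra.commutes,
    ← Algebra.smul_def, map_smul, smul_eq_mul]

theorem traceForm_absorb_left (hT : IsAntipodeInv T) (hf : IsAlg f)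
    (hs : ∀ x, C.Slides (f x) (f' x)) (hc : ∀ x y, Commute (C.j (-k) x) (f' y)) (y : H) (z : R) :
    C.traceForm f (conv (C.j (-k)).toLinearMap f' y * z) =
      counit (R := 𝕜) y * C.traceForm f z := by
  have h : ∀ X : H ⊗[𝕜] H, C.traceForm f (pairMul (C.j (-k)).toLinearMap f' X * z) =
      C.traceForm f (C.j (-k) (pairMul T LinearMap.id (TensorProduct.comm 𝕜 H H X)) * z) := by
    intro X
    induction X with
    | zero => simp
    | add x y hx hy => simp only [map_add, add_mul, hx, hy]
    | tmul a b =>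
      rw [pairMul_tmul, AlgHom.toLinearMap_apply, (hc a b).eq, mul_assoc,
        C.traceForm_first_mul hT hf hs]
      simp [mul_assoc]
  rw [conv_apply, h, hT.pairMul_comm_comul, AlgHom.commutes, ← Algebra.smul_def, map_smul,
    smul_eq_mul]

/-- The trace of the twisted operator, in terms of `traceForm`. -/
theorem trace_twisted (hT : IsAntipodeInv T) (F : TwoCocycle 𝕜 H) (hf : IsAlg f)
    (hc : ∀ x y, Commute (f x) (C.j 0 y)) (hs : ∀ x, C.Slides (f x) (f' x))
    (hc' : ∀ x y, Commute (C.j (-k) x) (f' y)) {a b b' : R} (hb : C.Slides b b')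
    (hbc : ∀ y, Commute b (C.j 0 y)) :
    LinearMap.trace 𝕜 H (LinearMap.mulLeftRight 𝕜 (F.u, F.uInv) ∘ₗ antipode 𝕜 ∘ₗ C.chain ∘ₗ
        LinearMap.mulLeftRight 𝕜 (a, b) ∘ₗ f) =
      C.traceForm f (pairMul (C.j (-k)).toLinearMap f' F.inv * b' *
        (a * pairMul f (C.j 0).toLinearMap F.val)) := by
  have h0 : IsAlg (C.j 0).toLinearMap := isAlg_algHom _
  have h1 : IsAlg (C.j (-k)).toLinearMap := isAlg_algHom _
  -- The conjugation by u in the twisted antipode is S of factors S⁻¹(u⁻¹) at the first and S⁻¹(u)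
  -- at the last position. The exchange rules replace these by copies of F⁻¹ and F that involve f',
  -- f and one extra position.
  have e1 := left_exchange_uInv hT (Ψ := C.traceForm f) h1 hc'
    (C.traceForm_first_mul hT hf hs) F (b' * (a * pairMul f (C.j 0).toLinearMap F.val))
  have e2 := right_exchange_u hT (Ψ := C.traceForm f) h0 hc
    (C.traceForm_mul_last hT hf hc) F (C.j (-k) (T F.uInv) * b' * a)
  rw [mul_assoc, e1, ← mul_assoc, ← mul_assoc]
  refine Eq.trans ?_ e2.symm
  rw [traceForm_apply]
  congr 1
  ext x
  simp only [LinearMap.comp_apply, LinearMap.mulLeft_apply, LinearMap.mulLeftRight_apply,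
    AlgHom.toLinearMap_apply]
  have e3 : C.chain (a * f x * b * C.j 0 (T F.u)) =
      C.chain (b' * (a * C.j 0 (T F.u)) * f x) := by
    have hx := hc x (T F.u)
    rw [mul_assoc _ b, (hbc _).eq, ← mul_assoc, hb, mul_assoc a, hx.eq]
    simp only [mul_assoc]
  have e4 : C.j (-k) (T F.uInv) * b' * a * C.j 0 (T F.u) * f x =
      C.j (-k) (T F.uInv) * (b' * (a * C.j 0 (T F.u)) * f x) := by simp only [mul_assoc]
  rw [e4, C.chain_first, ← e3, C.chain_last, antipode_mul_antidistrib, antipode_mul_antidistrib,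
    hT.antipode_inv, hT.antipode_inv]

end ChainSystem

end Chain

end HopfTrace

namespace HopfTrace

open Coalgebra HopfAlgebra

/-! ### The slots of the shuffled power, and the three blocks of exponents. -/

namespace ChainSystem

variable {𝕜 H R : Type*} [Field 𝕜] [Ring H] [HopfAlgebra 𝕜 H] [Ring R] [Algebra 𝕜 R] {n k : ℕ}
  (C : ChainSystem 𝕜 H R n k) (θ : H ≃ₐ[𝕜] H) (W : ℤ → Hˣ) (c : ZMod n → ℤ)

/-- The slot at the position `i` with the exponent `c i`. -/
noncomputable def expSlot (i : ℕ) : Slot 𝕜 H R := C.slot (i : ZMod n) (θ ^ c i) (W (c i))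

/-- The slot at the position `i - k` with the exponent `c i`. -/
noncomputable def expSlotBack (i : ℕ) : Slot 𝕜 H R :=
  C.slot ((i : ZMod n) - k) (θ ^ c i) (W (c i))

/-- The slot at the position `i` with the exponent `c (i + k)`. -/
noncomputable def expSlotNext (i : ℕ) : Slot 𝕜 H R :=
  C.slot (i : ZMod n) (θ ^ c ((i : ZMod n) + k)) (W (c ((i : ZMod n) + k)))

theorem expSlotBack_add (i : ℕ) : C.expSlotBack θ W c (i + k) = C.expSlotNext θ W c i := by
  simp [expSlotBack, expSlotNext]

/-- Since n - k = 2m + 1, the position i - k is the class of 2m + 1 + i. -/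
theorem expSlotBack_add' (i m : ℕ) (hn : 2 * m + 1 + k = n) :
    C.expSlotBack θ W c i = C.expSlotNext θ W c (2 * m + 1 + i) := by
  have : (((2 * m + 1 + i : ℕ) : ZMod n) + k) = i := by
    have h : ((2 * m + 1 + k : ℕ) : ZMod n) = 0 := by rw [hn]; simp
    calc (((2 * m + 1 + i : ℕ) : ZMod n) + k) = ((2 * m + 1 + k : ℕ) : ZMod n) + i := by
          push_cast; ring
      _ = i := by rw [h, zero_add]
  rw [expSlotBack, expSlotNext, this]
  congr 1
  rw [sub_eq_iff_eq_add, this]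

variable (n k) in
/-- The exponents in terms of `m = (n - k - 1) / 2`. -/
theorem exponent_cases {c : ZMod n → ℤ} (hc : IsExponentSeq n k c) {m : ℕ}
    (hn : 2 * m + 1 + k = n) :
    c 0 = 0 ∧ (∀ i ∈ List.range' 1 m, c ((i : ZMod n) + k) = c i + 1) ∧
      (∀ i ∈ List.range' (m + 1) m, c ((i : ZMod n) + k) = c i - 1) ∧
      ∀ i ∈ List.range' (2 * m + 1) (k + 1), c ((i : ZMod n) + k) = c i := by
  have hm : (n - k - 1) / 2 = m := by omega
  have h1 := hc.up
  have h2 := hc.down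
  have h3 := hc.stay
  rw [hm] at h1 h2 h3
  simp only [List.mem_range'_1]
  refine ⟨by simpa using hc.last, fun i hi => h1 i ?_ ?_, fun i hi => h2 i ?_ ?_,
    fun i hi => h3 i ?_ ?_⟩ <;> omega

variable {θ W c}

/-- For the exponent c + 1 the unit is W_{c+1} = W_c θ^c(w), so W_{c+1}⁻¹ W_c is θ^c(w⁻¹), the value
of the old slot at w⁻¹. -/
theorem twisted_up (hθ : ∀ x, θ x = antipodeSq 𝕜 H x) {w w' : H} (hw : w * w' = 1)
    (hW : ∀ m, (W (m + 1) : H) = W m * (θ ^ m) w) {i : ℕ}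
    (hi : c ((i : ZMod n) + k) = c i + 1) :
    (C.expSlotNext θ W c i).Twisted (antipodeSq 𝕜 H) w' (C.expSlot θ W c i) where
  hom_eq := by
    ext x
    simp only [expSlotNext, expSlot, LinearMap.comp_apply, slot_hom, hi]
    rw [zpow_add_one, AlgEquiv.mul_apply, hθ]
  unit_eq := by
    rw [expSlotNext, expSlot, slot_unit_inv, slot_unit, slot_hom, hi, ← map_mul]
    congr 1
    rw [Units.inv_mul_eq_iff_eq_mul, hW, mul_assoc, ← map_mul, hw, map_one, mul_one]

/-- For the exponent c - 1 the quotient W_{c-1}⁻¹ W_c is θ^{c-1}(w) = θ^c(S⁻²(w)). -/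
theorem twisted_down {T : H →ₗ[𝕜] H} (hT : IsAntipodeInv T)
    (hθ : ∀ x, θ x = antipodeSq 𝕜 H x) {w : H}
    (hW : ∀ m, (W (m + 1) : H) = W m * (θ ^ m) w) {i : ℕ}
    (hi : c ((i : ZMod n) + k) = c i - 1) :
    (C.expSlotNext θ W c i).Twisted (T ∘ₗ T) ((T ∘ₗ T) w) (C.expSlot θ W c i) := by
  have hT2 : ∀ x, θ ((T ∘ₗ T) x) = x := fun x => by rw [hθ]; exact hT.sq_inv x
  have hp : ∀ (m : ℤ) x, (θ ^ m) ((T ∘ₗ T) x) = (θ ^ (m - 1)) x := by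
    intro m x
    obtain ⟨m, rfl⟩ : ∃ m', m = m' + 1 := ⟨m - 1, by ring⟩
    rw [zpow_add_one, AlgEquiv.mul_apply, hT2, add_sub_cancel_right]
  constructor
  · ext x
    simp only [expSlotNext, expSlot, LinearMap.comp_apply, slot_hom, hi]
    rw [← hp]
    rfl
  · rw [expSlotNext, expSlot, slot_unit_inv, slot_unit, slot_hom, hi, ← map_mul]
    congr 1
    rw [Units.inv_mul_eq_iff_eq_mul, hp, ← hW, sub_add_cancel]

theorem twisted_stay {i : ℕ} (hi : c ((i : ZMod n) + k) = c i) :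
    (C.expSlotNext θ W c i).Twisted LinearMap.id 1 (C.expSlot θ W c i) where
  hom_eq := by rw [expSlotNext, expSlot, hi]; rfl
  unit_eq := by
    rw [expSlotNext, expSlot, slot_unit_inv, slot_unit, slot_hom, hi, ← map_mul]
    simp

theorem forall₂_twisted {p : H →ₗ[𝕜] H} {v : H} {l : List ℕ}
    (h : ∀ i ∈ l, (C.expSlotNext θ W c i).Twisted p v (C.expSlot θ W c i)) :
    List.Forall₂ (Slot.Twisted p v) (l.map (C.expSlotNext θ W c)) (l.map (C.expSlot θ W c)) := by
  rw [List.forall₂_map_left_iff, List.forall₂_map_right_iff, List.forall₂_same]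
  exact h

theorem natCast_injOn {i j : ℕ} {a : ℕ} (hi : a ≤ i ∧ i < a + n) (hj : a ≤ j ∧ j < a + n)
    (h : (i : ZMod n) = j) : i = j := by
  rw [ZMod.natCast_eq_natCast_iff'] at h
  have h1 := Nat.div_add_mod i n
  have h2 := Nat.div_add_mod j n
  have := (Nat.modEq_iff_dvd.1 (show i ≡ j [MOD n] from h))
  obtain ⟨q, hq⟩ := this
  have hq0 : q = 0 := by
    by_contra hq0
    have : |(j : ℤ) - i| < n := by rw [abs_lt]; omega
    rw [hq, abs_mul, Nat.abs_cast] at this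
    have h3 := Int.one_le_abs hq0
    nlinarith
  rw [hq0] at hq
  omega

theorem nodup_range'_cast (a m : ℕ) (hm : m ≤ n) :
    ((List.range' a m).map fun i : ℕ => (i : ZMod n)).Nodup := by
  rw [List.nodup_map_iff_inj_on (List.nodup_range')]
  intro x hx y hy h
  rw [List.mem_range'_1] at hx hy
  exact natCast_injOn (a := a) (by omega) (by omega) h

theorem isIndep_expSlot (a m : ℕ) (hm : m ≤ n) :
    IsIndep ((List.range' a m).map (C.expSlot θ W c)) :=
  C.isIndep_map (fun i : ℕ => (i : ZMod n)) (fun i => θ ^ c i) (fun i => W (c i)) _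
    (nodup_range'_cast a m hm)

theorem isIndep_expSlotBack (a m : ℕ) (hm : m ≤ n) :
    IsIndep ((List.range' a m).map (C.expSlotBack θ W c)) := by
  refine C.isIndep_map (fun i : ℕ => (i : ZMod n) - k) (fun i => θ ^ c i) (fun i => W (c i)) _ ?_
  have := (nodup_range'_cast (n := n) a m hm).map (f := fun x => x - (k : ZMod n))
    sub_left_injective
  rwa [List.map_map] at this

theorem forall₂_slides (m : ℕ) (hm : m < n) :
    List.Forall₂ (SlotSlides (C := C)) ((List.range' 1 m).map (C.expSlot θ W c))
      ((List.range' 1 m).map (C.expSlotBack θ W c)) := by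
  rw [List.forall₂_map_left_iff, List.forall₂_map_right_iff, List.forall₂_same]
  intro i hi
  rw [List.mem_range'_1] at hi
  refine slotSlides ?_ _ _
  intro h
  have := natCast_injOn (n := n) (a := 0) (i := i) (j := 0) (by omega) (by omega) (by simpa using h)
  omega

theorem range'_split {m : ℕ} (hn : 2 * m + 1 + k = n) :
    List.range' 1 m ++ List.range' (m + 1) m ++ List.range' (2 * m + 1) (k + 1) =
      List.range' 1 n := by
  have e : 2 * m + 1 = 1 + (m + m) := by ring
  rw [add_comm m 1, List.range'_append_1, e, List.range'_append_1]
  congr 1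
  omega

theorem range'_split_last (hn : 0 < n) :
    List.range' 1 (n - 1) ++ [n] = List.range' 1 n := by
  obtain ⟨m, rfl⟩ : ∃ m, n = m + 1 := ⟨n - 1, by omega⟩
  rw [List.range'_1_concat, Nat.add_sub_cancel, add_comm 1 m]

theorem range'_split_first (hn : 0 < n) : 0 :: List.range' 1 (n - 1) = List.range' 0 n := by
  obtain ⟨m, rfl⟩ : ∃ m, n = m + 1 := ⟨n - 1, by omega⟩
  rfl

/-- The indices 0, …, n - 1 shifted by -k start with the k + 1 positions n - k, …, n, both ends
included, and continue with 1, …, 2m. The block of constant exponents therefore moves from the end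
of the list to its beginning. -/
theorem map_expSlotBack {m : ℕ} (hn : 2 * m + 1 + k = n) :
    (List.range' (2 * m + 1) (k + 1)).map (C.expSlotNext θ W c) ++
      ((List.range' 1 m).map (C.expSlotNext θ W c) ++
        (List.range' (m + 1) m).map (C.expSlotNext θ W c)) =
      (List.range' 0 n).map (C.expSlotBack θ W c) := by
  have h3 : (List.range' (2 * m + 1) (k + 1)).map (C.expSlotNext θ W c) =
      (List.range' 0 (k + 1)).map (C.expSlotBack θ W c) := by
    rw [List.range'_eq_map_range, List.range'_eq_map_range, List.map_map, List.map_map]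
    refine List.map_congr_left fun i _ => ?_
    simp only [Function.comp_apply, zero_add]
    rw [expSlotBack_add' C θ W c i m hn]
  have h4 : (List.range' 1 (m + m)).map (C.expSlotNext θ W c) =
      (List.range' (k + 1) (m + m)).map (C.expSlotBack θ W c) := by
    rw [List.range'_eq_map_range, List.range'_eq_map_range, List.map_map, List.map_map]
    refine List.map_congr_left fun i _ => ?_
    simp only [Function.comp_apply]
    rw [show k + 1 + i = 1 + i + k by ring, expSlotBack_add]
  have h5 := List.range'_append_1 (s := 0) (m := k + 1) (n := m + m)
  rw [zero_add, show k + 1 + (m + m) = n by omega] at h5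
  rw [← List.map_append, add_comm m 1, List.range'_append_1, h3, h4, ← List.map_append, h5]

/-- The product of the iterated cocycles along the two orders, in terms of three blocks. -/
theorem listCocycleInv_mul_blocks [Module.Finite 𝕜 H] {T : H →ₗ[𝕜] H} (hT : IsAntipodeInv T)
    (F : TwoCocycle 𝕜 H) {A B Y A' B' Y' : List (Slot 𝕜 H R)} (hL : IsIndep (A ++ B ++ Y))
    (hL' : IsIndep (Y' ++ (A' ++ B')))
    (tA : List.Forall₂ (Slot.Twisted (antipodeSq 𝕜 H) F.wInv) A' A)
    (tB : List.Forall₂ (Slot.Twisted (T ∘ₗ T) ((T ∘ₗ T) F.w)) B' B)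
    (tY : List.Forall₂ (Slot.Twisted LinearMap.id 1) Y' Y) :
    listCocycleInv F (Y' ++ (A' ++ B')) * listCocycle F (A ++ B ++ Y) =
      pairMul (listConv Y) (conv (listConv A ∘ₗ antipodeSq 𝕜 H) (listConv B ∘ₗ T ∘ₗ T)) F.inv *
      pairMul (listConv A ∘ₗ antipodeSq 𝕜 H) (listConv B ∘ₗ T ∘ₗ T) F.inv *
      (listConv A F.wInv * listConv B ((T ∘ₗ T) F.w)) *
      pairMul (listConv A) (listConv B) F.val *
      pairMul (conv (listConv A) (listConv B)) (listConv Y) F.val := by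
  have iAB := hL.append_left
  have eA := listCocycleInv_mul_twisted F comul_antipodeSq counit_antipodeSq F.comul_wInv
    F.counit_wInv iAB.append_left tA
  have eB := listCocycleInv_mul_twisted F hT.comul_inv_sq hT.counit_inv_sq (F.comul_inv_sq_w hT)
    (by rw [hT.counit_inv_sq, F.counit_w]) iAB.append_right tB
  have eY := listCocycleInv_mul_twisted F (p := LinearMap.id) (v := 1) (by simp) (by simp)
    (by simp [← Algebra.TensorProduct.one_def]) (by simp) hL.append_right tY
  have qA := listConv_twisted comul_antipodeSq counit_antipodeSq tA
  have qB := listConv_twisted hT.comul_inv_sq hT.counit_inv_sq tB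
  have qY := listConv_twisted (p := LinearMap.id) (by simp) (by simp) tY
  have hAB := iAB.listIndep
  have hYA : ListIndep Y (A ++ B) := hL.listIndep.symm
  have c1 : Commute (listCocycleInv F Y') (listCocycle F (A ++ B)) :=
    listCocycleInv_commute F (twisted_commutesWith tY fun s hs =>
      hYA.cocycle_commutesWith F hs)
  have c2 : Commute (listCocycleInv F B') (listConv A F.wInv) :=
    listCocycleInv_commute F (twisted_commutesWith tB fun s hs =>
      hAB.symm.conv_commutesWith hs _)
  rw [(isAlg_listConv hL.append_right).map_one] at eY
  rw [listCocycleInv_append F hL', listCocycleInv_append F hL'.append_right,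
    listCocycle_append F hL, listConv_append, listConv_append, qA, qB, qY, LinearMap.comp_id]
  -- The order of the blocks is such that, after commuting independent ones, each inverse cocycle
  -- meets the cocycle of the same block. Only the copies of F^{±1} between blocks survive.
  have e : ∀ g₁ g₂ b₁ b₂ b₃ x y z : R, g₁ * (g₂ * b₁ * b₂) * b₃ * (x * y * z) =
      g₁ * g₂ * (b₁ * (b₂ * ((b₃ * x) * y))) * z := by
    intros; simp only [mul_assoc]
  rw [e, c1.eq, mul_assoc (listCocycle F (A ++ B)), eY, mul_one, listCocycle_append F iAB,
    ← mul_assoc (listCocycleInv F A'), ← mul_assoc (listCocycleInv F A'), eA,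
    ← mul_assoc (listCocycleInv F B'), ← mul_assoc (listCocycleInv F B'), c2.eq,
    mul_assoc (listConv A _), eB]
  simp only [mul_assoc]

/-- Invariance of the trace of the antipode composed with the multiplication along a chain. -/
theorem trace_invariance [Module.Finite 𝕜 H] {T : H →ₗ[𝕜] H} (hT : IsAntipodeInv T)
    (F : TwoCocycle 𝕜 H) (hθ : ∀ x, θ x = antipodeSq 𝕜 H x) (hW0 : W 0 = 1)
    (hW : ∀ m, (W (m + 1) : H) = W m * (θ ^ m) F.w) (hkn : k < n) (hodd : Odd (n - k))
    (hc : IsExponentSeq n k c) :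
    LinearMap.trace 𝕜 H (antipode 𝕜 ∘ₗ C.chain ∘ₗ
        listConv ((List.range' 1 (n - 1)).map (C.expSlot θ W c))) =
      LinearMap.trace 𝕜 H (LinearMap.mulLeftRight 𝕜 (F.u, F.uInv) ∘ₗ antipode 𝕜 ∘ₗ C.chain ∘ₗ
        LinearMap.mulLeftRight 𝕜
          (listCocycle F ((List.range' 1 (n - 1)).map (C.expSlot θ W c)),
            listCocycleInv F ((List.range' 1 (n - 1)).map (C.expSlot θ W c))) ∘ₗ
        listConv ((List.range' 1 (n - 1)).map (C.expSlot θ W c))) := by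
  obtain ⟨m, hm⟩ := hodd
  have hn : 2 * m + 1 + k = n := by omega
  obtain ⟨c0, cA, cB, cY⟩ := exponent_cases n k hc hn
  have hback := C.map_expSlotBack (θ := θ) (W := W) (c := c) hn
  have hfwd := congrArg (List.map (C.expSlot θ W c)) (range'_split hn)
  rw [List.map_append, List.map_append] at hfwd
  have tA : List.Forall₂ (Slot.Twisted (antipodeSq 𝕜 H) F.wInv) _ _ :=
    C.forall₂_twisted fun i hi => C.twisted_up hθ F.w_mul_wInv hW (cA i hi)
  have tB : List.Forall₂ (Slot.Twisted (T ∘ₗ T) ((T ∘ₗ T) F.w)) _ _ :=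
    C.forall₂_twisted fun i hi => C.twisted_down hT hθ hW (cB i hi)
  have tY := C.forall₂_twisted (θ := θ) (W := W) (c := c)
    fun i hi => C.twisted_stay (cY i hi)
  have iL := C.isIndep_expSlot (θ := θ) (W := W) (c := c) 1 n le_rfl
  have iL' := C.isIndep_expSlotBack (θ := θ) (W := W) (c := c) 0 n le_rfl
  have hlast := congrArg (List.map (C.expSlot θ W c)) (range'_split_last (n := n) (by omega))
  have hfirst := congrArg (List.map (C.expSlotBack θ W c)) (range'_split_first (n := n) (by omega))
  -- As c_n = 0 and W_0 = 1, the slots added at position 0 and at position -k are the bare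
  -- embeddings, with unit 1.
  have h1 : C.expSlot θ W c n = C.slot 0 1 1 := by simp [expSlot, c0, hW0]
  have h2 : C.expSlotBack θ W c 0 = C.slot (-k) 1 1 := by simp [expSlotBack, c0, hW0]
  rw [List.map_append, List.map_singleton, h1] at hlast
  rw [List.map_cons, h2] at hfirst
  have hs := C.forall₂_slides (θ := θ) (W := W) (c := c) (n - 1) (by omega)
  -- The forward list 1, …, n and the shifted list 0, …, n - 1 occupy the same positions; in blocks
  -- they are A, B, Y and Y', A', B'.
  have key := listCocycleInv_mul_blocks hT F (hfwd ▸ iL) (hback ▸ iL') tA tB tY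
  have iAB := (hfwd ▸ iL : IsIndep (_ ++ _ ++ _)).append_left
  have iY := (hfwd ▸ iL : IsIndep (_ ++ _ ++ _)).append_right
  have iABY := (hfwd ▸ iL : IsIndep (_ ++ _ ++ _)).listIndep
  have qA := listConv_twisted comul_antipodeSq counit_antipodeSq tA
  have qB := listConv_twisted hT.comul_inv_sq hT.counit_inv_sq tB
  have qY := listConv_twisted (p := LinearMap.id) (by simp) (by simp) tY
  rw [hfwd, hback, ← hlast, ← hfirst] at key
  -- The convolution along the full list is read in two ways: as l0 followed by position 0, for
  -- which absorption is known, and as A * B * Y, the form `functional_invariance` asks for. The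
  -- same holds for the shifted list on the left.
  have hconv := congrArg listConv (hlast.trans hfwd.symm)
  have hconv' := congrArg listConv (hfirst.trans hback.symm)
  simp only [listConv_append, listConv_singleton] at hconv
  rw [listConv, listConv_append, listConv_append, qA, qB, qY, LinearMap.comp_id] at hconv'
  rw [← hlast] at iL
  rw [← hfirst] at iL'
  set l0 := (List.range' 1 (n - 1)).map (C.expSlot θ W c) with hl0
  set l0' := (List.range' 1 (n - 1)).map (C.expSlotBack θ W c) with hl0'
  have i0 := isAlg_listConv iL.append_left
  have hc0 : ∀ x y, Commute (listConv l0 x) (C.j 0 y) := fun x y => by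
    have := iL.listIndep.conv_conv x y
    rwa [listConv_singleton] at this
  have hc0' : ∀ x y, Commute (C.j (-k) x) (listConv l0' y) := iL'.conv_hom
  have hsl := Slides.listConv hs
  have hr := C.traceForm_absorb_right hT i0 hc0
  have hl := C.traceForm_absorb_left hT i0 hsl hc0'
  have hj0 : (C.slot 0 1 1).hom = (C.j 0).toLinearMap := rfl
  have hjk : (C.slot (-k) 1 1).hom = (C.j (-k)).toLinearMap := rfl
  rw [hj0] at hconv
  rw [hjk] at hconv'
  rw [hconv] at hr
  rw [hconv'] at hl
  have inv := functional_invariance hT F (isAlg_listConv iAB.append_left)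
    (isAlg_listConv iAB.append_right) (isAlg_listConv iY) iAB.listIndep.conv_conv
    (ListIndep.conv_conv fun s hs => iABY s (List.mem_append_left _ hs))
    (ListIndep.conv_conv fun s hs => iABY s (List.mem_append_right _ hs)) hr hl
  -- Splitting off the extra position from both full lists gives exactly the element produced by
  -- `trace_twisted`.
  rw [← key, listCocycleInv, listCocycle_append F iL, listConv_singleton,
    listCocycle_singleton F _ (isAlg_algHom _), slot_unit, slot_unit_inv, hj0, hjk] at inv
  simp only [Units.val_one, inv_one, map_one, mul_one] at inv
  have htr := C.trace_twisted hT F i0 hc0 hsl hc0' (a := listCocycle F l0)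
    (Slides.listCocycleInv F hs)
    (fun y => listCocycleInv_commute F fun s hs =>
      (iL.listIndep s hs _ (List.mem_singleton_self _)).1 y)
  rw [htr, inv, traceForm_apply]
  congr 1
  ext x
  simp

end ChainSystem

end HopfTrace

namespace HopfTrace

open Coalgebra HopfAlgebra

/-! ### Moving a factor within an ordered product. -/

section OrderedProducts

variable {M : Type*} [Monoid M]

theorem prod_ofFn_slide {n : ℕ} (t t' : Fin n) (h : (t' : ℕ) = t + 1) (v : Fin n → M) (b : M) :
    (List.ofFn fun i => v i * if i = t then b else 1).prod =
      (List.ofFn fun i => (if i = t' then b else 1) * v i).prod := by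
  induction n with
  | zero => exact t.elim0
  | succ n ih =>
    obtain ⟨s', rfl⟩ : ∃ s', t' = Fin.succ s' :=
      ⟨t'.pred (by rintro rfl; simp at h), (Fin.succ_pred _ _).symm⟩
    rw [List.ofFn_succ, List.ofFn_succ, List.prod_cons, List.prod_cons]
    rw [if_neg (Fin.succ_ne_zero s').symm, one_mul]
    simp only [Fin.succ_inj]
    cases t using Fin.cases with
    | zero =>
      simp only [if_true, Fin.succ_ne_zero, if_false, mul_one]
      obtain ⟨n, rfl⟩ : ∃ m, n = m + 1 := ⟨n - 1, by have := s'.isLt; omega⟩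
      obtain rfl : s' = 0 := Fin.ext (by simpa using h)
      rw [List.ofFn_succ, List.ofFn_succ, List.prod_cons, List.prod_cons]
      simp [mul_assoc]
    | succ s =>
      rw [if_neg (Fin.succ_ne_zero s).symm, mul_one]
      simp only [Fin.succ_inj]
      rw [ih s s' (by simpa using h)]

theorem prod_ofFn_last {n : ℕ} (t : Fin n) (h : (t : ℕ) + 1 = n) (v : Fin n → M) (b : M) :
    (List.ofFn fun i => v i * if i = t then b else 1).prod = (List.ofFn v).prod * b := by
  induction n with
  | zero => exact t.elim0
  | succ n ih =>
    rw [List.ofFn_succ, List.ofFn_succ, List.prod_cons, List.prod_cons]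
    cases t using Fin.cases with
    | zero =>
      obtain rfl : n = 0 := by simpa using h.symm
      simp
    | succ s =>
      rw [if_neg (Fin.succ_ne_zero s).symm, mul_one]
      simp only [Fin.succ_inj]
      rw [ih s (by simpa using h), mul_assoc]

theorem prod_ofFn_first {n : ℕ} (t : Fin n) (h : (t : ℕ) = 0) (v : Fin n → M) (b : M) :
    (List.ofFn fun i => (if i = t then b else 1) * v i).prod = b * (List.ofFn v).prod := by
  cases n with
  | zero => exact t.elim0
  | succ n =>
    obtain rfl : t = 0 := Fin.ext h
    rw [List.ofFn_succ, List.ofFn_succ, List.prod_cons, List.prod_cons]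
    simp [Fin.succ_ne_zero, mul_assoc]

end OrderedProducts

/-! ### The tensor power as a chain system. -/

section TensorChain

variable {n k : ℕ}

/-- The place of `x` in the order `-k, -2k, …, -nk` of `ℤ/n`. -/
noncomputable def chainTime (n k : ℕ) [NeZero n] (h : n.Coprime k) (x : ZMod n) : Fin n :=
  -- Places are counted from 0, so this is the solution t of x = -(t + 1)k.
  ⟨(-(x * ((ZMod.unitOfCoprime k h.symm)⁻¹ : (ZMod n)ˣ)) - 1).val, ZMod.val_lt _⟩

variable [NeZero n] (h : n.Coprime k)

theorem chainTime_injective : Function.Injective (chainTime n k h) := by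
  intro x y hxy
  have h1 := ZMod.val_injective n (Fin.mk.inj_iff.1 hxy)
  rw [sub_left_inj, neg_inj] at h1
  exact (Units.isUnit _).mul_right_cancel h1

theorem chainTime_zero : (chainTime n k h 0 : ℕ) + 1 = n := by
  obtain ⟨m, hm⟩ : ∃ m, n = m + 1 := ⟨n - 1, by have := NeZero.pos n; omega⟩
  subst hm
  simp [chainTime, ZMod.val_neg_one]

theorem chainTime_neg : (chainTime n k h (-k) : ℕ) = 0 := by
  have hk : (k : ZMod n) = ZMod.unitOfCoprime k h.symm := (ZMod.coe_unitOfCoprime k h.symm).symm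
  have : (-((-(k : ZMod n)) * ((ZMod.unitOfCoprime k h.symm)⁻¹ : (ZMod n)ˣ)) - 1) = 0 := by
    rw [hk, neg_mul, Units.mul_inv]
    ring
  exact (congrArg ZMod.val this).trans ZMod.val_zero

theorem chainTime_sub {x : ZMod n} (hx : x ≠ 0) :
    (chainTime n k h (x - k) : ℕ) = chainTime n k h x + 1 := by
  have hk : (k : ZMod n) = ZMod.unitOfCoprime k h.symm := (ZMod.coe_unitOfCoprime k h.symm).symm
  have e : (-((x - (k : ZMod n)) * ((ZMod.unitOfCoprime k h.symm)⁻¹ : (ZMod n)ˣ)) - 1) =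
      (-(x * ((ZMod.unitOfCoprime k h.symm)⁻¹ : (ZMod n)ˣ)) - 1) + 1 := by
    rw [sub_mul]
    conv_lhs => rw [hk, Units.mul_inv]
    ring
  -- Position 0 has the last place. For x ≠ 0 the place of x can thus be increased by one without
  -- wrapping around modulo n.
  have h0 := chainTime_zero h
  have hne : chainTime n k h x ≠ chainTime n k h 0 := fun h' => hx (chainTime_injective h h')
  have hlt : (chainTime n k h x : ℕ) + 1 < n := by
    have := (chainTime n k h x).isLt
    have : (chainTime n k h x : ℕ) ≠ chainTime n k h 0 := fun h' => hne (Fin.ext h')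
    omega
  unfold chainTime at hlt ⊢
  simp only at hlt ⊢
  rw [e]
  have h1 : (1 : ZMod n).val = 1 := by
    have := ZMod.val_natCast_of_lt (n := n) (a := 1) (by omega)
    simpa using this
  rw [ZMod.val_add_of_lt (by rw [h1]; exact hlt), h1]

variable (𝕜 H : Type*) [Field 𝕜] [Ring H] [HopfAlgebra 𝕜 H]

theorem tensorMul_tprod (m : ℕ) (v : Fin m → H) :
    tensorMul 𝕜 H m (PiTensorProduct.tprod 𝕜 v) = (List.ofFn v).prod := by
  rw [tensorMul, PiTensorProduct.lift.tprod, MultilinearMap.mkPiAlgebraFin_apply]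

theorem tprod_mul_single {m : ℕ} (v : Fin m → H) (t : Fin m) (b : H) :
    PiTensorProduct.tprod 𝕜 v * PiTensorProduct.singleAlgHom (R := 𝕜) (A := fun _ => H) t b =
      PiTensorProduct.tprod 𝕜 (fun i => v i * if i = t then b else 1) := by
  rw [PiTensorProduct.singleAlgHom_apply, PiTensorProduct.tprod_mul_tprod]
  congr 1
  ext i
  simp [Pi.mulSingle_apply]

theorem single_mul_tprod {m : ℕ} (v : Fin m → H) (t : Fin m) (b : H) :
    PiTensorProduct.singleAlgHom (R := 𝕜) (A := fun _ => H) t b * PiTensorProduct.tprod 𝕜 v =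
      PiTensorProduct.tprod 𝕜 (fun i => (if i = t then b else 1) * v i) := by
  rw [PiTensorProduct.singleAlgHom_apply, PiTensorProduct.tprod_mul_tprod]
  congr 1
  ext i
  simp [Pi.mulSingle_apply]

/-- The tensor power of `H`, with its factors in the order `-k, -2k, …, -nk` of `ℤ/n`. -/
noncomputable def tensorChain : ChainSystem 𝕜 H (⨂[𝕜] (_ : Fin n), H) n k where
  j x := PiTensorProduct.singleAlgHom (R := 𝕜) (A := fun _ : Fin n => H) (chainTime n k h x)
  chain := tensorMul 𝕜 H n
  commute x y hxy a b := by
    simp only [PiTensorProduct.singleAlgHom_apply]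
    apply Commute.tprod
    exact Pi.mulSingle_commute (f := fun _ : Fin n => H) (fun h' => hxy (chainTime_injective h h')) a b
  chain_one := by
    rw [PiTensorProduct.one_def, tensorMul_tprod]
    exact List.prod_eq_one fun x hx => by
      obtain ⟨i, rfl⟩ := List.mem_ofFn.1 hx
      rfl
  chain_slide x hx z b := by
    induction z using PiTensorProduct.induction_on with
    | smul_tprod r v =>
      rw [smul_mul_assoc, mul_smul_comm, map_smul, map_smul, tprod_mul_single, single_mul_tprod,
        tensorMul_tprod, tensorMul_tprod, prod_ofFn_slide _ _ (chainTime_sub h hx)]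
    | add x y hx hy => rw [add_mul, mul_add, map_add, map_add, hx, hy]
  chain_last z b := by
    induction z using PiTensorProduct.induction_on with
    | smul_tprod r v =>
      rw [smul_mul_assoc, map_smul, map_smul, tprod_mul_single,
        tensorMul_tprod, tensorMul_tprod, prod_ofFn_last _ (chainTime_zero h), smul_mul_assoc]
    | add x y hx hy => rw [add_mul, map_add, map_add, hx, hy, add_mul]
  chain_first z b := by
    induction z using PiTensorProduct.induction_on with
    | smul_tprod r v =>
      rw [mul_smul_comm, map_smul, map_smul, single_mul_tprod,
        tensorMul_tprod, tensorMul_tprod, prod_ofFn_first _ (chainTime_neg h), mul_smul_comm]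
    | add x y hx hy => rw [mul_add, map_add, map_add, hx, hy, mul_add]

end TensorChain

namespace ChainSystem

variable {𝕜 H R : Type*} [Field 𝕜] [Ring H] [HopfAlgebra 𝕜 H] [Ring R] [Algebra 𝕜 R] {n k : ℕ}
  (C : ChainSystem 𝕜 H R n k)

theorem mul_cast_ne (hn : n.Coprime k) {r t : ℕ} (hr : r < n) (ht : t < n) (hrt : r ≠ t) :
    (-((r + 1 : ℕ) * k) : ZMod n) ≠ -((t + 1 : ℕ) * k) := by
  intro h
  rw [neg_inj, ← ZMod.coe_unitOfCoprime k hn.symm] at h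
  have h1 := (Units.isUnit _).mul_right_cancel h
  exact hrt (by
    have := natCast_injOn (n := n) (a := 1) (by omega) (by omega) h1
    omega)

/-- A factor with no other factors before it can be taken out of the chain. -/
theorem chain_pull (hn : n.Coprime k) {t : ℕ} (ht : t < n) (b : H) (z : R)
    (hz : ∀ r < t, ∀ a, Commute (C.j (-((r + 1 : ℕ) * k)) a) z) :
    C.chain (C.j (-((t + 1 : ℕ) * k)) b * z) = b * C.chain z := by
  induction t with
  | zero => simpa using C.chain_first z b
  | succ t ih =>
    rw [← ih (by omega) fun r hr => hz r (by omega)]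
    have h0 : (-((t + 1 : ℕ) * k) : ZMod n) ≠ 0 := by
      have := mul_cast_ne hn (r := t) (t := n - 1) (by omega) (by omega) (by omega)
      rwa [Nat.sub_add_cancel (by omega : 1 ≤ n), ZMod.natCast_self, zero_mul, neg_zero] at this
    have e : (-((t + 1 + 1 : ℕ) * k) : ZMod n) = -((t + 1 : ℕ) * k) - k := by push_cast; ring
    rw [e, ← C.chain_slide _ h0, (hz t (by omega) b).eq]

theorem chain_prod (hn : n.Coprime k) (m s : ℕ) (hs : s + m ≤ n) (a : Fin m → H) :
    C.chain (List.ofFn fun t : Fin m => C.j (-((s + t + 1 : ℕ) * k)) (a t)).prod =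
      (List.ofFn a).prod := by
  induction m generalizing s with
  | zero => simp [C.chain_one]
  | succ m ih =>
    rw [List.ofFn_succ, List.ofFn_succ, List.prod_cons, List.prod_cons]
    have h1 := ih (s + 1) (by omega) fun i => a i.succ
    have e : ∀ i : Fin m, s + (i.succ : ℕ) + 1 = s + 1 + i + 1 := fun i => by simp; omega
    simp only [e, Fin.val_zero, add_zero]
    rw [C.chain_pull hn (by omega), h1]
    intro r hr b
    refine Commute.list_prod_right _ _ fun y hy => ?_
    obtain ⟨i, rfl⟩ := List.mem_ofFn.1 hy
    exact C.commute _ _ (mul_cast_ne hn (by omega) (by omega) (by omega)) _ _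

/-- The product of the factors at the places `1, …, n - 1` of the chain. -/
theorem chain_prod_perm (hn : n.Coprime k) (h0 : 0 < n) (a : Fin (n - 1) → H) :
    C.chain (List.ofFn fun i : Fin (n - 1) => C.j ((i : ℕ) + 1 : ℕ) (a i)).prod =
      (List.ofFn fun t => a (sigmaPerm n (-(k : ℤ)) (isCoprime_neg_of_coprime hn) t)).prod := by
  set σ := sigmaPerm n (-(k : ℤ)) (isCoprime_neg_of_coprime hn) with hσ
  -- The position σ(t) stands at place t of the chain. The last place, at position 0, stays empty,
  -- so the chain multiplies the factors in the order prescribed by σ.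
  have hσt : ∀ t, (((σ t : ℕ) + 1 : ℕ) : ZMod n) = -((0 + t + 1 : ℕ) * k) := by
    intro t
    have h1 := posRes_pos n (((t : ℕ) + 1 : ℕ) * (-(k : ℤ)))
    have h2 : (σ t : ℕ) + 1 = posRes n (((t : ℕ) + 1 : ℕ) * (-(k : ℤ))) := by
      change posRes n (((t : ℕ) + 1 : ℕ) * (-(k : ℤ))) - 1 + 1 = _
      omega
    rw [h2, posRes_cast h0]
    push_cast
    ring
  rw [← C.chain_prod hn (n - 1) 0 (by omega)]
  congr 1
  simp only [← hσt]
  -- In R factors at different positions commute, so they may be listed in the order of the chain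
  -- before it is applied.
  refine ((σ.ofFn_comp_perm fun i : Fin (n - 1) => C.j ((i : ℕ) + 1 : ℕ) (a i)).symm).prod_eq' ?_
  rw [List.pairwise_ofFn]
  intro i j hij
  refine C.commute _ _ (fun h' => ?_) _ _
  have := natCast_injOn (n := n) (a := 1) (by omega) (by omega) h'
  exact absurd (Fin.lt_def.1 hij) (by omega)

end ChainSystem

/-! ### Iterated comultiplication as convolution along a list. -/

section Iterated

variable {𝕜 H R : Type*} [Field 𝕜] [Ring H] [HopfAlgebra 𝕜 H] [Ring R] [Algebra 𝕜 R]

/-- `v₁ ⊗ ⋯ ⊗ vₘ ↦ f₁(v₁) ⋯ fₘ(vₘ)`. -/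
noncomputable def tensorMulMap {m : ℕ} (f : Fin m → H →ₗ[𝕜] R) :
    (⨂[𝕜] (_ : Fin m), H) →ₗ[𝕜] R :=
  PiTensorProduct.lift ((MultilinearMap.mkPiAlgebraFin 𝕜 m R).compLinearMap f)

theorem tensorMulMap_tprod {m : ℕ} (f : Fin m → H →ₗ[𝕜] R) (v : Fin m → H) :
    tensorMulMap f (PiTensorProduct.tprod 𝕜 v) = (List.ofFn fun i => f i (v i)).prod := by
  rw [tensorMulMap, PiTensorProduct.lift.tprod, MultilinearMap.compLinearMap_apply,
    MultilinearMap.mkPiAlgebraFin_apply]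

theorem tensorMulMap_cons {m : ℕ} (f : Fin (m + 1) → H →ₗ[𝕜] R) (a : H)
    (y : ⨂[𝕜] (_ : Fin m), H) :
    tensorMulMap f (tensorCons 𝕜 H m (a ⊗ₜ y)) = f 0 a * tensorMulMap (fun i => f i.succ) y := by
  induction y using PiTensorProduct.induction_on with
  | smul_tprod r v =>
    rw [TensorProduct.tmul_smul, map_smul, map_smul, map_smul, tensorCons_tmul,
      tensorMulMap_tprod, tensorMulMap_tprod, List.ofFn_succ, List.prod_cons, mul_smul_comm]
    simp
  | add x y hx hy => rw [TensorProduct.tmul_add, map_add, map_add, map_add, hx, hy, mul_add]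

/-- Both sides split off the first tensor factor with one comultiplication. This identifies the
Sweedler power with a `listConv` to which the cocycle calculus applies. -/
theorem tensorMulMap_iterComul {m : ℕ} (s : Fin m → Slot 𝕜 H R) (x : H) :
    tensorMulMap (fun i => (s i).hom) (iterComul 𝕜 H m x) = listConv (List.ofFn s) x := by
  induction m generalizing x with
  | zero =>
    rw [iterComul, LinearMap.comp_apply, List.ofFn_zero, listConv, convUnit_apply]
    generalize counit (R := 𝕜) x = r
    obtain ⟨y, rfl⟩ := (PiTensorProduct.isEmptyEquiv (R := 𝕜) (s := fun _ : Fin 0 => H)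
      (Fin 0)).surjective r
    rw [LinearEquiv.coe_coe, LinearEquiv.symm_apply_apply]
    induction y using PiTensorProduct.induction_on with
    | smul_tprod r v =>
      rw [map_smul, map_smul, tensorMulMap_tprod, PiTensorProduct.isEmptyEquiv_apply_tprod]
      simp [Algebra.algebraMap_eq_smul_one]
    | add x y hx hy => rw [map_add, map_add, map_add, hx, hy]
  | succ m ih =>
    rw [List.ofFn_succ, listConv, conv_apply, iterComul, LinearMap.comp_apply,
      LinearMap.comp_apply]
    generalize comul (R := 𝕜) x = X
    induction X with
    | zero => simp
    | add x y hx hy => simp only [map_add, hx, hy]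
    | tmul a b => rw [LinearMap.lTensor_tmul, tensorMulMap_cons, ih, pairMul_tmul]

end Iterated

section ShuffledPower

variable {𝕜 H H' R : Type*} [Field 𝕜] [Ring H] [HopfAlgebra 𝕜 H] [Ring H'] [HopfAlgebra 𝕜 H']
  [Ring R] [Algebra 𝕜 R] {n k : ℕ}

/-- The shuffled product of the factors of the iterated comultiplication, in terms of a chain. -/
theorem shuffled_eq_chain (C : ChainSystem 𝕜 H R n k) (hn : n.Coprime k) (h0 : 0 < n)
    (e : H' ≃ₐ[𝕜] H) (q : Fin (n - 1) → H' →ₗ[𝕜] H') (s : Fin (n - 1) → Slot 𝕜 H' R)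
    (hs : ∀ i y, (s i).hom y = C.j ((i : ℕ) + 1 : ℕ) (e (q i y))) (x : H') :
    e (tensorMul 𝕜 H' (n - 1) (tensorPerm 𝕜 H'
      (sigmaPerm n (-(k : ℤ)) (isCoprime_neg_of_coprime hn))
        (PiTensorProduct.map q (iterComul 𝕜 H' (n - 1) x)))) =
      C.chain (listConv (List.ofFn s) x) := by
  rw [← tensorMulMap_iterComul]
  generalize iterComul 𝕜 H' (n - 1) x = y
  induction y using PiTensorProduct.induction_on with
  | smul_tprod r v =>
    simp only [map_smul]
    rw [PiTensorProduct.map_tprod, tensorPerm_tprod, tensorMul_tprod, tensorMulMap_tprod]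
    simp only [hs]
    rw [C.chain_prod_perm hn h0, map_list_prod, List.map_ofFn]
    rfl
  | add x y hx hy => simp only [map_add, hx, hy]

end ShuffledPower

end HopfTrace

theorem intPow_units {M : Type*} [MonoidWithZero M] (x : Mˣ) (z : ℤ) :
    intPow (x : M) z = ((x ^ z : Mˣ) : M) := by
  cases z with
  | ofNat m => simp [intPow]
  | negSucc m => simp [intPow, zpow_negSucc]

namespace HopfTrace

open Coalgebra HopfAlgebra

/-! ### Powers of the squared antipode and of its conjugate. -/

section Automorphisms

variable {𝕜 H : Type*} [Field 𝕜] [Ring H] [HopfAlgebra 𝕜 H] {T : H →ₗ[𝕜] H}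

/-- The square of the antipode as an algebra automorphism. -/
noncomputable def antipodeSqEquiv (hT : IsAntipodeInv T) : H ≃ₐ[𝕜] H where
  toFun := antipodeSq 𝕜 H
  invFun := T ∘ₗ T
  left_inv := hT.inv_sq
  right_inv := hT.sq_inv
  map_mul' := isAlg_antipodeSq.map_mul
  map_add' := map_add _
  commutes' r := by
    rw [Algebra.algebraMap_eq_smul_one, map_smul, isAlg_antipodeSq.map_one]

/-- The antipode as a unit of the ring of endomorphisms. -/
noncomputable def antipodeUnit (hT : IsAntipodeInv T) : (Module.End 𝕜 H)ˣ :=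
  ⟨antipodeEnd 𝕜 H, T, LinearMap.ext hT.antipode_inv, LinearMap.ext hT.inv_antipode⟩

/-- Automorphisms as linear endomorphisms. -/
def autToEnd (𝕜 H : Type*) [Field 𝕜] [Ring H] [Algebra 𝕜 H] :
    (H ≃ₐ[𝕜] H) →* Module.End 𝕜 H where
  toFun φ := φ.toLinearMap
  map_one' := rfl
  map_mul' _ _ := rfl

theorem antipode_intPow_two_mul (hT : IsAntipodeInv T) (c : ℤ) :
    intPow (antipodeEnd 𝕜 H) (2 * c) = (antipodeSqEquiv hT ^ c).toLinearMap := by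
  have h1 : antipodeUnit hT ^ 2 = (autToEnd 𝕜 H).toHomUnits (antipodeSqEquiv hT) := by
    ext x
    rw [pow_two]
    rfl
  have h2 : antipodeUnit hT ^ (2 * c) =
      (autToEnd 𝕜 H).toHomUnits (antipodeSqEquiv hT ^ c) := by
    rw [zpow_mul, map_zpow, ← h1]
    rfl
  have h3 := intPow_units (antipodeUnit hT) (2 * c)
  rw [h2] at h3
  exact h3

/-- Conjugation by a unit. -/
def conjAut (𝕜 H : Type*) [Field 𝕜] [Ring H] [Algebra 𝕜 H] : Hˣ →* (H ≃ₐ[𝕜] H) where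
  toFun v :=
    { toFun := fun x => v * x * (v⁻¹ : Hˣ)
      invFun := fun x => (v⁻¹ : Hˣ) * x * v
      left_inv := fun x => by simp [mul_assoc]
      right_inv := fun x => by simp [mul_assoc]
      map_mul' := fun x y => by simp [mul_assoc]
      map_add' := fun x y => by rw [mul_add, add_mul]
      commutes' := fun r => by rw [← Algebra.commutes, mul_assoc, Units.mul_inv, mul_one] }
  map_one' := by ext; simp
  map_mul' v w := by ext; simp [mul_assoc]

/-- The action of automorphisms on units. -/
def autUnits (𝕜 H : Type*) [Field 𝕜] [Ring H] [Algebra 𝕜 H] :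
    (H ≃ₐ[𝕜] H) →* MulAut Hˣ where
  toFun φ := Units.mapEquiv φ.toMulEquiv
  map_one' := rfl
  map_mul' _ _ := rfl

/-- The powers of an automorphism that differs from `θ` by a conjugation. -/
theorem exists_zpow_conj (θ ψ : H ≃ₐ[𝕜] H) (w : Hˣ) (hψ : ∀ x, ψ x = w * θ x * (w⁻¹ : Hˣ)) :
    ∃ W : ℤ → Hˣ, W 0 = 1 ∧ (∀ m, (W (m + 1) : H) = W m * (θ ^ m) w) ∧
      ∀ m x, (ψ ^ m) x = W m * (θ ^ m) x * ((W m)⁻¹ : Hˣ) := by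
  -- In the semidirect product of units and automorphisms, W m is the unit component of (w, θ)^m.
  -- This gives the recursion for all integers m at once, and the homomorphism L, (v, φ) ↦
  -- (conjugation by v) ∘ φ, carries powers of p to powers of ψ.
  let p : Hˣ ⋊[autUnits 𝕜 H] (H ≃ₐ[𝕜] H) := ⟨w, θ⟩
  have hr : ∀ m : ℤ, (p ^ m).right = θ ^ m := fun m =>
    map_zpow (SemidirectProduct.rightHom (φ := autUnits 𝕜 H)) p m
  let L : Hˣ ⋊[autUnits 𝕜 H] (H ≃ₐ[𝕜] H) →* (H ≃ₐ[𝕜] H) :=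
    SemidirectProduct.lift (conjAut 𝕜 H) (MonoidHom.id _) (fun g => by
      ext v x
      have : (autUnits 𝕜 H g v : H) * x * ((autUnits 𝕜 H g v)⁻¹ : Hˣ) =
          g v * x * g (v⁻¹ : Hˣ) := rfl
      simpa [conjAut] using this)
  have hL : L p = ψ := by
    ext x
    rw [hψ]
    rfl
  refine ⟨fun m => (p ^ m).left, by simp, fun m => ?_, fun m x => ?_⟩
  · change (((p ^ (m + 1)).left : Hˣ) : H) = (p ^ m).left * (θ ^ m) w
    rw [zpow_add_one, SemidirectProduct.mul_left, hr]
    rfl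
  · rw [← hL, ← map_zpow, ← hr]
    rfl

end Automorphisms

/-! ### The shuffled Sweedler power of the twist. -/

section Twist

variable {𝕜 H R : Type*} [Field 𝕜] [Ring H] [HopfAlgebra 𝕜 H] [Ring R] [Algebra 𝕜 R]
  (F : TwoCocycle 𝕜 H)

/-- The identity, as an algebra isomorphism from the twist to `H`. -/
def twistEquiv : DrinfeldTwist F ≃ₐ[𝕜] H where
  toFun x := x
  invFun x := x
  left_inv _ := rfl
  right_inv _ := rfl
  map_mul' _ _ := rfl
  map_add' _ _ := rfl
  commutes' _ := rfl

theorem twistEquiv_antipode (x : DrinfeldTwist F) :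
    twistEquiv F (antipode 𝕜 x) = F.u * antipode 𝕜 (twistEquiv F x) * F.uInv := rfl

theorem map_twistEquiv_comul (x : DrinfeldTwist F) :
    TensorProduct.map (twistEquiv F).toLinearMap (twistEquiv F).toLinearMap (comul (R := 𝕜) x) =
      F.val * comul (R := 𝕜) (twistEquiv F x) * F.inv := by
  have h : ∀ X : H ⊗[𝕜] H, TensorProduct.map (LinearMap.id : H →ₗ[𝕜] H) LinearMap.id X = X :=
    fun X => by simp
  exact h _

theorem pairMul_twist (f g : DrinfeldTwist F →ₗ[𝕜] R) (f' g' : H →ₗ[𝕜] R)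
    (hf : ∀ x, f x = f' (twistEquiv F x)) (hg : ∀ x, g x = g' (twistEquiv F x))
    (x : DrinfeldTwist F) : pairMul f g (comul x) =
      pairMul f' g' (F.val * comul (R := 𝕜) (twistEquiv F x) * F.inv) := by
  rw [← map_twistEquiv_comul]
  generalize comul (R := 𝕜) x = X
  induction X with
  | zero => simp
  | add x y hx hy => simp only [map_add, hx, hy]
  | tmul a b => simp [hf, hg]

/-- The iterated convolution over the twist, of maps that are conjugated by the units of slots. -/
theorem listConv_twist {l : List (Slot 𝕜 H R)} (hl : IsIndep l)
    {l' : List (Slot 𝕜 (DrinfeldTwist F) R)}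
    (h : List.Forall₂ (fun (s' : Slot 𝕜 (DrinfeldTwist F) R) (s : Slot 𝕜 H R) =>
      ∀ y, s'.hom y = s.unit * s.hom (twistEquiv F y) * (s.unit⁻¹ : Rˣ)) l' l)
    (x : DrinfeldTwist F) :
    listConv l' x = listCocycle F l * listConv l (twistEquiv F x) * listCocycleInv F l := by
  induction h generalizing x with
  | nil =>
    simp only [listConv, listCocycle, listCocycleInv, one_mul, mul_one]
    rfl
  | @cons s' s l' l hs h ih =>
    have hl' := hl.tail
    have hi := hl.listIndep_cons
    have hsm := List.mem_singleton_self s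
    let f' : H →ₗ[𝕜] R := LinearMap.mulLeftRight 𝕜 ((s.unit : R), ((s.unit⁻¹ : Rˣ) : R)) ∘ₗ s.hom
    let g' : H →ₗ[𝕜] R :=
      LinearMap.mulLeftRight 𝕜 (listCocycle F l, listCocycleInv F l) ∘ₗ listConv l
    have key : ∀ X : H ⊗[𝕜] H, pairMul f' g' X =
        s.unit * listCocycle F l * pairMul s.hom (listConv l) X *
          (listCocycleInv F l * (s.unit⁻¹ : Rˣ)) := by
      intro X
      induction X with
      | zero => simp
      | add x y hx hy => simp only [map_add, hx, hy, mul_add, add_mul]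
      | tmul a b =>
        have c1 := (hi.cocycle_commutesWith F hsm).1 a
        have c2 : Commute ((s.unit⁻¹ : Rˣ) : R) (listCocycle F l) :=
          (hi.cocycle_commutesWith F hsm).2.units_inv_left
        have c3 : Commute ((s.unit⁻¹ : Rˣ) : R) (listConv l b) :=
          (hi.conv_commutesWith hsm b).2.units_inv_left
        have c4 : Commute ((s.unit⁻¹ : Rˣ) : R) (listCocycleInv F l) :=
          (hi.cocycleInv_commutesWith F hsm).2.units_inv_left
        simp only [pairMul_tmul, f', g', LinearMap.comp_apply, LinearMap.mulLeftRight_apply]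
        have c5 := ((c2.mul_right c3).mul_right c4)
        calc _ = (s.unit : R) * s.hom a * (((s.unit⁻¹ : Rˣ) : R) *
              (listCocycle F l * listConv l b * listCocycleInv F l)) := by
              simp only [mul_assoc]
          _ = s.unit * (s.hom a * listCocycle F l) * listConv l b * listCocycleInv F l *
              (s.unit⁻¹ : Rˣ) := by rw [c5.eq]; simp only [mul_assoc]
          _ = _ := by rw [c1.eq]; simp only [mul_assoc]
    have hcc := hl.conv_hom
    rw [listConv, conv_apply, pairMul_twist F s'.hom (listConv l') f' g' hs (ih hl'), key,
      pairMul_mul (hl.1 s (by simp)) (isAlg_listConv hl') hcc,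
      pairMul_mul (hl.1 s (by simp)) (isAlg_listConv hl') hcc, listCocycle, listCocycleInv,
      listConv, conv_apply]
    simp only [mul_assoc]

instance [Module.Finite 𝕜 H] : Module.Finite 𝕜 (DrinfeldTwist F) :=
  Module.Finite.equiv (twistEquiv F).symm.toLinearEquiv

/-- The inverse of the antipode of the twist. -/
theorem isAntipodeInv_twist [Module.Finite 𝕜 H] {T : H →ₗ[𝕜] H} (hT : IsAntipodeInv T) :
    ∃ T' : DrinfeldTwist F →ₗ[𝕜] DrinfeldTwist F, IsAntipodeInv T' := by
  refine ⟨(twistEquiv F).symm.toLinearMap ∘ₗ T ∘ₗ LinearMap.mulLeftRight 𝕜 (F.uInv, F.u) ∘ₗ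
    (twistEquiv F).toLinearMap, fun x => ?_, fun x => ?_⟩
  · apply (twistEquiv F).injective
    simp only [LinearMap.comp_apply, AlgEquiv.toLinearMap_apply, LinearMap.mulLeftRight_apply]
    rw [twistEquiv_antipode, AlgEquiv.apply_symm_apply, hT.antipode_inv, ← mul_assoc, ← mul_assoc,
      F.u_mul_uInv, one_mul, mul_assoc, F.u_mul_uInv, mul_one]
  · apply (twistEquiv F).injective
    simp only [LinearMap.comp_apply, AlgEquiv.toLinearMap_apply, LinearMap.mulLeftRight_apply]
    rw [twistEquiv_antipode, AlgEquiv.apply_symm_apply, ← mul_assoc, ← mul_assoc,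
      F.uInv_mul_u, one_mul, mul_assoc, F.uInv_mul_u, mul_one, hT.inv_antipode]

theorem ofFn_eq_map_range' {α : Type*} (m : ℕ) (f : ℕ → α) :
    List.ofFn (fun i : Fin m => f (i + 1)) = (List.range' 1 m).map f := by
  apply List.ext_getElem
  · simp
  · intro i h1 h2
    simp [add_comm]

/-- The trace of the antipode composed with the shuffled Sweedler power is invariant under
Drinfeld twists. -/
theorem trace_shuffledSweedlerPower_twist [Module.Finite 𝕜 H] {T : H →ₗ[𝕜] H}
    (hT : IsAntipodeInv T) (n k : ℕ) (hkn : k < n) (hcop : n.Coprime k)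
    (hodd : Odd (n - k)) :
    LinearMap.trace 𝕜 H (antipodeEnd 𝕜 H ∘ₗ shuffledSweedlerPower 𝕜 H n k hkn hcop) =
      LinearMap.trace 𝕜 (DrinfeldTwist F) (antipodeEnd 𝕜 (DrinfeldTwist F) ∘ₗ
        shuffledSweedlerPower 𝕜 (DrinfeldTwist F) n k hkn hcop) := by
  have hn : 0 < n := by omega
  have : NeZero n := ⟨hn.ne'⟩
  obtain ⟨T', hT'⟩ := isAntipodeInv_twist F hT
  set c := exponentSeq n k hkn hcop with hc
  let C := tensorChain hcop 𝕜 H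
  let wU : Hˣ := ⟨F.w, F.wInv, F.w_mul_wInv, F.wInv_mul_w⟩
  let θ := antipodeSqEquiv hT
  -- The automorphism S_F², carried over to H; it is conjugation by w composed with S².
  let ψ := AlgEquiv.autCongr (twistEquiv F) (antipodeSqEquiv hT')
  obtain ⟨W, hW0, hW, hWψ⟩ := exists_zpow_conj θ ψ wU (fun x => F.twistAntipode_sq x)
  have hψ : ∀ (m : ℤ) y, twistEquiv F ((antipodeSqEquiv hT' ^ m) y) =
      (ψ ^ m) (twistEquiv F y) := by
    intro m y
    rw [← map_zpow]
    rfl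
  have key := C.trace_invariance hT F (θ := θ) (fun _ => rfl) hW0 hW hkn hodd
    (exponentSeq_spec n k hkn hcop)
  rw [← hc] at key
  set l0 := (List.range' 1 (n - 1)).map (C.expSlot θ W c) with hl0
  have hl0' : List.ofFn (fun i : Fin (n - 1) => C.expSlot θ W c (i + 1)) = l0 :=
    ofFn_eq_map_range' _ _
  have h1 : antipodeEnd 𝕜 H ∘ₗ shuffledSweedlerPower 𝕜 H n k hkn hcop =
      antipode 𝕜 ∘ₗ C.chain ∘ₗ listConv l0 := by
    ext x
    have := shuffled_eq_chain C hcop hn (AlgEquiv.refl : H ≃ₐ[𝕜] H)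
      (fun i => intPow (antipodeEnd 𝕜 H) (2 * c (((i : ℕ) + 1 : ℕ) : ZMod n)))
      (fun i => C.expSlot θ W c (i + 1))
      (fun i y => by rw [antipode_intPow_two_mul hT]; rfl) x
    rw [hl0'] at this
    exact congrArg (antipode 𝕜) this
  have h2 : (twistEquiv F).toLinearEquiv.conj (antipodeEnd 𝕜 (DrinfeldTwist F) ∘ₗ
        shuffledSweedlerPower 𝕜 (DrinfeldTwist F) n k hkn hcop) =
      LinearMap.mulLeftRight 𝕜 (F.u, F.uInv) ∘ₗ antipode 𝕜 ∘ₗ C.chain ∘ₗ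
        LinearMap.mulLeftRight 𝕜 (listCocycle F l0, listCocycleInv F l0) ∘ₗ listConv l0 := by
    ext x
    -- Only the maps of these slots are used; their units are arbitrary. The conjugating units sit
    -- in the list `l0` over H.
    let s' : ℕ → Slot 𝕜 (DrinfeldTwist F) (⨂[𝕜] (_ : Fin n), H) := fun i =>
      ⟨(C.j i).toLinearMap ∘ₗ (twistEquiv F).toLinearMap ∘ₗ
        (antipodeSqEquiv hT' ^ c i).toLinearMap, 1⟩
    have e1 := shuffled_eq_chain C hcop hn (twistEquiv F)
      (fun i => intPow (antipodeEnd 𝕜 (DrinfeldTwist F)) (2 * c (((i : ℕ) + 1 : ℕ) : ZMod n)))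
      (fun i => s' (i + 1))
      (fun i y => by rw [antipode_intPow_two_mul hT']; rfl) ((twistEquiv F).symm x)
    have e2 := listConv_twist F (l := l0) (l' := (List.range' 1 (n - 1)).map s')
      (C.isIndep_expSlot 1 (n - 1) (by omega)) (by
        rw [hl0, List.forall₂_map_left_iff, List.forall₂_map_right_iff, List.forall₂_same]
        intro i _ y
        have := hψ (c i) y
        simp only [s', LinearMap.comp_apply, AlgHom.toLinearMap_apply,
          AlgEquiv.toLinearMap_apply, this, hWψ, map_mul]
        rfl) ((twistEquiv F).symm x)
    rw [ofFn_eq_map_range' (n - 1) s', e2, AlgEquiv.apply_symm_apply] at e1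
    have e3 : ∀ y, (twistEquiv F) (antipodeEnd 𝕜 (DrinfeldTwist F) y) =
      F.u * antipode 𝕜 (twistEquiv F y) * F.uInv := fun y => rfl
    rw [LinearEquiv.conj_apply_apply]
    refine (e3 _).trans ?_
    exact congrArg (fun z => F.u * antipode 𝕜 z * F.uInv) e1
  rw [h1, key, ← h2, LinearMap.trace_conj']

end Twist

end HopfTrace

namespace HopfTrace

open Coalgebra HopfAlgebra

/-! ### The two actions of the dual on a Hopf algebra. -/

section Hit

variable {𝕜 H : Type*} [Field 𝕜] [Ring H] [HopfAlgebra 𝕜 H]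

/-- A functional as a map to the scalars in `H`. -/
noncomputable def scal (f : Module.Dual 𝕜 H) : H →ₗ[𝕜] H := Algebra.linearMap 𝕜 H ∘ₗ f

theorem scal_apply (f : Module.Dual 𝕜 H) (x : H) : scal f x = f x • (1 : H) := by
  simp [scal, Algebra.algebraMap_eq_smul_one]

/-- `a ⊗ b ↦ f(b) a`. -/
noncomputable def contrRight (f : Module.Dual 𝕜 H) : H ⊗[𝕜] H →ₗ[𝕜] H :=
  (TensorProduct.rid 𝕜 H).toLinearMap ∘ₗ f.lTensor H

/-- `a ⊗ b ↦ f(a) b`. -/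
noncomputable def contrLeft (f : Module.Dual 𝕜 H) : H ⊗[𝕜] H →ₗ[𝕜] H :=
  (TensorProduct.lid 𝕜 H).toLinearMap ∘ₗ f.rTensor H

@[simp] theorem contrRight_tmul (f : Module.Dual 𝕜 H) (a b : H) :
    contrRight f (a ⊗ₜ b) = f b • a := by simp [contrRight]

@[simp] theorem contrLeft_tmul (f : Module.Dual 𝕜 H) (a b : H) :
    contrLeft f (a ⊗ₜ b) = f a • b := by simp [contrLeft]

theorem hitLeft_apply (f : Module.Dual 𝕜 H) (x : H) : hitLeft f x = contrRight f (comul x) := rfl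

theorem hitRight_apply (f : Module.Dual 𝕜 H) (x : H) : hitRight f x = contrLeft f (comul x) := rfl

theorem conv_scal (p : H →ₗ[𝕜] H) (f : Module.Dual 𝕜 H) : conv p (scal f) = p ∘ₗ hitLeft f := by
  ext x
  rw [conv_apply, LinearMap.comp_apply, hitLeft_apply]
  generalize comul (R := 𝕜) x = X
  induction X with
  | zero => simp
  | add x y hx hy => simp only [map_add, hx, hy]
  | tmul a b => simp [scal_apply]

theorem scal_conv (p : H →ₗ[𝕜] H) (f : Module.Dual 𝕜 H) : conv (scal f) p = p ∘ₗ hitRight f := by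
  ext x
  rw [conv_apply, LinearMap.comp_apply, hitRight_apply]
  generalize comul (R := 𝕜) x = X
  induction X with
  | zero => simp
  | add x y hx hy => simp only [map_add, hx, hy]
  | tmul a b => simp [scal_apply]

/-- Written as convolutions with scalar-valued maps, the two actions satisfy their composition and
commutation rules by associativity of convolution. -/
theorem hitLeft_eq_conv (f : Module.Dual 𝕜 H) : hitLeft f = conv LinearMap.id (scal f) := by
  rw [conv_scal, LinearMap.id_comp]

theorem hitRight_eq_conv (f : Module.Dual 𝕜 H) : hitRight f = conv (scal f) LinearMap.id := by
  rw [scal_conv, LinearMap.id_comp]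

theorem hitLeft_comp_hitLeft (f g : Module.Dual 𝕜 H) :
    hitLeft g ∘ₗ hitLeft f = hitLeft (g ∘ₗ hitLeft f) := by
  rw [hitLeft_eq_conv (g ∘ₗ hitLeft f), hitLeft_eq_conv g, ← conv_scal, conv_assoc, conv_scal]
  rfl

theorem hitRight_comp_hitRight (f g : Module.Dual 𝕜 H) :
    hitRight g ∘ₗ hitRight f = hitRight (g ∘ₗ hitRight f) := by
  rw [hitRight_eq_conv (g ∘ₗ hitRight f), hitRight_eq_conv g, ← scal_conv, ← conv_assoc,
    scal_conv]
  rfl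

theorem hitRight_comp_hitLeft (f g : Module.Dual 𝕜 H) :
    hitRight g ∘ₗ hitLeft f = hitLeft f ∘ₗ hitRight g := by
  rw [← conv_scal, hitRight_eq_conv, conv_assoc, ← hitLeft_eq_conv, scal_conv,
    ← hitRight_eq_conv]

theorem counit_hitLeft (f : Module.Dual 𝕜 H) (x : H) :
    counit (R := 𝕜) (hitLeft f x) = f x := by
  have h1 : conv (convUnit 𝕜 H H) (scal f) = convUnit 𝕜 H H ∘ₗ hitLeft f := conv_scal _ f
  rw [unit_conv] at h1
  have h2 := congrArg (counit (R := 𝕜)) (LinearMap.congr_fun h1 x)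
  simpa [scal, convUnit] using h2.symm

theorem hitRight_counit : hitRight (counit : H →ₗ[𝕜] 𝕜) = LinearMap.id := by
  rw [hitRight_eq_conv]
  exact unit_conv _

theorem dual_hitLeft (f ψ : Module.Dual 𝕜 H) (x : H) : ψ (hitLeft f x) = f (hitRight ψ x) := by
  rw [hitLeft_apply, hitRight_apply]
  generalize comul (R := 𝕜) x = X
  induction X with
  | zero => simp
  | add x y hx hy => simp only [map_add, hx, hy]
  | tmul a b => simp [mul_comm]

variable {ι : Type*} [Fintype ι] (b : Module.Basis ι 𝕜 H)

theorem sum_contrRight_tmul (X : H ⊗[𝕜] H) :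
    ∑ j, contrRight (b.coord j) X ⊗ₜ[𝕜] b j = X := by
  induction X with
  | zero => simp
  | add x y hx hy => simp only [map_add, TensorProduct.add_tmul, Finset.sum_add_distrib, hx, hy]
  | tmul c d =>
    simp only [contrRight_tmul, TensorProduct.smul_tmul, ← TensorProduct.tmul_sum,
      Module.Basis.coord_apply, b.sum_repr]

theorem sum_tmul_contrLeft (X : H ⊗[𝕜] H) :
    ∑ j, b j ⊗ₜ[𝕜] contrLeft (b.coord j) X = X := by
  induction X with
  | zero => simp
  | add x y hx hy => simp only [map_add, TensorProduct.tmul_add, Finset.sum_add_distrib, hx, hy]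
  | tmul c d =>
    simp only [contrLeft_tmul, ← TensorProduct.smul_tmul, ← TensorProduct.sum_tmul,
      Module.Basis.coord_apply, b.sum_repr]

theorem comul_eq_sum_left (x : H) : comul (R := 𝕜) x = ∑ j, hitLeft (b.coord j) x ⊗ₜ[𝕜] b j :=
  (sum_contrRight_tmul b _).symm

theorem comul_eq_sum_right (x : H) : comul (R := 𝕜) x = ∑ j, b j ⊗ₜ[𝕜] hitRight (b.coord j) x :=
  (sum_tmul_contrLeft b _).symm

end Hit

section Embeddings

variable (𝕜 H : Type*) [Field 𝕜] [Ring H] [HopfAlgebra 𝕜 H]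

/-- `a ↦ a ⊗ 1` -/
noncomputable def inl : H →ₗ[𝕜] H ⊗[𝕜] H :=
  (Algebra.TensorProduct.includeLeft : H →ₐ[𝕜] H ⊗[𝕜] H).toLinearMap

/-- `a ↦ 1 ⊗ a` -/
noncomputable def inr : H →ₗ[𝕜] H ⊗[𝕜] H :=
  (Algebra.TensorProduct.includeRight : H →ₐ[𝕜] H ⊗[𝕜] H).toLinearMap

variable {𝕜 H}

@[simp] theorem inl_apply (a : H) : inl 𝕜 H a = a ⊗ₜ 1 := rfl
@[simp] theorem inr_apply (a : H) : inr 𝕜 H a = 1 ⊗ₜ a := rfl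

theorem isAlg_inl : IsAlg (inl 𝕜 H) := isAlg_algHom _
theorem isAlg_inr : IsAlg (inr 𝕜 H) := isAlg_algHom _

theorem conv_inr_inl_antipode : conv (inr 𝕜 H ∘ₗ antipode 𝕜) (inl 𝕜 H ∘ₗ antipode 𝕜) =
    comul ∘ₗ antipode 𝕜 := by
  ext x
  rw [conv_apply, LinearMap.comp_apply, comul_antipode]
  generalize comul (R := 𝕜) x = X
  induction X with
  | zero => simp
  | add x y hx hy => simp only [map_add, hx, hy]
  | tmul a b => simp

/-- `∑ (1 ⊗ h₁) Δ(S(h₂)) = S(h) ⊗ 1` -/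
theorem conv_inr_comul_antipode :
    conv (inr 𝕜 H) (comul ∘ₗ antipode 𝕜) = inl 𝕜 H ∘ₗ antipode 𝕜 := by
  rw [← conv_inr_inl_antipode, ← conv_assoc, self_conv_antipode isAlg_inr, unit_conv]

/-- `∑ Δ(S(h₁)) (h₂ ⊗ 1) = 1 ⊗ S(h)` -/
theorem conv_comul_antipode_inl :
    conv (comul ∘ₗ antipode 𝕜) (inl 𝕜 H) = inr 𝕜 H ∘ₗ antipode 𝕜 := by
  rw [← conv_inr_inl_antipode, conv_assoc, antipode_conv_self isAlg_inl, conv_unit]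

end Embeddings

/-! ### Existence of a nonzero left integral on the Hopf algebra. -/

section Existence

variable {𝕜 H : Type*} [Field 𝕜] [Ring H] [HopfAlgebra 𝕜 H]

/-- The functional `x ↦ Tr(h ↦ f ⇀ (x S²(h)))`, which is a left integral. -/
noncomputable def traceIntegral (f : Module.Dual 𝕜 H) : Module.Dual 𝕜 H where
  toFun x := LinearMap.trace 𝕜 H (hitLeft f ∘ₗ LinearMap.mulLeft 𝕜 x ∘ₗ antipodeSq 𝕜 H)
  map_add' x y := by
    rw [← map_add]
    congr 1
    ext h
    simp [add_mul]
  map_smul' c x := by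
    rw [RingHom.id_apply, ← map_smul]
    congr 1
    ext h
    simp

theorem traceIntegral_apply (f : Module.Dual 𝕜 H) (x : H) : traceIntegral f x =
    LinearMap.trace 𝕜 H (hitLeft f ∘ₗ LinearMap.mulLeft 𝕜 x ∘ₗ antipodeSq 𝕜 H) := rfl

variable {ι : Type*} [Fintype ι]

/-- The identity S(h₂) S²(h₁) = ε(h) writes the rank-one map h ↦ ε(h) (f ⇀ x), whose trace is f(x),
as a sum of maps whose traces are values of `traceIntegral`, by cyclicity. For f = ε and x = 1 the
sum is 1, so one of these functionals is nonzero. -/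
theorem sum_traceIntegral (b : Module.Basis ι 𝕜 H) (f : Module.Dual 𝕜 H) (x : H) :
    ∑ j, traceIntegral (b.coord j ∘ₗ hitLeft f) (x * antipode 𝕜 (b j)) = f x := by
  have := Module.Free.of_basis b
  have := Module.Finite.of_basis b
  have h1 : (counit (R := 𝕜) (A := H)).smulRight (hitLeft f x) =
      ∑ j, (hitLeft f ∘ₗ LinearMap.mulLeft 𝕜 (x * antipode 𝕜 (b j)) ∘ₗ antipodeSq 𝕜 H) ∘ₗ
        hitLeft (b.coord j) := by
    ext h
    have h2 : antipode 𝕜 (TwoCocycle.sandwichLeft 1 (comul (R := 𝕜) h)) =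
        ∑ j, antipode 𝕜 (b j) * antipodeSq 𝕜 H (hitLeft (b.coord j) h) := by
      conv_lhs => rw [comul_eq_sum_left b h]
      simp [TwoCocycle.sandwichLeft, antipode_mul_antidistrib, antipodeSq_apply]
    rw [TwoCocycle.sandwichLeft_comul, map_smul, antipode_one] at h2
    have h3 := congrArg (fun y => hitLeft f (x * y)) h2
    simp only [mul_smul_comm, mul_one, map_smul, Finset.mul_sum, map_sum] at h3
    simp only [LinearMap.smulRight_apply, h3, LinearMap.sum_apply, LinearMap.comp_apply,
      LinearMap.mulLeft_apply, mul_assoc]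
  have h4 := congrArg (LinearMap.trace 𝕜 H) h1
  rw [LinearMap.trace_smulRight, counit_hitLeft, map_sum] at h4
  rw [h4]
  refine Finset.sum_congr rfl fun j _ => ?_
  rw [LinearMap.trace_comp_comm', ← LinearMap.comp_assoc, hitLeft_comp_hitLeft]
  rfl

/-- The left integral property after pairing with ψ, through `dual_hitLeft`. The right action is
pulled out of the trace, commutes with the left action of f, and is returned by cyclicity to the
other side, where the antipode axiom reduces it to ψ(1). -/
theorem traceIntegral_hitRight (b : Module.Basis ι 𝕜 H) (f ψ : Module.Dual 𝕜 H) (x : H) :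
    traceIntegral f (hitRight ψ x) = ψ 1 * traceIntegral f x := by
  have := Module.Free.of_basis b
  have := Module.Finite.of_basis b
  let ψ' : ι → Module.Dual 𝕜 H := fun j => ψ ∘ₗ LinearMap.mulRight 𝕜 (antipode 𝕜 (b j))
  let N : Module.End 𝕜 H := hitLeft f ∘ₗ LinearMap.mulLeft 𝕜 x ∘ₗ antipodeSq 𝕜 H
  have h1 : ∀ h, hitRight ψ x * antipodeSq 𝕜 H h =
      ∑ j, hitRight (ψ' j) (x * antipodeSq 𝕜 H (hitRight (b.coord j) h)) := by
    intro h
    -- Flipping ∑ (1 ⊗ h₁) Δ(S(h₂)) = S(h) ⊗ 1 gives ∑ Δ(S²(h₂)) (S(h₁) ⊗ 1) = 1 ⊗ S²(h). It moves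
    -- S²(h) inside a coproduct.
    have e1 := congrArg (flipAntipode 𝕜 H) (LinearMap.congr_fun conv_inr_comul_antipode h)
    rw [conv_apply, comul_eq_sum_right b h] at e1
    simp only [map_sum, pairMul_tmul, flipAntipode_mul, LinearMap.comp_apply, inl_apply,
      inr_apply, flipAntipode_tmul, antipode_one, ← comul_antipode_eq_flip] at e1
    have e2 : ∀ X : H ⊗[𝕜] H, ∀ y, contrLeft ψ X * y = contrLeft ψ (X * (1 ⊗ₜ y)) := by
      intro X y
      induction X with
      | zero => simp
      | add x y hx hy => simp only [map_add, add_mul, hx, hy]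
      | tmul c d => simp
    have e3 : ∀ X : H ⊗[𝕜] H, ∀ j, contrLeft ψ (X * (antipode 𝕜 (b j) ⊗ₜ 1)) =
        contrLeft (ψ' j) X := by
      intro X j
      induction X with
      | zero => simp
      | add x y hx hy => simp only [map_add, add_mul, hx, hy]
      | tmul c d => simp [ψ']
    rw [hitRight_apply, e2, antipodeSq_apply, ← e1, Finset.mul_sum, map_sum]
    refine Finset.sum_congr rfl fun j _ => ?_
    rw [← mul_assoc, ← Bialgebra.comul_mul, e3]
    rfl
  have h2 : hitLeft f ∘ₗ LinearMap.mulLeft 𝕜 (hitRight ψ x) ∘ₗ antipodeSq 𝕜 H =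
      ∑ j, hitRight (ψ' j) ∘ₗ (N ∘ₗ hitRight (b.coord j)) := by
    ext h
    simp only [LinearMap.comp_apply, LinearMap.mulLeft_apply, h1, map_sum, LinearMap.sum_apply, N]
    refine Finset.sum_congr rfl fun j _ => ?_
    exact (LinearMap.congr_fun (hitRight_comp_hitLeft f (ψ' j)) _).symm
  -- Summing over the basis rebuilds ψ(y₁ S(y₂)), so the composite is ψ(1) times the identity.
  have h3 : ∑ j, hitRight (b.coord j) ∘ₗ hitRight (ψ' j) = ψ 1 • LinearMap.id := by
    have e : ∑ j, b.coord j ∘ₗ hitRight (ψ' j) = ψ 1 • counit := by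
      ext y
      have e1 : ∀ X : H ⊗[𝕜] H, ∑ j, b.coord j (contrLeft (ψ' j) X) =
          ψ (TwoCocycle.sandwichRight 1 X) := by
        intro X
        induction X with
        | zero => simp
        | add x y hx hy => simp only [map_add, Finset.sum_add_distrib, hx, hy]
        | tmul c d =>
          have e2 : ψ (c * antipode 𝕜 (∑ j, b.repr d j • b j)) =
              ∑ j, b.repr d j * ψ (c * antipode 𝕜 (b j)) := by
            simp only [map_sum, map_smul, Finset.mul_sum, mul_smul_comm, smul_eq_mul]
          rw [b.sum_repr] at e2
          simp only [contrLeft_tmul, map_smul, smul_eq_mul, TwoCocycle.sandwichRight,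
            LinearMap.comp_apply, LinearMap.lTensor_tmul, LinearMap.mul'_apply,
            LinearMap.mulLeft_apply, one_mul, e2, ψ', LinearMap.mulRight_apply,
            Module.Basis.coord_apply]
          exact Finset.sum_congr rfl fun j _ => mul_comm _ _
      have e3 := e1 (comul y)
      rw [TwoCocycle.sandwichRight_comul, map_smul, smul_eq_mul, mul_comm] at e3
      simpa [LinearMap.sum_apply, hitRight_apply] using e3
    have e4 : ∀ χ : ι → Module.Dual 𝕜 H, ∑ j, hitRight (χ j) = hitRight (∑ j, χ j) := by
      intro χ
      ext y
      rw [hitRight_apply, LinearMap.sum_apply]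
      simp only [hitRight_apply]
      generalize comul (R := 𝕜) y = X
      induction X with
      | zero => simp
      | add x y hx hy => simp only [map_add, Finset.sum_add_distrib, hx, hy]
      | tmul c d => simp [LinearMap.sum_apply, Finset.sum_smul]
    simp only [hitRight_comp_hitRight, e4, e]
    rw [← hitRight_counit]
    ext y
    simp only [LinearMap.smul_apply, hitRight_apply]
    generalize comul (R := 𝕜) y = X
    induction X with
    | zero => simp
    | add x y hx hy => simp only [map_add, smul_add, hx, hy]
    | tmul c d => simp [smul_smul]
  rw [traceIntegral_apply, h2, map_sum]
  have h4 : ∀ j, LinearMap.trace 𝕜 H (hitRight (ψ' j) ∘ₗ (N ∘ₗ hitRight (b.coord j))) =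
      LinearMap.trace 𝕜 H (N ∘ₗ (hitRight (b.coord j) ∘ₗ hitRight (ψ' j))) := by
    intro j
    rw [LinearMap.trace_comp_comm', LinearMap.comp_assoc]
  simp only [h4]
  rw [← map_sum]
  have h5 : ∑ j, N ∘ₗ (hitRight (b.coord j) ∘ₗ hitRight (ψ' j)) = ψ 1 • N := by
    have := congrArg (fun Z => N ∘ₗ Z) h3
    simp only [LinearMap.comp_smul, LinearMap.comp_id] at this
    rw [← this]
    ext y
    simp [LinearMap.sum_apply]
  rw [h5, map_smul]
  rfl

theorem exists_left_integral [Module.Finite 𝕜 H] :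
    ∃ l : Module.Dual 𝕜 H, l ≠ 0 ∧ ∀ x, hitLeft l x = l x • (1 : H) := by
  let b := Module.finBasis 𝕜 H
  have h1 := sum_traceIntegral b counit (1 : H)
  rw [Bialgebra.counit_one] at h1
  obtain ⟨j, -, hj⟩ := Finset.exists_ne_zero_of_sum_ne_zero
    (h1.trans_ne (one_ne_zero : (1 : 𝕜) ≠ 0))
  refine ⟨traceIntegral (b.coord j ∘ₗ hitLeft counit), fun h => hj (by rw [h]; rfl), fun x => ?_⟩
  rw [← sub_eq_zero, ← Module.forall_dual_apply_eq_zero_iff 𝕜]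
  intro ψ
  rw [map_sub, dual_hitLeft, traceIntegral_hitRight b, map_smul, smul_eq_mul, mul_comm, sub_self]

end Existence

end HopfTrace

namespace HopfTrace

open Coalgebra HopfAlgebra

/-! ### Nondegeneracy of an integral and bijectivity of the antipode. -/

section LeftIntegral

variable {𝕜 H : Type*} [Field 𝕜] [Ring H] [HopfAlgebra 𝕜 H] {l : Module.Dual 𝕜 H}

theorem contrRight_mul_inl (f : Module.Dual 𝕜 H) (X : H ⊗[𝕜] H) (a : H) :
    contrRight f (X * (a ⊗ₜ 1)) = contrRight f X * a := by
  induction X with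
  | zero => simp
  | add x y hx hy => simp only [map_add, add_mul, hx, hy]
  | tmul c d => simp

/-- `∑ x₁ l(x₂ S(h)) = ∑ l(x S(h₁)) h₂` for a left integral `l`. -/
theorem contrRight_comul_mul_antipode (hl : ∀ x, hitLeft l x = l x • (1 : H)) (x h : H) :
    contrRight l (comul x * (1 ⊗ₜ antipode 𝕜 h)) =
      hitRight (l ∘ₗ LinearMap.mulLeft 𝕜 x ∘ₗ antipode 𝕜) h := by
  have h1 : ∀ X : H ⊗[𝕜] H, contrRight l (comul x * pairMul (comul ∘ₗ antipode 𝕜) (inl 𝕜 H) X) =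
      contrLeft (l ∘ₗ LinearMap.mulLeft 𝕜 x ∘ₗ antipode 𝕜) X := by
    intro X
    induction X with
    | zero => simp
    | add x y hx hy => simp only [map_add, mul_add, hx, hy]
    | tmul c d =>
      rw [pairMul_tmul, inl_apply, LinearMap.comp_apply, ← mul_assoc, ← Bialgebra.comul_mul,
        contrRight_mul_inl, ← hitLeft_apply, hl]
      simp
  have h2 := LinearMap.congr_fun (conv_comul_antipode_inl (𝕜 := 𝕜) (H := H)) h
  rw [conv_apply] at h2
  rw [hitRight_apply, ← h1, h2]
  rfl

/-- The elements h with l(x S(h)) = 0 for all x are stable under the actions f ⇀ h, and the counit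
vanishes on them. Hence φ(h) = ε(φ ⇀ h) = 0 for every functional φ. -/
theorem eq_zero_of_left_integral [Module.Finite 𝕜 H] (hl0 : l ≠ 0)
    (hl : ∀ x, hitLeft l x = l x • (1 : H)) {h : H} (hh : ∀ x, l (x * antipode 𝕜 h) = 0) :
    h = 0 := by
  have hK : ∀ (f : Module.Dual 𝕜 H) (h : H), (∀ x, l (x * antipode 𝕜 h) = 0) →
      ∀ x, l (x * antipode 𝕜 (hitLeft f h)) = 0 := by
    intro f h hh x
    have h1 : ∀ X : H ⊗[𝕜] H, contrRight l (X * (1 ⊗ₜ antipode 𝕜 h)) = 0 := by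
      intro X
      induction X with
      | zero => simp
      | add x y hx hy => simp only [map_add, add_mul, hx, hy, add_zero]
      | tmul c d => simp [hh]
    have h2 := congrArg f (contrRight_comul_mul_antipode hl x h)
    rw [h1, map_zero, ← dual_hitLeft] at h2
    exact h2.symm
  -- Expand l(x) ε(h) as ∑ l(x S²(h₂) S(h₁)); every term vanishes by the stability `hK`, while l(x)
  -- can be chosen nonzero.
  have hε : ∀ h : H, (∀ x, l (x * antipode 𝕜 h) = 0) → counit (R := 𝕜) h = 0 := by
    intro h hh
    obtain ⟨x, hx⟩ : ∃ x, l x ≠ 0 := by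
      by_contra! h
      exact hl0 (LinearMap.ext h)
    have h1 : antipode 𝕜 (TwoCocycle.sandwichRight 1 (comul (R := 𝕜) h)) =
        ∑ j, antipodeSq 𝕜 H (Module.finBasis 𝕜 H j) *
          antipode 𝕜 (hitLeft ((Module.finBasis 𝕜 H).coord j) h) := by
      conv_lhs => rw [comul_eq_sum_left (Module.finBasis 𝕜 H) h]
      simp [TwoCocycle.sandwichRight, antipode_mul_antidistrib, antipodeSq_apply]
    rw [TwoCocycle.sandwichRight_comul, map_smul, antipode_one] at h1
    have h2 := congrArg (fun y => l (x * y)) h1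
    simp only [Finset.mul_sum, map_sum, ← mul_assoc, hK _ h hh, Finset.sum_const_zero,
      mul_smul_comm, mul_one, map_smul, smul_eq_mul] at h2
    exact (mul_eq_zero.1 h2).resolve_right hx
  rw [← Module.forall_dual_apply_eq_zero_iff 𝕜]
  intro φ
  rw [← counit_hitLeft]
  exact hε _ (hK φ h hh)

/-- An element of the kernel of S lies in the radical of the integral, which is zero; finite
dimension does the rest. The integral itself was constructed without an inverse of S. -/
theorem exists_antipodeInv (𝕜 H : Type*) [Field 𝕜] [Ring H] [HopfAlgebra 𝕜 H]
    [Module.Finite 𝕜 H] : ∃ T : H →ₗ[𝕜] H, IsAntipodeInv T := by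
  obtain ⟨l, hl0, hl⟩ := exists_left_integral (𝕜 := 𝕜) (H := H)
  have hinj : Function.Injective (antipode 𝕜 : H →ₗ[𝕜] H) := by
    rw [← LinearMap.ker_eq_bot, LinearMap.ker_eq_bot']
    intro h hh
    exact eq_zero_of_left_integral hl0 hl fun x => by rw [hh, mul_zero, map_zero]
  let e := LinearEquiv.ofInjectiveEndo (antipode 𝕜 : H →ₗ[𝕜] H) hinj
  exact ⟨e.symm.toLinearMap, ⟨e.apply_symm_apply, e.symm_apply_apply⟩⟩

/-- A right integral on a Hopf algebra and a left integral in it, normalized. -/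
theorem exists_integrals (𝕜 H : Type*) [Field 𝕜] [Ring H] [HopfAlgebra 𝕜 H]
    [Module.Finite 𝕜 H] : ∃ (L : H) (f : Module.Dual 𝕜 H),
      (∀ h, h * L = counit (R := 𝕜) h • L) ∧ (∀ h, hitRight f h = f h • (1 : H)) ∧ f L = 1 := by
  obtain ⟨T, hT⟩ := exists_antipodeInv 𝕜 H
  obtain ⟨l, hl0, hl⟩ := exists_left_integral (𝕜 := 𝕜) (H := H)
  let p : H →ₗ[𝕜] Module.Dual 𝕜 H := (LinearMap.mul 𝕜 H).compr₂ l
  have hp : ∀ a x, p a x = l (a * x) := fun _ _ => rfl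
  have hdim : Module.finrank 𝕜 H = Module.finrank 𝕜 (Module.Dual 𝕜 H) :=
    Subspace.dual_finrank_eq.symm
  have hflip : Function.Injective p.flip := by
    rw [← LinearMap.ker_eq_bot, LinearMap.ker_eq_bot']
    intro h hh
    rw [← hT.antipode_inv h, eq_zero_of_left_integral hl0 hl (h := T h), map_zero]
    intro x
    rw [hT.antipode_inv]
    exact LinearMap.congr_fun hh x
  have hsurj := (LinearMap.injective_iff_surjective_of_finrank_eq_finrank hdim).1 hflip
  have hinj : Function.Injective p := by
    rw [← LinearMap.ker_eq_bot, LinearMap.ker_eq_bot']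
    intro h hh
    rw [← Module.forall_dual_apply_eq_zero_iff 𝕜]
    intro f
    obtain ⟨x, rfl⟩ := hsurj f
    exact LinearMap.congr_fun hh x
  -- The form l(a x) is nondegenerate, so the counit is represented by some M; uniqueness of the
  -- representing element makes M a right integral.
  obtain ⟨M, hM⟩ := (LinearMap.injective_iff_surjective_of_finrank_eq_finrank hdim).1 hinj counit
  have hM' : ∀ x, l (M * x) = counit (R := 𝕜) x := LinearMap.congr_fun hM
  have hMr : ∀ h, M * h = counit (R := 𝕜) h • M := by
    intro h
    apply hinj
    ext x
    simp [hp, mul_assoc, hM']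
  -- The antipode exchanges left and right: S⁻¹(M) is a left integral, l ∘ S is a right integral on
  -- H, and their pairing is l(M) = ε(1) = 1.
  refine ⟨T M, l ∘ₗ antipode 𝕜, fun h => ?_, fun h => hT.injective ?_, ?_⟩
  · rw [← hT.inv_antipode h, ← hT.map_mul, hMr, map_smul, hT.inv_antipode, counit_antipode]
  · have h1 := hl (antipode 𝕜 h)
    rw [hitLeft_apply, comul_antipode] at h1
    rw [map_smul, antipode_one, LinearMap.comp_apply, ← h1, hitRight_apply]
    generalize comul (R := 𝕜) h = X
    induction X with
    | zero => simp
    | add x y hx hy => simp only [map_add, hx, hy]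
    | tmul c d => simp
  · rw [LinearMap.comp_apply, hT.antipode_inv, ← mul_one M, hM', Bialgebra.counit_one]

end LeftIntegral

/-! ### Uniqueness of integrals and the trace formula. -/

section Integrals

variable {𝕜 H : Type*} [Field 𝕜] [Ring H] [HopfAlgebra 𝕜 H]

/-- Left integrals in a Hopf algebra. -/
def IsLeftIntegral (𝕜 : Type*) {H : Type*} [Field 𝕜] [Ring H] [HopfAlgebra 𝕜 H] (L : H) : Prop :=
  ∀ h : H, h * L = counit (R := 𝕜) h • L

/-- Right integrals on a Hopf algebra. -/
def IsRightCointegral (f : Module.Dual 𝕜 H) : Prop := ∀ h, hitRight f h = f h • (1 : H)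

/-- Compute h₁ L₁ ⊗ S(L₂) S(h₂) h₃ in two ways. The factors S(h₂) h₃ cancel, and on the other hand
h₁ L₁ ⊗ S(h₂ L₂) is ε(h₁) L₁ ⊗ S(L₂) since L is an integral. -/
theorem IsLeftIntegral.mul_map_antipode {L : H} (hL : IsLeftIntegral 𝕜 L) (h : H) :
    (h ⊗ₜ[𝕜] (1 : H)) * (antipode 𝕜).lTensor H (comul L) =
      (antipode 𝕜).lTensor H (comul L) * ((1 : H) ⊗ₜ[𝕜] h) := by
  let Z : H ⊗[𝕜] H := (antipode 𝕜).lTensor H (comul L)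
  let A := leftOp 𝕜 (H ⊗[𝕜] H) ∘ₗ inl 𝕜 H
  let B := rightOp 𝕜 (H ⊗[𝕜] H) ∘ₗ inr 𝕜 H
  have hB : IsAlg B := isAlg_rightOp_comp isAlg_inr
  have h1 : conv (conv A (B ∘ₗ antipode 𝕜)) B = A := by
    rw [conv_assoc, antipode_conv_self hB, conv_unit]
  have h2 : ∀ y, (conv A (B ∘ₗ antipode 𝕜) y).unop Z = counit (R := 𝕜) y • Z := by
    intro y
    have : ∀ X Y : H ⊗[𝕜] H,
        (pairMul A (B ∘ₗ antipode 𝕜) X).unop ((antipode 𝕜).lTensor H Y) =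
          (antipode 𝕜).lTensor H (X * Y) := by
      intro X Y
      induction X with
      | zero => simp
      | add x y hx hy => simp only [map_add, add_mul, MulOpposite.unop_add, LinearMap.add_apply,
          hx, hy]
      | tmul a b =>
        induction Y with
        | zero => simp
        | add x y hx hy => simp only [map_add, mul_add, hx, hy]
        | tmul c d => simp [A, B, antipode_mul_antidistrib]
    rw [conv_apply, this, ← Bialgebra.comul_mul, hL, map_smul, map_smul]
  have h3 : ∀ X : H ⊗[𝕜] H, (pairMul (conv A (B ∘ₗ antipode 𝕜)) B X).unop Z =
      Z * ((1 : H) ⊗ₜ[𝕜] contrLeft counit X) := by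
    intro X
    induction X with
    | zero => simp
    | add x y hx hy => simp only [map_add, mul_add, TensorProduct.tmul_add, MulOpposite.unop_add,
        LinearMap.add_apply, hx, hy]
    | tmul a b => simp [h2, B]
  have h4 := congrArg (fun y => y.unop Z) (LinearMap.congr_fun h1 h)
  simp only [conv_apply (conv A (B ∘ₗ antipode 𝕜)) B, h3, ← hitRight_apply, hitRight_counit] at h4
  exact h4.symm

end Integrals

end HopfTrace

namespace HopfTrace

open Coalgebra HopfAlgebra

section Uniqueness

variable {𝕜 H : Type*} [Field 𝕜] [Ring H] [HopfAlgebra 𝕜 H]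

/-- `∑ f(h L₁) S(L₂) = f(L) h` for a left integral `L` and a right integral `f`. -/
theorem IsRightCointegral.contrLeft_map_antipode {f : Module.Dual 𝕜 H} (hf : IsRightCointegral f)
    {L : H} (hL : IsLeftIntegral 𝕜 L) (h : H) :
    contrLeft (f ∘ₗ LinearMap.mulLeft 𝕜 h) ((antipode 𝕜).lTensor H (comul L)) = f L • h := by
  have h1 : ∀ X : H ⊗[𝕜] H, contrLeft (f ∘ₗ LinearMap.mulLeft 𝕜 h) X =
      contrLeft f ((h ⊗ₜ 1) * X) := by
    intro X
    induction X with
    | zero => simp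
    | add x y hx hy => simp only [map_add, mul_add, hx, hy]
    | tmul a b => simp
  have h2 : ∀ X : H ⊗[𝕜] H, contrLeft f ((antipode 𝕜).lTensor H X * (1 ⊗ₜ h)) =
      antipode 𝕜 (contrLeft f X) * h := by
    intro X
    induction X with
    | zero => simp
    | add x y hx hy => simp only [map_add, add_mul, hx, hy]
    | tmul a b => simp
  rw [h1, hL.mul_map_antipode, h2, ← hitRight_apply, hf, map_smul, antipode_one, smul_one_mul]

/-- `∑ f(S(L₂) h) L₁ = h · ∑ f(S(L₂)) L₁` for a left integral `L`. -/
theorem IsLeftIntegral.contrRight_mulRight (f : Module.Dual 𝕜 H)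
    {L : H} (hL : IsLeftIntegral 𝕜 L) (h : H) :
    contrRight (f ∘ₗ LinearMap.mulRight 𝕜 h) ((antipode 𝕜).lTensor H (comul L)) =
      h * hitLeft (f ∘ₗ antipode 𝕜) L := by
  have h1 : ∀ X : H ⊗[𝕜] H, contrRight (f ∘ₗ LinearMap.mulRight 𝕜 h) X =
      contrRight f (X * (1 ⊗ₜ h)) := by
    intro X
    induction X with
    | zero => simp
    | add x y hx hy => simp only [map_add, add_mul, hx, hy]
    | tmul a b => simp
  have h2 : ∀ X : H ⊗[𝕜] H, contrRight f ((h ⊗ₜ 1) * (antipode 𝕜).lTensor H X) =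
      h * contrRight (f ∘ₗ antipode 𝕜) X := by
    intro X
    induction X with
    | zero => simp
    | add x y hx hy => simp only [map_add, mul_add, hx, hy]
    | tmul a b => simp
  rw [h1, ← hL.mul_map_antipode, h2, ← hitLeft_apply]

variable {T : H →ₗ[𝕜] H}

theorem IsRightCointegral.hitLeft_antipode {f : Module.Dual 𝕜 H} (hf : IsRightCointegral f)
    (hT : IsAntipodeInv T) (h : H) :
    hitLeft (f ∘ₗ antipode 𝕜) h = f (antipode 𝕜 h) • (1 : H) := by
  apply hT.injective
  have h1 := hf (antipode 𝕜 h)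
  rw [hitRight_apply, comul_antipode] at h1
  rw [map_smul, antipode_one, ← h1, hitLeft_apply]
  generalize comul (R := 𝕜) h = X
  induction X with
  | zero => simp
  | add x y hx hy => simp only [map_add, hx, hy]
  | tmul c d => simp

/-- Apply f to ∑ f'(h L₁) S(L₂) = f'(L) h and use that f ∘ S is a left integral. If f(S(L)) ≠ 0 this
is uniqueness up to a scalar; for f' = f and h = L it gives f(S(L)) = 1. -/
theorem IsRightCointegral.smul_eq {f f' : Module.Dual 𝕜 H} (hf : IsRightCointegral f)
    (hf' : IsRightCointegral f') (hT : IsAntipodeInv T) {L : H} (hL : IsLeftIntegral 𝕜 L) (h : H) :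
    f' L * f h = f (antipode 𝕜 L) * f' h := by
  have h1 := congrArg f (hf'.contrLeft_map_antipode hL h)
  rw [map_smul, smul_eq_mul] at h1
  rw [← h1]
  have h2 : ∀ X : H ⊗[𝕜] H, f (contrLeft (f' ∘ₗ LinearMap.mulLeft 𝕜 h)
      ((antipode 𝕜).lTensor H X)) = f' (h * contrRight (f ∘ₗ antipode 𝕜) X) := by
    intro X
    induction X with
    | zero => simp
    | add x y hx hy => simp only [map_add, mul_add, hx, hy]
    | tmul a b => simp [mul_comm]
  rw [h2, ← hitLeft_apply, hf.hitLeft_antipode hT, mul_smul_comm, mul_one, map_smul, smul_eq_mul]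

/-- A normalized pair of a left integral in `H` and a right integral on `H`. -/
structure IsIntegralPair (L : H) (f : Module.Dual 𝕜 H) : Prop where
  left : IsLeftIntegral 𝕜 L
  right : IsRightCointegral f
  apply_eq_one : f L = 1

namespace IsIntegralPair

variable {L : H} {f : Module.Dual 𝕜 H}

theorem apply_antipode (hT : IsAntipodeInv T) (hI : IsIntegralPair L f) :
    f (antipode 𝕜 L) = 1 := by
  have := hI.right.smul_eq hI.right hT hI.left L
  rwa [hI.apply_eq_one, mul_one, mul_one, eq_comm] at this

theorem eq_smul_right (hT : IsAntipodeInv T) (hI : IsIntegralPair L f) {f' : Module.Dual 𝕜 H}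
    (hf' : IsRightCointegral f') (h : H) : f' h = f' L * f h := by
  rw [hI.right.smul_eq hf' hT hI.left, hI.apply_antipode hT, one_mul]

theorem contrRight_eq (hT : IsAntipodeInv T) (hI : IsIntegralPair L f) (h : H) :
    contrRight (f ∘ₗ LinearMap.mulRight 𝕜 h) ((antipode 𝕜).lTensor H (comul L)) = h := by
  rw [hI.left.contrRight_mulRight, hI.right.hitLeft_antipode hT, hI.apply_antipode hT, one_smul,
    mul_one]

theorem eq_smul_left (hT : IsAntipodeInv T) (hI : IsIntegralPair L f) {L' : H}
    (hL' : IsLeftIntegral 𝕜 L') : L' = f L' • L := by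
  have h1 : ∀ X : H ⊗[𝕜] H, contrRight (f ∘ₗ LinearMap.mulRight 𝕜 L')
      ((antipode 𝕜).lTensor H X) = f L' • contrRight counit X := by
    intro X
    induction X with
    | zero => simp
    | add x y hx hy => simp only [map_add, smul_add, hx, hy]
    | tmul a b => simp [hL' _, smul_smul, mul_comm]
  have h2 := hI.contrRight_eq hT L'
  have h3 : contrRight (counit (R := 𝕜)) (comul L) = L := by simp [contrRight]
  rw [h1, h3] at h2
  exact h2.symm

/-- `Tr(φ) = ∑ f(S(L₂) φ(L₁))`. -/
theorem trace_eq [Module.Finite 𝕜 H] (hT : IsAntipodeInv T) (hI : IsIntegralPair L f)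
    (φ : Module.End 𝕜 H) : LinearMap.trace 𝕜 H φ =
      f (pairMul (antipode 𝕜) φ (TensorProduct.comm 𝕜 H H (comul L))) := by
  -- The dual basis relation writes φ as a sum of rank-one maps h ↦ f(S(L₂) h) φ(L₁).
  have h1 : φ = ∑ j, (f ∘ₗ LinearMap.mulLeft 𝕜 (antipode 𝕜 (Module.finBasis 𝕜 H j))).smulRight
      (φ (hitLeft ((Module.finBasis 𝕜 H).coord j) L)) := by
    ext h
    conv_lhs => rw [← hI.contrRight_eq hT h, comul_eq_sum_left (Module.finBasis 𝕜 H) L]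
    simp [LinearMap.sum_apply]
  rw [comul_eq_sum_left (Module.finBasis 𝕜 H) L]
  conv_lhs => rw [h1]
  simp only [map_sum, LinearMap.trace_smulRight, TensorProduct.comm_tmul, pairMul_tmul,
    LinearMap.comp_apply, LinearMap.mulLeft_apply]

end IsIntegralPair

/-- The multiple Λ h is again a left integral and λ ∘ (· ↼ ψ) again a right integral. By uniqueness
they are proportional to Λ and λ, which yields α(h) = λ(Λ h) and g = λ ⇀ Λ. -/
theorem nonempty_normalizedIntegrals (𝕜 H : Type*) [Field 𝕜] [Ring H] [HopfAlgebra 𝕜 H]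
    [Module.Finite 𝕜 H] : Nonempty (NormalizedIntegrals 𝕜 H) := by
  obtain ⟨T, hT⟩ := exists_antipodeInv 𝕜 H
  obtain ⟨L, f, hL, hf, h1⟩ := exists_integrals 𝕜 H
  have hI : IsIntegralPair L f := ⟨hL, hf, h1⟩
  refine ⟨⟨L, f, f ∘ₗ LinearMap.mulLeft 𝕜 L, hitLeft f L, hL, hf, h1, fun h => ?_, fun h => ?_⟩⟩
  · exact hI.eq_smul_left hT (fun x => by rw [← mul_assoc, hL, smul_mul_assoc])
  · rw [← sub_eq_zero, ← Module.forall_dual_apply_eq_zero_iff 𝕜]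
    intro ψ
    have hψ : IsRightCointegral (f ∘ₗ hitRight ψ) := fun x => by
      rw [← hitRight_comp_hitRight, LinearMap.comp_apply, hf]
      rfl
    have h2 := hI.eq_smul_right hT hψ h
    simp only [LinearMap.comp_apply] at h2
    rw [map_sub, map_smul, dual_hitLeft, dual_hitLeft, h2, smul_eq_mul, mul_comm, sub_self]

end Uniqueness

end HopfTrace

/-! ### The integral Λ_{1/2}. -/

namespace NormalizedIntegrals

open HopfTrace Coalgebra HopfAlgebra

variable {𝕜 H : Type*} [Field 𝕜] [Ring H] [HopfAlgebra 𝕜 H] (I : NormalizedIntegrals 𝕜 H)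

theorem isIntegralPair : IsIntegralPair I.Lam I.lam := ⟨I.mul_Lam, I.hitRight_lam, I.lam_Lam⟩

theorem alpha_eq (h : H) : I.alpha h = I.lam (I.Lam * h) := by
  rw [I.Lam_mul, map_smul, I.lam_Lam, smul_eq_mul, mul_one]

theorem isAlg_alpha : IsAlg (I.alpha : H →ₗ[𝕜] 𝕜) where
  map_one := by rw [alpha_eq, mul_one, I.lam_Lam]
  map_mul x y := by
    rw [alpha_eq, ← mul_assoc, I.Lam_mul, smul_mul_assoc, I.Lam_mul, map_smul, map_smul, I.lam_Lam,
      smul_eq_mul, smul_eq_mul, mul_one]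

theorem dualPow_alpha_neg_one : dualPow I.alpha (-1) = I.alpha ∘ₗ antipode 𝕜 := by
  let v : (WithConv (H →ₗ[𝕜] 𝕜))ˣ :=
    ⟨WithConv.toConv I.alpha, WithConv.toConv (I.alpha ∘ₗ antipode 𝕜),
      congrArg WithConv.toConv (self_conv_antipode I.isAlg_alpha),
      congrArg WithConv.toConv (antipode_conv_self I.isAlg_alpha)⟩
  have := intPow_units v (-1)
  rw [zpow_neg_one] at this
  exact congrArg WithConv.ofConv this

theorem hitLeft_mul {f : Module.Dual 𝕜 H} (hf : IsAlg (f : H →ₗ[𝕜] 𝕜)) (x y : H) :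
    hitLeft f (x * y) = hitLeft f x * hitLeft f y := by
  have : ∀ X Y : H ⊗[𝕜] H, contrRight f (X * Y) = contrRight f X * contrRight f Y := by
    intro X Y
    induction X with
    | zero => simp
    | add x y hx hy => simp only [map_add, add_mul, hx, hy]
    | tmul a b => induction Y with
      | zero => simp
      | add x y hx hy => simp only [map_add, mul_add, hx, hy]
      | tmul c d => simp [hf.map_mul, smul_smul, mul_comm]
  rw [hitLeft_apply, Bialgebra.comul_mul, this]
  rfl

/-- The action of α⁻¹ is multiplicative and (α ⇀ h) S(Λ) = ε(h) S(Λ), so α⁻¹ ⇀ S(Λ) is a left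
integral. Its value under λ is α⁻¹(1) λ(S(Λ)) = 1, and uniqueness identifies it with Λ. -/
theorem LamHalf_one {T : H →ₗ[𝕜] H} (hT : IsAntipodeInv T) : I.LamHalf 1 = I.Lam := by
  have hα := I.isAlg_alpha
  have hβ : IsAlg (I.alpha ∘ₗ antipode 𝕜 : H →ₗ[𝕜] 𝕜) :=
    ⟨by simp [hα.map_one], fun x y => by simp [antipode_mul_antidistrib, hα.map_mul, mul_comm]⟩
  have h0 : I.LamHalf 1 = hitLeft (I.alpha ∘ₗ antipode 𝕜) (antipode 𝕜 I.Lam) := by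
    rw [LamHalf, dualPow_alpha_neg_one]
  have h1 : I.lam (I.LamHalf 1) = 1 := by
    rw [h0, dual_hitLeft, I.hitRight_lam, I.isIntegralPair.apply_antipode hT, one_smul,
      hβ.map_one]
  have h2 : IsLeftIntegral 𝕜 (I.LamHalf 1) := by
    intro h
    have e1 : hitLeft (I.alpha ∘ₗ antipode 𝕜) (hitLeft I.alpha h) = h := by
      have e : (I.alpha ∘ₗ antipode 𝕜) ∘ₗ hitLeft I.alpha = counit := by
        ext y
        have e' : ∀ X : H ⊗[𝕜] H, (I.alpha ∘ₗ antipode 𝕜) (contrRight I.alpha X) =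
            pairMul (I.alpha ∘ₗ antipode 𝕜) I.alpha X := by
          intro X
          induction X with
          | zero => simp
          | add x y hx hy => simp only [map_add, hx, hy]
          | tmul a b => simp [mul_comm]
        exact (e' _).trans (LinearMap.congr_fun (antipode_conv_self hα) y)
      rw [← LinearMap.comp_apply, hitLeft_comp_hitLeft, e]
      simp [hitLeft]
    have e2 : ∀ X : H ⊗[𝕜] H, I.alpha (T (contrRight I.alpha X)) =
        I.alpha (pairMul LinearMap.id T (TensorProduct.comm 𝕜 H H X)) := by
      intro X
      induction X with
      | zero => simp
      | add x y hx hy => simp only [map_add, hx, hy]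
      | tmul a b => simp [hα.map_mul]
    have e3 : hitLeft I.alpha h * antipode 𝕜 I.Lam = counit (R := 𝕜) h • antipode 𝕜 I.Lam := by
      conv_lhs => rw [← hT.antipode_inv (hitLeft I.alpha h)]
      rw [← antipode_mul_antidistrib, I.Lam_mul, hitLeft_apply, e2, hT.pairMul_comm_comul',
        Algebra.algebraMap_eq_smul_one, map_smul, map_smul, hα.map_one, smul_eq_mul, mul_one]
    rw [h0]
    conv_lhs => rw [← e1]
    rw [← hitLeft_mul hβ, e3, map_smul]
  have := I.isIntegralPair.eq_smul_left hT h2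
  rwa [h1, one_smul] at this

end NormalizedIntegrals

namespace HopfTrace

open Coalgebra HopfAlgebra

/-! ### Splitting off the last tensor factor, and products in reversed order. -/

section Snoc

variable (𝕜 H : Type*) [Field 𝕜] [Ring H] [HopfAlgebra 𝕜 H]

/-- The linear map `H^{⊗ m} ⊗ H → H^{⊗ (m + 1)}`. -/
noncomputable def tensorSnoc (m : ℕ) :
    (⨂[𝕜] (_ : Fin m), H) ⊗[𝕜] H →ₗ[𝕜] ⨂[𝕜] (_ : Fin (m + 1)), H :=
  tensorPerm 𝕜 H (finRotate (m + 1)) ∘ₗ tensorCons 𝕜 H m ∘ₗ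
    (TensorProduct.comm 𝕜 (⨂[𝕜] (_ : Fin m), H) H).toLinearMap

theorem tensorSnoc_tmul (m : ℕ) (v : Fin m → H) (h : H) :
    tensorSnoc 𝕜 H m (PiTensorProduct.tprod 𝕜 v ⊗ₜ[𝕜] h) =
      PiTensorProduct.tprod 𝕜 (Fin.snoc v h : Fin (m + 1) → H) := by
  rw [Fin.snoc_eq_cons_rotate, tensorSnoc, LinearMap.comp_apply, LinearMap.comp_apply,
    LinearEquiv.coe_coe, TensorProduct.comm_tmul, tensorCons_tmul, tensorPerm_tprod]

theorem tensorCons_tensorSnoc (m : ℕ) (a b : H) (y : ⨂[𝕜] (_ : Fin m), H) :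
    tensorCons 𝕜 H (m + 1) (a ⊗ₜ tensorSnoc 𝕜 H m (y ⊗ₜ b)) =
      tensorSnoc 𝕜 H (m + 1) (tensorCons 𝕜 H m (a ⊗ₜ y) ⊗ₜ b) := by
  induction y using PiTensorProduct.induction_on with
  | smul_tprod r v =>
    simp only [TensorProduct.tmul_smul, ← TensorProduct.smul_tmul', map_smul]
    rw [tensorSnoc_tmul, tensorCons_tmul, tensorCons_tmul, tensorSnoc_tmul, Fin.cons_snoc_eq_snoc_cons]
  | add x y hx hy =>
    simp only [TensorProduct.tmul_add, TensorProduct.add_tmul, map_add, hx, hy]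

/-- The recursion splits off the first factor; coassociativity allows the last one instead. That one
belongs to p_n, where the upper curve starts. -/
theorem iterComul_succ' (m : ℕ) (x : H) : iterComul 𝕜 H (m + 1) x =
    tensorSnoc 𝕜 H m ((iterComul 𝕜 H m).rTensor H (comul x)) := by
  induction m generalizing x with
  | zero =>
    have h2 : (PiTensorProduct.isEmptyEquiv (R := 𝕜) (s := fun _ : Fin 0 => H) (Fin 0)).symm 1 =
        PiTensorProduct.tprod 𝕜 Fin.elim0 := by
      rw [LinearEquiv.symm_apply_eq, PiTensorProduct.isEmptyEquiv_apply_tprod]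
    rw [iterComul_one, iterComul, LinearMap.rTensor_comp, LinearMap.comp_apply,
      Coalgebra.rTensor_counit_comul, LinearMap.rTensor_tmul, LinearEquiv.coe_coe, h2,
      tensorSnoc_tmul]
    congr 1
  | succ m ih =>
    have h1 : ∀ X : H ⊗[𝕜] H, (iterComul 𝕜 H (m + 1)).lTensor H X =
        (tensorSnoc 𝕜 H m ∘ₗ (iterComul 𝕜 H m).rTensor H).lTensor H (comul.lTensor H X) := by
      intro X
      rw [← LinearMap.comp_apply, ← LinearMap.lTensor_comp]
      congr 2
      ext y
      exact ih y
    have h2 : ∀ (X : H ⊗[𝕜] H) (b : H), tensorCons 𝕜 H (m + 1)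
        ((tensorSnoc 𝕜 H m ∘ₗ (iterComul 𝕜 H m).rTensor H).lTensor H
          (TensorProduct.assoc 𝕜 H H H (X ⊗ₜ b))) =
        tensorSnoc 𝕜 H (m + 1) ((tensorCons 𝕜 H m ((iterComul 𝕜 H m).lTensor H X)) ⊗ₜ b) := by
      intro X b
      induction X with
      | zero => simp
      | add x y hx hy => simp only [map_add, TensorProduct.add_tmul, hx, hy]
      | tmul c d =>
        rw [TensorProduct.assoc_tmul, LinearMap.lTensor_tmul, LinearMap.comp_apply,
          LinearMap.rTensor_tmul, tensorCons_tensorSnoc, LinearMap.lTensor_tmul]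
    have h3 : ∀ X : H ⊗[𝕜] H, tensorCons 𝕜 H (m + 1)
        ((tensorSnoc 𝕜 H m ∘ₗ (iterComul 𝕜 H m).rTensor H).lTensor H
          (TensorProduct.assoc 𝕜 H H H (comul.rTensor H X))) =
        tensorSnoc 𝕜 H (m + 1) ((iterComul 𝕜 H (m + 1)).rTensor H X) := by
      intro X
      induction X with
      | zero => simp
      | add x y hx hy => simp only [map_add, hx, hy]
      | tmul c d =>
        rw [LinearMap.rTensor_tmul, h2, LinearMap.rTensor_tmul]
        rfl
    rw [iterComul, LinearMap.comp_apply, LinearMap.comp_apply, h1, ← Coalgebra.coassoc_apply, h3]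

end Snoc

section Diagram

variable {𝕜 H : Type*} [Field 𝕜] [Ring H] [HopfAlgebra 𝕜 H]

theorem reverse_ofFn {α : Type*} {m : ℕ} (f : Fin m → α) :
    (List.ofFn f).reverse = List.ofFn fun i => f i.rev := by
  apply List.ext_getElem
  · simp
  · intro i h1 h2
    simp only [List.getElem_reverse, List.getElem_ofFn, List.length_ofFn]
    congr 1
    ext
    simp [Fin.val_rev]
    omega

theorem antipode_list_prod (l : List H) :
    antipode 𝕜 l.prod = ((l.map (antipode 𝕜)).reverse).prod := by
  induction l with
  | nil => simp
  | cons a l ih => simp [antipode_mul_antidistrib, ih]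

/-- A shuffled product in which the last factor comes first and the other ones, up to the antipode,
come in the reverse of the order `σ`. -/
theorem tensorMul_reverse (m : ℕ) (σ : Equiv.Perm (Fin m)) (τ : Equiv.Perm (Fin (m + 1)))
    (h0 : τ 0 = Fin.last m) (hτ : ∀ t : Fin m, τ t.succ = (σ t.rev).castSucc)
    (p : Fin m → Module.End 𝕜 H) (q : Fin (m + 1) → Module.End 𝕜 H)
    (hq0 : q (Fin.last m) = antipode 𝕜) (hq : ∀ i : Fin m, q i.castSucc = antipode 𝕜 ∘ₗ p i)
    (x : H) :
    tensorMul 𝕜 H (m + 1) (tensorPerm 𝕜 H τ (PiTensorProduct.map q (iterComul 𝕜 H (m + 1) x))) =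
      pairMul (antipode 𝕜) (antipode 𝕜 ∘ₗ (tensorMul 𝕜 H m ∘ₗ tensorPerm 𝕜 H σ ∘ₗ
        PiTensorProduct.map p ∘ₗ iterComul 𝕜 H m)) (TensorProduct.comm 𝕜 H H (comul x)) := by
  have h1 : ∀ (y : ⨂[𝕜] (_ : Fin m), H) (b : H), tensorMul 𝕜 H (m + 1)
      (tensorPerm 𝕜 H τ (PiTensorProduct.map q (tensorSnoc 𝕜 H m (y ⊗ₜ b)))) =
      antipode 𝕜 b * antipode 𝕜 (tensorMul 𝕜 H m (tensorPerm 𝕜 H σ (PiTensorProduct.map p y))) := by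
    intro y b
    induction y using PiTensorProduct.induction_on with
    | smul_tprod r v =>
      simp only [← TensorProduct.smul_tmul', map_smul, mul_smul_comm]
      rw [tensorSnoc_tmul, PiTensorProduct.map_tprod, PiTensorProduct.map_tprod, tensorPerm_tprod,
        tensorPerm_tprod, tensorMul_tprod, tensorMul_tprod, antipode_list_prod, List.map_ofFn,
        reverse_ofFn, List.ofFn_succ, List.prod_cons, h0, hq0, Fin.snoc_last]
      congr 4
      ext t
      rw [hτ, hq, Fin.snoc_castSucc]
      rfl
    | add x y hx hy => simp only [TensorProduct.add_tmul, map_add, mul_add, hx, hy]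
  rw [iterComul_succ']
  generalize comul (R := 𝕜) x = X
  induction X with
  | zero => simp
  | add x y hx hy => simp only [map_add, hx, hy]
  | tmul a b =>
    rw [LinearMap.rTensor_tmul, h1, TensorProduct.comm_tmul, pairMul_tmul]
    rfl

end Diagram

/-! ### Rotation numbers of the lens space diagram and the exponents. -/

section Exponents

variable {n k : ℕ}

/-- Apart from the arcs that leave p_n and p_{n-k}, the rotation along an arc is minus the increment
of c. The odd difference n - k makes 2k₀ equal to n - k - 1, so the cases match. -/
theorem arcRotation_eq (hkn : k < n) (hodd : Odd (n - k)) {i : ℕ} (hi : 0 < i) (hin : i < n)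
    (hik : i ≠ n - k) : arcRotation n k i = -(expStep n k i : ℚ) := by
  obtain ⟨m, hm⟩ := hodd
  have e1 : n - k - 1 = 2 * m := by omega
  have e2 : 2 * m / 2 = m := by omega
  rw [arcRotation, expStep, e1, e2, if_neg hin.ne, if_neg hik]
  by_cases h1 : i ≤ m
  · rw [if_pos h1, if_pos ⟨hi, h1⟩]
    norm_num
  · by_cases h2 : i ≤ 2 * m
    · rw [if_neg h1, if_pos h2, if_neg (fun h => h1 h.2), if_pos ⟨by omega, h2⟩]
      norm_num
    · rw [if_neg h1, if_neg h2, if_neg (fun h => h1 h.2), if_neg (fun h => h2 h.2)]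
      norm_num

theorem val_eq_posRes (hn : 0 < n) (a : ℤ) (h : posRes n a ≠ n) : (a : ZMod n).val = posRes n a := by
  have := posRes_le hn a
  rw [← posRes_cast hn, ZMod.val_natCast_of_lt (by omega)]

/-- A telescoping sum: the arc leaving p_n contributes -1/4 and the others -(c_{i+k} - c_i). The
exceptional arc at p_{n-k} is the last one and does not occur here. -/
theorem sum_arcRotation_range (hkn : k < n) (hcop : n.Coprime k) (hodd : Odd (n - k)) (r : ℕ)
    (hr : r + 1 < n) : ∑ j ∈ Finset.range (r + 1), arcRotation n k (posRes n (k * j)) =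
      -(1 / 4) - (exponentSeq n k hkn hcop ((r + 1 : ℕ) * k : ZMod n) : ℚ) := by
  have hn : 0 < n := by omega
  have : NeZero n := ⟨hn.ne'⟩
  obtain ⟨hc0, hc⟩ := (isExponentSeq_iff hn _).1 (exponentSeq_spec n k hkn hcop)
  have hcast : ∀ a : ℕ, (((k * a : ℤ) : ZMod n)) = a * k := fun a => by push_cast; ring
  induction r with
  | zero =>
    have h1 : posRes n ((k : ℤ) * (0 : ℕ)) = n := posRes_unique hn le_rfl (by simp [Int.ModEq])
    have h2 := hc 0
    rw [hc0, ZMod.val_zero, zero_add] at h2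
    have h3 : expStep n k 0 = 0 := by simp [expStep]
    rw [Finset.sum_range_one, h1, arcRotation, if_pos rfl, zero_add, Nat.cast_one, one_mul, h2, h3]
    norm_num
  | succ r ih =>
    have hne : ∀ a : ℕ, 0 < a → a < n → (a * k : ZMod n) ≠ 0 := by
      intro a h0 ha h
      rw [← Nat.cast_mul, ZMod.natCast_eq_zero_iff] at h
      exact absurd (Nat.le_of_dvd h0 (hcop.dvd_of_dvd_mul_right h)) (by omega)
    have hp := posRes_cast hn (k * (r + 1 : ℕ))
    rw [hcast] at hp
    have h1 : posRes n (k * (r + 1 : ℕ)) ≠ n := by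
      intro h
      rw [h, ZMod.natCast_self] at hp
      exact hne (r + 1) (by omega) (by omega) hp.symm
    have h2 : posRes n (k * (r + 1 : ℕ)) ≠ n - k := by
      intro h
      rw [h, Nat.cast_sub hkn.le, ZMod.natCast_self, zero_sub] at hp
      refine hne (r + 1 + 1) (by omega) (by omega) ?_
      rw [Nat.cast_succ, add_mul, ← hp]
      ring
    have h3 := posRes_le hn (k * (r + 1 : ℕ))
    have h4 := val_eq_posRes hn (k * (r + 1 : ℕ)) h1
    rw [hcast] at h4
    rw [Finset.sum_range_succ, ih (by omega), arcRotation_eq hkn hodd (posRes_pos _ _) (by omega) h2,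
      ← h4]
    have h5 := hc ((r + 1 : ℕ) * k : ZMod n)
    have h6 : (((r + 1 + 1 : ℕ) : ZMod n) * k) = (r + 1 : ℕ) * k + k := by push_cast; ring
    rw [h6, h5]
    push_cast
    ring

theorem lensThetaUpper_lensPerm (h : n.Coprime k) (r : Fin n) :
    lensThetaUpper n k h (lensPerm n k h r) =
      ∑ j ∈ Finset.range r, arcRotation n k (posRes n (k * j)) := by
  rw [lensThetaUpper, Equiv.symm_apply_apply, ← Nat.Iio_eq_range, ← Fin.map_valEmbedding_Iio,
    Finset.sum_map]
  exact Finset.sum_congr rfl fun j _ => by rw [lensPerm_add_one]; rfl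

theorem lensPerm_zero (hn : 0 < n) (h : n.Coprime k) : (lensPerm n k h ⟨0, hn⟩ : ℕ) + 1 = n := by
  rw [lensPerm_add_one]
  exact posRes_unique hn le_rfl (by simp [Int.ModEq])

/-- At p_n the rotations are 1/4 and 0, giving 2 · 1/4 + 1/2 = 1. Elsewhere θ_η = 0 and θ_μ = -1/4 -
c, giving 1 + 2c. -/
theorem sExp_lensDiagramR (hk : 0 < k) (hkn : k < n) (hcop : n.Coprime k) (hodd : Odd (n - k))
    (p : Fin n) : (lensDiagramR n k hk hkn hcop hodd).sExp p =
      1 + 2 * exponentSeq n k hkn hcop (((p : ℕ) + 1 : ℕ) : ZMod n) := by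
  have hn : 0 < n := by omega
  have : NeZero n := ⟨hn.ne'⟩
  obtain ⟨hc0, hc⟩ := (isExponentSeq_iff hn _).1 (exponentSeq_spec n k hkn hcop)
  obtain ⟨⟨r, hr⟩, rfl⟩ := (lensPerm n k hcop).surjective p
  change ⌊2 * ((if (lensPerm n k hcop ⟨r, hr⟩ : ℕ) + 1 = n then 1 / 4 else 0) -
    lensThetaUpper n k hcop (lensPerm n k hcop ⟨r, hr⟩)) + 1 / 2⌋ = _
  rw [lensThetaUpper_lensPerm]
  cases r with
  | zero =>
    rw [if_pos (lensPerm_zero hn hcop), lensPerm_zero hn hcop, ZMod.natCast_self, hc0]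
    norm_num
  | succ r =>
    have hne : (lensPerm n k hcop ⟨r + 1, hr⟩ : ℕ) + 1 ≠ n := by
      intro h
      have := (lensPerm n k hcop).injective
        (Fin.ext (Nat.succ_injective (h.trans (lensPerm_zero hn hcop).symm)))
      simp at this
    have hp : (((lensPerm n k hcop ⟨r + 1, hr⟩ : ℕ) + 1 : ℕ) : ZMod n) = (r + 1 : ℕ) * k := by
      rw [lensPerm_add_one, posRes_cast hn]
      push_cast
      ring
    rw [if_neg hne, hp, sum_arcRotation_range hkn hcop hodd r hr, Int.floor_eq_iff]
    push_cast
    constructor <;> linarith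

end Exponents

end HopfTrace

namespace HopfTrace

open Coalgebra HopfAlgebra

/-! ### The Kuperberg invariant as a trace. -/

section Lens

variable {n k : ℕ}

/-- After p_n the upper curve meets the points in the reverse of the order σ, because (t + 1) k ≡
-(n - t - 1) k. The antipode in every factor compensates for this reversal. -/
theorem lensPerm_succ {m k : ℕ} (h : (m + 1).Coprime k) (t : Fin m) :
    lensPerm (m + 1) k h t.succ =
      (sigmaPerm (m + 1) (-(k : ℤ)) (isCoprime_neg_of_coprime h) t.rev).castSucc := by
  have hn : 0 < m + 1 := by omega
  apply Fin.ext
  rw [Fin.val_castSucc]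
  change posRes (m + 1) (k * ((t.succ : Fin (m + 1)) : ℕ)) - 1 =
    posRes (m + 1) (((t.rev : ℕ) + 1 : ℕ) * -(k : ℤ)) - 1
  congr 1
  refine posRes_unique (posRes_pos _ _) (posRes_le hn _)
    ((posRes_modEq hn _).trans ((ZMod.intCast_eq_intCast_iff _ _ _).1 ?_))
  have h1 : (((t.rev : ℕ) + 1 + (t + 1) : ℕ) : ZMod (m + 1)) = 0 := by
    rw [Fin.val_rev, ← ZMod.natCast_self (m + 1)]
    congr 1
    omega
  rw [Fin.val_succ]
  push_cast at h1 ⊢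
  linear_combination (-(k : ZMod (m + 1))) * h1

variable {𝕜 H : Type*} [Field 𝕜] [Ring H] [HopfAlgebra 𝕜 H] {T : H →ₗ[𝕜] H}

theorem intPow_one_add_two_mul (hT : IsAntipodeInv T) (c : ℤ) :
    intPow (antipodeEnd 𝕜 H) (1 + 2 * c) = antipode 𝕜 ∘ₗ intPow (antipodeEnd 𝕜 H) (2 * c) := by
  have h1 := intPow_units (antipodeUnit hT) (1 + 2 * c)
  have h2 := intPow_units (antipodeUnit hT) (2 * c)
  rw [zpow_add, zpow_one, Units.val_mul, ← h2] at h1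
  exact h1

/-- All t_r vanish, so T disappears, and s_r = 1 + 2c_r puts one extra S on each factor. The factor
of p_n comes first and carries S alone since c_n = 0; the remaining reversed product of antipodes is
S ∘ P. -/
theorem diagramOperator_lensDiagramR (hT : IsAntipodeInv T) (hk : 0 < k) (hkn : k < n)
    (hcop : n.Coprime k) (hodd : Odd (n - k)) (I : NormalizedIntegrals 𝕜 H) (x : H) :
    (lensDiagramR n k hk hkn hcop hodd).diagramOperator I x =
      pairMul (antipode 𝕜) (antipode 𝕜 ∘ₗ shuffledSweedlerPower 𝕜 H n k hkn hcop)
        (TensorProduct.comm 𝕜 H H (comul x)) := by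
  obtain ⟨m, rfl⟩ : ∃ m, n = m + 1 := ⟨n - 1, by omega⟩
  have hn : 0 < m + 1 := by omega
  have : NeZero (m + 1) := ⟨hn.ne'⟩
  have hc0 := ((isExponentSeq_iff hn _).1 (exponentSeq_spec (m + 1) k hkn hcop)).1
  let q : Fin (m + 1) → Module.End 𝕜 H := fun r =>
    intPow (antipodeEnd 𝕜 H) ((lensDiagramR (m + 1) k hk hkn hcop hodd).sExp r) ∘ₗ
      intPow I.T ((lensDiagramR (m + 1) k hk hkn hcop hodd).tExp r)
  have hq : ∀ r, q r = antipode 𝕜 ∘ₗ intPow (antipodeEnd 𝕜 H)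
      (2 * exponentSeq (m + 1) k hkn hcop (((r : ℕ) + 1 : ℕ) : ZMod (m + 1))) := by
    intro r
    have h1 : intPow I.T ((lensDiagramR (m + 1) k hk hkn hcop hodd).tExp r) = LinearMap.id :=
      pow_zero _
    change intPow (antipodeEnd 𝕜 H) ((lensDiagramR (m + 1) k hk hkn hcop hodd).sExp r) ∘ₗ
      intPow I.T ((lensDiagramR (m + 1) k hk hkn hcop hodd).tExp r) = _
    rw [h1, LinearMap.comp_id, sExp_lensDiagramR, intPow_one_add_two_mul hT]
  refine tensorMul_reverse m _ (lensPerm (m + 1) k hcop) ?_ (lensPerm_succ hcop) _ q ?_ ?_ x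
  · apply Fin.ext
    have := lensPerm_zero hn hcop
    rw [Fin.val_last]
    exact Nat.succ_injective this
  · rw [hq, Fin.val_last, ZMod.natCast_self, hc0, mul_zero]
    rfl
  · intro i
    rw [hq]
    rfl

/-- The Kuperberg invariant of the framed lens space is the trace of `S ∘ P`. -/
theorem kuperberg_lensDiagramR [Module.Finite 𝕜 H] (hk : 0 < k) (hkn : k < n)
    (hcop : n.Coprime k) (hodd : Odd (n - k)) (I : NormalizedIntegrals 𝕜 H) :
    (lensDiagramR n k hk hkn hcop hodd).kuperberg I =
      LinearMap.trace 𝕜 H (antipodeEnd 𝕜 H ∘ₗ shuffledSweedlerPower 𝕜 H n k hkn hcop) := by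
  obtain ⟨T, hT⟩ := exists_antipodeInv 𝕜 H
  have h1 : (lensDiagramR n k hk hkn hcop hodd).thetaUpperTotal = 1 / 2 :=
    (Equiv.sum_comp (lensPerm n k hcop) (fun i : Fin n => arcRotation n k ((i : ℕ) + 1))).trans
      ((Fin.sum_univ_eq_sum_range (fun i => arcRotation n k (i + 1)) n).trans
        (sum_arcRotation hk hkn hodd))
  have h2 : (lensDiagramR n k hk hkn hcop hodd).thetaLowerTotal = 1 / 2 := rfl
  have h3 : ⌊(-(1 / 2) + 1 / 2 : ℚ)⌋ = 0 := by norm_num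
  have h4 : ⌊(1 / 2 + 1 / 2 : ℚ)⌋ = 1 := by norm_num
  have h5 : ∀ x, I.lamHalf 0 x = I.lam x := fun x => by
    have : intPow I.g 0 = 1 := pow_zero _
    simp [NormalizedIntegrals.lamHalf, this]
  -- Both totals are 1/2, so the functional is λ_{-1/2} = λ and the element is Λ_{1/2} = Λ. The
  -- diagram then evaluates to the right side of the trace formula for φ = S ∘ P.
  rw [FramedDiagram.kuperberg, h1, h2, h3, h4, h5, I.LamHalf_one hT,
    diagramOperator_lensDiagramR hT, I.isIntegralPair.trace_eq hT]
  rfl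

end Lens

end HopfTrace

theorem theorem4p5 {𝕜 : Type*} {H : Type*} [Field 𝕜] [Ring H] [HopfAlgebra 𝕜 H]
    [Module.Finite 𝕜 H] (F : TwoCocycle 𝕜 H) (n k : ℕ) (hk : 0 < k) (hkn : k < n)
    (hcop : n.Coprime k) (hodd : Odd (n - k)) :
    LinearMap.trace 𝕜 H (antipodeEnd 𝕜 H ∘ₗ shuffledSweedlerPower 𝕜 H n k hkn hcop) =
        LinearMap.trace 𝕜 (DrinfeldTwist F)
          (antipodeEnd 𝕜 (DrinfeldTwist F) ∘ₗ
            shuffledSweedlerPower 𝕜 (DrinfeldTwist F) n k hkn hcop) ∧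
      Nonempty (NormalizedIntegrals 𝕜 H) ∧
      Nonempty (NormalizedIntegrals 𝕜 (DrinfeldTwist F)) ∧
      ∀ (I : NormalizedIntegrals 𝕜 H) (J : NormalizedIntegrals 𝕜 (DrinfeldTwist F)),
        (lensDiagramR n k hk hkn hcop hodd).kuperberg I =
          (lensDiagramR n k hk hkn hcop hodd).kuperberg J := by
  obtain ⟨T, hT⟩ := HopfTrace.exists_antipodeInv 𝕜 H
  have h := HopfTrace.trace_shuffledSweedlerPower_twist F hT n k hkn hcop hodd
  refine ⟨h, HopfTrace.nonempty_normalizedIntegrals 𝕜 H,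
    HopfTrace.nonempty_normalizedIntegrals 𝕜 (DrinfeldTwist F), fun I J => ?_⟩
  rw [HopfTrace.kuperberg_lensDiagramR, HopfTrace.kuperberg_lensDiagramR, h]
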